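/- Let $p\ge 0$ be an integer and let $\{v_t\}_{t\in\mathbb Z}$ be the stationary solution of $$v_t=\beta_1v_{t-1}+\dots+\beta_pv_{t-p}+\nu+\varepsilon_t,\qquad t\in\mathbb Z,$$ where $\{\varepsilon_t\}$ are i.i.d. with distribution function $G$, $\mathbf E\varepsilon_1=0$, $0<\mathbf E\varepsilon_1^2<\infty$, and all roots of the characteristic equation $z^p=\beta_1z^{p-1}+\dots+\beta_p$ are less than one in modulus. Let $\delta(\beta)=1-\beta_1-\dots-\beta_p$ and define $\mu$ by $\nu=\delta(\beta)\mu$. For $\gamma\ge 0$ and $n\ge1$ the observations are $$y_t=v_t+z_t^{\gamma_n}\xi_t,\qquad t=1-p,\dots,n,\qquad \gamma_n=\min(1,\gamma/\sqrt n),$$ where $\{z_t^{\gamma_n}\}$ are i.i.d. Bernoulli variables equal to $1$ with probability $\gamma_n$ and to $0$ otherwise, $\{\xi_t\}$ are i.i.d. with an arbitrary distribution $\Pi$, and the sequences $\{v_t\}$, $\{z_t^{\gamma_n}\}$, $\{\xi_t\}$ are independent of each other. The distribution function $G$, the distribution $\Pi$ and the parameters $\beta_1,\dots,\beta_p,\nu$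 do not depend on $n$ or $\gamma$. Fix a finite $\Gamma\ge0$. Let $\hat\mu_n$ and $\hat\beta_n=(\hat\beta_{1n},\dots,\hat\beta_{pn})$ be any estimators (arbitrary random variables, for instance measurable functions of the observations) such that, as $n\to\infty$, $$n^{1/2}(\hat\mu_n-\mu)=O_P(1),\qquad n^{1/2}(\hat\beta_n-\beta)=O_P(1)\qquad\text{uniformly in } 0\le\gamma\le\Gamma;$$ that is, for each of the two sequences, say $X_n$, and every $\eta>0$ there are $M$ and $N$ with $\mathbf P(|X_n|>M)\le\eta$ for all $n\ge N$ and all $\gamma\in[0,\Gamma]$. Put $\hat u_t=y_t-\hat\mu_n$ for $t=1-p,\dots,n$, define the residuals $\hat\varepsilon_t=\hat u_t-\hat\beta_{1n}\hat u_{t-1}-\dots-\hat\beta_{pn}\hat u_{t-p}$, $t=1,\dots,n$, and let $$\hat G_n(x)=n^{-1}\sum_{t=1}^nI(\hat\varepsilon_t\le x),\qquad G_n(x)=n^{-1}\sum_{t=1}^nI(\varepsilon_t\le x).$$ Suppose that $G$ has a derivative $g=G'$, that $g$ is differentiable, and that $\sup_x|g'(x)|<\infty$. Then for every fixed $x\in\mathbb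 R$ and every $\delta>0$, $$\sup_{0\le\gamma\le\Gamma}\mathbf P\Bigl(\bigl|n^{1/2}[\hat G_n(x)-G_n(x)]-g(x)\,\delta(\beta)\,n^{1/2}(\hat\mu_n-\mu)-\gamma\Delta(x,\Pi)\bigr|>\delta\Bigr)\to0,\qquad n\to\infty,$$ where $$\Delta(x,\Pi)=\sum_{j=0}^p\bigl[\mathbf E\,G(x+\beta_j\xi_1)-G(x)\bigr],\qquad\beta_0=-1.$$ -/

import Mathlib

open MeasureTheory ProbabilityTheory Filter Topology

namespace AROutliers

noncomputable section

/-- The coefficient vector `b : Fin p → ℝ` stands for `(β₁, …, β_p)`, with `b j = β_{j+1}`.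
All complex roots of the characteristic equation `z ^ p = β₁ z ^ (p-1) + ⋯ + β_p`
have modulus less than one. -/
def CharRootsInsideDisk {p : ℕ} (b : Fin p → ℝ) : Prop :=
  ∀ z : ℂ, z ^ p = ∑ j : Fin p, (b j : ℂ) * z ^ (p - 1 - (j : ℕ)) → ‖z‖ < 1

/-- `δ(β) = 1 - β₁ - ⋯ - β_p`. -/
def delta {p : ℕ} (b : Fin p → ℝ) : ℝ := 1 - ∑ j : Fin p, b j

/-- The outlier intensity `min (1, γ / √n)`, as an element of `[0, 1]`. -/
def outlierProb (γ : ℝ) (n : ℕ) : unitInterval :=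
  Set.projIcc 0 1 zero_le_one (γ / Real.sqrt n)

theorem coe_outlierProb {γ : ℝ} (hγ : 0 ≤ γ) (n : ℕ) :
    (outlierProb γ n : ℝ) = min 1 (γ / Real.sqrt n) := by
  have h : 0 ≤ min 1 (γ / Real.sqrt n) := le_min zero_le_one (by positivity)
  simp only [outlierProb, Set.coe_projIcc]
  exact max_eq_right h

/-- A sequence of random variables is independent and identically distributed with law `L`. -/
structure IsIID {Ω : Type*} [MeasurableSpace Ω] (P : Measure Ω) (X : ℤ → Ω → ℝ)
    (L : Measure ℝ) : Prop where
  measurable : ∀ t, Measurable (X t)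
  indep : iIndepFun X P
  law : ∀ t, P.map (X t) = L

/-- `v` is a (strictly) stationary solution of
`v_t = β₁ v_{t-1} + ⋯ + β_p v_{t-p} + ν + ε_t`, `t ∈ ℤ`. -/
structure IsStationarySolution {Ω : Type*} [MeasurableSpace Ω] (P : Measure Ω) {p : ℕ}
    (b : Fin p → ℝ) (ν : ℝ) (ε v : ℤ → Ω → ℝ) : Prop where
  measurable : ∀ t, Measurable (v t)
  stationary : ∀ h : ℤ, P.map (fun ω (t : ℤ) => v (t + h) ω) = P.map (fun ω (t : ℤ) => v t ω)
  recursion : ∀ t, ∀ᵐ ω ∂P,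
    v t ω = ∑ j : Fin p, b j * v (t - ((j : ℕ) + 1 : ℤ)) ω + ν + ε t ω

/-- The stationary AR(`p`) model with outliers: i.i.d. innovations `ε` with law `Q`, a stationary
solution `v`, i.i.d. Bernoulli variables `z` that are `1` with probability `q`, i.i.d. outliers
`ξ` with law `L`, the sequences `v`, `z`, `ξ` being independent of each other. -/
structure IsModel {Ω : Type*} [MeasurableSpace Ω] (P : Measure Ω) {p : ℕ}
    (b : Fin p → ℝ) (ν : ℝ) (Q L : Measure ℝ) (q : unitInterval)
    (ε v z ξ : ℤ → Ω → ℝ) : Prop where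
  innovations : IsIID P ε Q
  solution : IsStationarySolution P b ν ε v
  bernoulli : IsIID P z (bernoulliMeasure 1 0 q)
  outliers : IsIID P ξ L
  indep : iIndepFun
    (![fun ω t => v t ω, fun ω t => z t ω, fun ω t => ξ t ω] : Fin 3 → Ω → ℤ → ℝ) P

/-- The observations `y_t = v_t + z_t ξ_t`. -/
def obs {Ω : Type*} (v z ξ : ℤ → Ω → ℝ) (ω : Ω) (t : ℤ) : ℝ := v t ω + z t ω * ξ t ω

/-- The residual `û_t - β̂₁ û_{t-1} - ⋯ - β̂_p û_{t-p}`, where `û_t = y_t - μ̂`. -/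
def arResidual {p : ℕ} (bhat : Fin p → ℝ) (μhat : ℝ) (y : ℤ → ℝ) (t : ℤ) : ℝ :=
  (y t - μhat) - ∑ j : Fin p, bhat j * (y (t - ((j : ℕ) + 1 : ℤ)) - μhat)

/-- The empirical distribution function of `e_1, …, e_n`. -/
def empiricalDF (e : ℤ → ℝ) (n : ℕ) (x : ℝ) : ℝ :=
  (n : ℝ)⁻¹ * ∑ t ∈ Finset.Icc (1 : ℤ) n, (Set.Iic x).indicator (fun _ => (1 : ℝ)) (e t)

/-- `Δ(x, L) = ∑_{j=0}^p [E G(x + β_j ξ₁) - G(x)]` with `β₀ = -1`, where `G` is the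
distribution function of `Q` and `ξ₁` has law `L`. -/
def shift {p : ℕ} (b : Fin p → ℝ) (Q L : Measure ℝ) (x : ℝ) : ℝ :=
  ∑ j : Fin (p + 1),
    ((∫ s, cdf Q (x + (Fin.cons (-1) b : Fin (p + 1) → ℝ) j * s) ∂L) - cdf Q x)

/-- `X_n = O_P(1)` as `n → ∞`, uniformly in `0 ≤ γ ≤ Γ`. -/
def IsBoundedInProbUniformly {E : Type*} [Norm E] {Ω : ℝ → ℕ → Type*}
    [∀ γ n, MeasurableSpace (Ω γ n)] (P : ∀ γ n, Measure (Ω γ n)) (Γ : ℝ)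
    (X : ∀ γ n, Ω γ n → E) : Prop :=
  ∀ η : ℝ, 0 < η → ∃ M : ℝ, ∃ N : ℕ, ∀ n ≥ N, ∀ γ ∈ Set.Icc 0 Γ,
    P γ n {ω | M < ‖X γ n ω‖} ≤ ENNReal.ofReal η

end

end AROutliers

/-! Write `τ = √n (μ̂ - μ)` and `θ = √n (β̂ - β)`. The residual equals `ε_t - ∑ c_i z_{t-i} ξ_{t-i}
- d_t`, with `c = (-1, β₁, …, β_p)` and a drift `d_t` of order `n^{-1/2}` (`arResidual_eq`).
Accordingly `√n (Ĝ_n - G_n)` splits into three parts (`abs_expansion_error_le`).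

Clean part: the drift computed from the outlier-free `v`. It involves the estimators, which may
depend on the whole sample, so no martingale argument applies directly. On `|τ|, ‖θ‖ ≤ M` a finite
net of mesh `η` is taken. The indicator is monotone in the shift, hence the process at the random
parameter lies between two processes whose shifts are deterministic functions of the past of `v`
(`abs_clean_process_sub_le`). For such a predictable shift the centred indicators are orthogonal
with second moments `O(n^{-1/2})`, and a Taylor expansion of `G` leaves `g(x)` times the average
shift (`integral_abs_sum_step_sub_le`). Since `v - μ` averages to `O(n^{-1/2})` in `L¹`, that
average shift is `τ δ(β)` up to `O(η)`. Predictability is not assumed of `v`: stationarity and the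
root condition force `v` to be a causal moving average of `ε`
(`IsStationarySolution.ae_eq_causalState`), which also supplies its second moments.

Outlier part: for each lag the effect of one isolated outlier has mean `γ_n [E G(x + β_j ξ) - G(x)]`
and second moment at most `γ_n`. Values at different times are independent, so the scaled sum is `√n
γ_n [⋯]` up to an `L¹` error `√γ_n` (`IsModel.integral_abs_sum_single_effect_le`). Summation over
lags gives `γ Δ(x, Π)`.

Remainder: the two effects interact only if the window `t-p, …, t` contains two outliers
(probability `O(γ_n²)`), or contains one while the innovation, contaminated or not, is within the
drift of `x` (probability `O(γ_n n^{-1/2})` once lagged values are bounded by `R`), or contains one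
while a lagged `v - μ` or `ξ` exceeds `R`. After scaling by `√n` the first two vanish and the last
is of size `Γ` times a tail that is small for large `R` (`abs_contamination_remainder_le`,
`IsModel.integral_remainderBound_le`).

All errors are dominated by one random variable free of the estimators, with expectation bounded
through `Γ` only. Markov's inequality then gives uniformity in `γ`. -/

namespace AROutliers

/-! ### Geometric decay of the powers of the companion matrix. -/

section Companion

/-- The companion endomorphism of the recursion with coefficients `b`: it maps
`(w_{t-1}, …, w_{t-p})` to `(∑ b_j w_{t-j}, w_{t-1}, …, w_{t-p+1})`. -/
def companion {R : Type*} [CommSemiring R] {p : ℕ} (b : Fin p → R) :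
    Module.End R (Fin p → R) where
  toFun v i := if (i : ℕ) = 0 then ∑ j, b j * v j else v ⟨i - 1, by omega⟩
  map_add' u v := by
    ext i
    by_cases hi : (i : ℕ) = 0 <;> simp [hi, mul_add, Finset.sum_add_distrib]
  map_smul' c v := by
    ext i
    by_cases hi : (i : ℕ) = 0 <;> simp [hi, Finset.mul_sum, mul_left_comm]

theorem companion_apply {R : Type*} [CommSemiring R] {p : ℕ} (b v : Fin p → R) (i : Fin p) :
    companion b v i = if (i : ℕ) = 0 then ∑ j, b j * v j else v ⟨i - 1, by omega⟩ := rfl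

/-- Below the first row the eigenvalue equation reads `v_{i-1} = z v_i`, so every coordinate is a
power of `z` times the last one. The last one is therefore nonzero, and the first row becomes the
characteristic equation. -/
theorem companion_eigenvector {p : ℕ} (c : Fin p → ℂ) (z : ℂ) (v : Fin p → ℂ) (hv : v ≠ 0)
    (h : companion c v = z • v) : z ^ p = ∑ j : Fin p, c j * z ^ (p - 1 - (j : ℕ)) := by
  have hp : 0 < p := by
    rcases Nat.eq_zero_or_pos p with rfl | h0
    · exact absurd (Subsingleton.elim v 0) hv
    · exact h0
  have key : ∀ k (hk : k < p), v ⟨p - 1 - k, by omega⟩ = z ^ k * v ⟨p - 1, by omega⟩ := by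
    intro k
    induction k with
    | zero => intro hk; simp
    | succ k ih =>
      intro hk
      have h1 := congrFun h ⟨p - 1 - k, by omega⟩
      rw [companion_apply, if_neg (by simp; omega)] at h1
      have h2 : (⟨p - 1 - (k + 1), by omega⟩ : Fin p) = ⟨p - 1 - k - 1, by omega⟩ := by
        ext; simp; omega
      rw [h2, h1, Pi.smul_apply, ih (by omega), smul_eq_mul, pow_succ']
      ring
  have key' : ∀ j : Fin p, v j = z ^ (p - 1 - (j : ℕ)) * v ⟨p - 1, by omega⟩ := by
    intro j
    rw [← key (p - 1 - j) (by omega)]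
    congr 1
    ext; simp; omega
  have hlast : v ⟨p - 1, by omega⟩ ≠ 0 := by
    intro h0
    apply hv
    ext j
    rw [key' j, h0]; simp
  have h0 := congrFun h ⟨0, hp⟩
  rw [companion_apply, if_pos rfl, Pi.smul_apply, key' ⟨0, hp⟩, smul_eq_mul, ← mul_assoc,
    ← pow_succ'] at h0
  have h3 : p - 1 - 0 + 1 = p := by omega
  simp only [h3] at h0
  apply mul_right_cancel₀ hlast
  rw [← h0, Finset.sum_mul]
  refine Finset.sum_congr rfl fun j _ => ?_
  rw [key' j, mul_assoc]

/-- Gelfand's formula: `‖a ^ m‖ ^ (1/m)` is eventually below any `r` strictly between the spectral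
radius and `1`. -/
theorem exists_norm_pow_le_of_spectralRadius_lt_one {A : Type*} [NormedRing A]
    [NormedAlgebra ℂ A] [CompleteSpace A] (a : A) (ha : spectralRadius ℂ a < 1) :
    ∃ C ρ : ℝ, 0 ≤ C ∧ 0 < ρ ∧ ρ < 1 ∧ ∀ m : ℕ, ‖a ^ m‖ ≤ C * ρ ^ m := by
  obtain ⟨r, hr1, hr2⟩ := ENNReal.lt_iff_exists_nnreal_btwn.1 ha
  have hr2' : r < 1 := by exact_mod_cast hr2
  have hr0 : 0 < r := by
    have := lt_of_le_of_lt (zero_le) hr1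
    exact_mod_cast this
  have h := spectrum.pow_nnnorm_pow_one_div_tendsto_nhds_spectralRadius a
  have h1 := (h.eventually (gt_mem_nhds hr1)).and (eventually_gt_atTop 0)
  obtain ⟨N, hN⟩ := eventually_atTop.1 h1
  have hr0' : (0 : ℝ) < r := by exact_mod_cast hr0
  -- The sum absorbs the finitely many powers before Gelfand's bound takes effect; the `1` serves
  -- all later powers.
  refine ⟨1 + ∑ k ∈ Finset.range N, ‖a ^ k‖ / (r : ℝ) ^ k, r, by positivity, hr0',
    by exact_mod_cast hr2', fun m => ?_⟩
  rcases lt_or_ge m N with hm | hm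
  · have : ‖a ^ m‖ / (r : ℝ) ^ m ≤ ∑ k ∈ Finset.range N, ‖a ^ k‖ / (r : ℝ) ^ k :=
      Finset.single_le_sum (f := fun k => ‖a ^ k‖ / (r : ℝ) ^ k) (fun k _ => by positivity)
        (Finset.mem_range.2 hm)
    rw [← div_le_iff₀ (by positivity)]
    linarith
  · obtain ⟨h2, h3⟩ := hN m hm
    have h4 : (‖a ^ m‖₊ : ENNReal) ≤ (r : ENNReal) ^ m := by
      have := ENNReal.rpow_le_rpow h2.le (Nat.cast_nonneg (α := ℝ) m)
      rwa [← ENNReal.rpow_mul, one_div, inv_mul_cancel₀ (by positivity), ENNReal.rpow_one,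
        ENNReal.rpow_natCast] at this
    have h5 : ‖a ^ m‖ ≤ (r : ℝ) ^ m := by
      have : ‖a ^ m‖₊ ≤ r ^ m := by exact_mod_cast h4
      exact_mod_cast this
    refine h5.trans (le_mul_of_one_le_left (by positivity) ?_)
    have : 0 ≤ ∑ k ∈ Finset.range N, ‖a ^ k‖ / (r : ℝ) ^ k := Finset.sum_nonneg fun k _ => by positivity
    linarith

theorem companion_ofReal {p : ℕ} (b : Fin p → ℝ) (v : Fin p → ℝ) (m : ℕ) :
    (companion (fun j => (b j : ℂ)) ^ m) (fun i => (v i : ℂ))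
      = fun i => (((companion b ^ m) v i : ℝ) : ℂ) := by
  induction m with
  | zero => rfl
  | succ m ih =>
    rw [pow_succ', pow_succ', Module.End.mul_apply, ih, Module.End.mul_apply]
    ext i
    simp only [companion_apply]
    split_ifs <;> simp

/-- Eigenvalues of the complexified companion map are characteristic roots, so its spectral radius
is below `1`. The sup norm of a real vector is unchanged by complexification, which brings the bound
back to `ℝ`. -/
theorem CharRootsInsideDisk.exists_norm_companion_pow_le {p : ℕ} {b : Fin p → ℝ}
    (hb : CharRootsInsideDisk b) :
    ∃ C ρ : ℝ, 0 ≤ C ∧ 0 < ρ ∧ ρ < 1 ∧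
      ∀ (m : ℕ) (v : Fin p → ℝ), ‖(companion b ^ m) v‖ ≤ C * ρ ^ m * ‖v‖ := by
  set T : Module.End ℂ (Fin p → ℂ) := companion (fun j => (b j : ℂ)) with hT
  set A : (Fin p → ℂ) →L[ℂ] (Fin p → ℂ) := Module.End.toContinuousLinearMap _ T with hA
  have hspec : spectrum ℂ A = spectrum ℂ T := AlgEquiv.spectrum_eq _ T
  have hrad : spectralRadius ℂ A < 1 := by
    rcases Nat.eq_zero_or_pos p with rfl | hp
    · have : Subsingleton ((Fin 0 → ℂ) →L[ℂ] (Fin 0 → ℂ)) := ⟨fun f g => by ext _ i; exact i.elim0⟩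
      rw [Subsingleton.elim A 0]
      simp
    · have : Nonempty (Fin p) := ⟨⟨0, hp⟩⟩
      refine spectrum.spectralRadius_lt_of_forall_lt _ (r := 1) fun z hz => ?_
      rw [hspec, ← Module.End.hasEigenvalue_iff_mem_spectrum] at hz
      obtain ⟨v, hv⟩ := hz.exists_hasEigenvector
      have := hb z (companion_eigenvector _ z v hv.2 hv.apply_eq_smul)
      exact_mod_cast this
  obtain ⟨C, ρ, hC, hρ0, hρ1, hbound⟩ := exists_norm_pow_le_of_spectralRadius_lt_one A hrad
  refine ⟨C, ρ, hC, hρ0, hρ1, fun m v => ?_⟩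
  have h1 : ∀ u : Fin p → ℝ, ‖u‖ = ‖fun i => (u i : ℂ)‖ := by
    intro u
    simp [Pi.norm_def]
  have h2 : (A ^ m) (fun i => (v i : ℂ)) = (T ^ m) (fun i => (v i : ℂ)) := by
    rw [hA, ← map_pow]; rfl
  rw [h1 v, h1, ← companion_ofReal, ← hT, ← h2]
  exact ((A ^ m).le_opNorm _).trans (by gcongr; exact hbound m)

/-- Otherwise `1` would be a characteristic root. This permits division by `δ(β)` when the sample
mean of `v` is estimated. -/
theorem CharRootsInsideDisk.delta_ne_zero {p : ℕ} {b : Fin p → ℝ}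
    (hb : CharRootsInsideDisk b) : delta b ≠ 0 := by
  intro h
  have := hb 1 (by
    have h2 : ∑ j, b j = 1 := by unfold delta at h; linarith
    simp only [one_pow, mul_one]
    rw [← Complex.ofReal_sum, h2, Complex.ofReal_one])
  simp at this

end Companion

/-! ### Indicator functions, orthogonal sums and integration over an independent variable. -/

section Step

/-- The indicator of `e ≤ x`, as a real number. -/
noncomputable def step (x e : ℝ) : ℝ := (Set.Iic x).indicator (fun _ => (1 : ℝ)) e

theorem step_eq_ite (x e : ℝ) : step x e = if e ≤ x then 1 else 0 := by
  simp [step, Set.indicator_apply]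

theorem step_nonneg (x e : ℝ) : 0 ≤ step x e := by
  rw [step_eq_ite]; split_ifs <;> norm_num

theorem step_le_one (x e : ℝ) : step x e ≤ 1 := by
  rw [step_eq_ite]; split_ifs <;> norm_num

theorem abs_step_le_one (x e : ℝ) : |step x e| ≤ 1 := by
  rw [abs_of_nonneg (step_nonneg x e)]; exact step_le_one x e

theorem step_antitone (x : ℝ) : Antitone (step x) := by
  intro a b hab
  rw [step_eq_ite, step_eq_ite]
  split_ifs <;> first | (norm_num; done) | (exfalso; linarith)

theorem measurable_step (x : ℝ) : Measurable (step x) :=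
  measurable_const.indicator measurableSet_Iic

theorem abs_step_sub_step_le_one (x e e' : ℝ) : |step x e - step x e'| ≤ 1 := by
  rw [abs_le]
  constructor <;> linarith [step_nonneg x e, step_le_one x e, step_nonneg x e', step_le_one x e']

/-- Two step functions evaluated at points at distance at most `r` only differ if the first point is
within `r` of the threshold. -/
theorem abs_step_sub_step_le {x e e' r : ℝ} (h : |e' - e| ≤ r) :
    |step x e' - step x e| ≤ if |e - x| ≤ r then 1 else 0 := by
  have h1 := abs_le.1 h
  split_ifs with h2
  · exact abs_step_sub_step_le_one x e' e
  · rw [step_eq_ite, step_eq_ite]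
    rcases lt_abs.1 (not_le.1 h2) with h3 | h3
    · rw [if_neg (by linarith), if_neg (by linarith)]; simp
    · rw [if_pos (by linarith), if_pos (by linarith)]; simp

theorem integrable_of_abs_le {Ω : Type*} [MeasurableSpace Ω] {P : Measure Ω} [IsFiniteMeasure P]
    {X : Ω → ℝ} (hX : Measurable X) {c : ℝ} (h : ∀ ω, |X ω| ≤ c) : Integrable X P :=
  Integrable.of_bound hX.aestronglyMeasurable c (ae_of_all _ h)

theorem memLp_two_of_abs_le {Ω : Type*} [MeasurableSpace Ω] {P : Measure Ω} [IsFiniteMeasure P]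
    {X : Ω → ℝ} (hX : Measurable X) {c : ℝ} (h : ∀ ω, |X ω| ≤ c) : MemLp X 2 P :=
  MemLp.of_bound hX.aestronglyMeasurable c (ae_of_all _ h)

theorem integral_abs_le_sqrt {Ω : Type*} [MeasurableSpace Ω] {P : Measure Ω}
    [IsProbabilityMeasure P] {X : Ω → ℝ} (hX : MemLp X 2 P) :
    ∫ ω, |X ω| ∂P ≤ √(∫ ω, X ω ^ 2 ∂P) := by
  have h := variance_nonneg |X| P
  rw [variance_eq_sub hX.abs] at h
  apply Real.le_sqrt_of_sq_le
  simp only [Pi.pow_apply, Pi.abs_apply, sq_abs] at h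
  linarith

/-- Pythagoras in `L²` followed by Cauchy–Schwarz. It serves for martingale differences, for i.i.d.
innovations and for the outlier effects. -/
theorem integral_abs_sum_le_sqrt {Ω ι : Type*} [MeasurableSpace Ω] {P : Measure Ω}
    [IsProbabilityMeasure P] (s : Finset ι) {D : ι → Ω → ℝ} (hD : ∀ i ∈ s, MemLp (D i) 2 P)
    (horth : ∀ i ∈ s, ∀ j ∈ s, i ≠ j → ∫ ω, D i ω * D j ω ∂P = 0) :
    ∫ ω, |∑ i ∈ s, D i ω| ∂P ≤ √(∑ i ∈ s, ∫ ω, D i ω ^ 2 ∂P) := by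
  have hsum : MemLp (fun ω => ∑ i ∈ s, D i ω) 2 P := memLp_finsetSum s hD
  refine (integral_abs_le_sqrt hsum).trans (le_of_eq ?_)
  congr 1
  have h1 : ∀ ω, (∑ i ∈ s, D i ω) ^ 2 = ∑ i ∈ s, ∑ j ∈ s, D i ω * D j ω := by
    intro ω; rw [sq, Finset.sum_mul_sum]
  simp_rw [h1]
  have hint : ∀ i ∈ s, ∀ j ∈ s, Integrable (fun ω => D i ω * D j ω) P :=
    fun i hi j hj => (hD i hi).integrable_mul (hD j hj)
  rw [integral_finsetSum _ fun i hi => integrable_finsetSum _ (hint i hi)]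
  refine Finset.sum_congr rfl fun i hi => ?_
  rw [integral_finsetSum _ (hint i hi), Finset.sum_eq_single_of_mem i hi]
  · simp_rw [sq]
  · intro j hj hji
    exact horth i hi j hj hji.symm

/-- Fubini for the product law. It takes the place of conditioning on `X` throughout. -/
theorem integral_comp_of_indepFun {Ω S : Type*} [MeasurableSpace Ω] [MeasurableSpace S]
    {P : Measure Ω} [IsProbabilityMeasure P] {X : Ω → S} {Y : Ω → ℝ} {Q : Measure ℝ}
    (hX : Measurable X) (hY : Measurable Y) (hQ : P.map Y = Q) (hXY : IndepFun X Y P)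
    {F : S × ℝ → ℝ} (hF : Measurable F) {c : ℝ} (hc : ∀ y, |F y| ≤ c) :
    ∫ ω, F (X ω, Y ω) ∂P = ∫ ω, ∫ y, F (X ω, y) ∂Q ∂P := by
  have : IsProbabilityMeasure Q := hQ ▸ Measure.isProbabilityMeasure_map hY.aemeasurable
  have : IsProbabilityMeasure (P.map X) := Measure.isProbabilityMeasure_map hX.aemeasurable
  have h1 := (indepFun_iff_map_prod_eq_prod_map_map hX.aemeasurable hY.aemeasurable).1 hXY
  rw [← integral_map (φ := fun ω => (X ω, Y ω)) (hX.prodMk hY).aemeasurable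
    hF.aestronglyMeasurable, h1, hQ, integral_prod _ (integrable_of_abs_le hF hc),
    integral_map hX.aemeasurable]
  exact hF.stronglyMeasurable.integral_prod_right'.aestronglyMeasurable

end Step

/-! ### Smoothness of the distribution function and moments of centred indicators. -/

section Cdf

variable {Q : Measure ℝ}

theorem integral_step [IsProbabilityMeasure Q] (x a : ℝ) : ∫ e, step x (e - a) ∂Q = cdf Q (x + a) := by
  have : (fun e => step x (e - a)) = (Set.Iic (x + a)).indicator 1 := by
    ext e
    simp only [step_eq_ite, Set.indicator_apply, Set.mem_Iic, sub_le_iff_le_add, Pi.one_apply]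
  rw [this, integral_indicator_one measurableSet_Iic, cdf_eq_real]

/-- For a fixed sign of `a` the difference of the two indicators takes only the values `0` and one
of `±1`, so its square is its absolute value. -/
theorem integral_step_sub_step_sq [IsProbabilityMeasure Q] (x a : ℝ) :
    ∫ e, (step x (e - a) - step x e) ^ 2 ∂Q = |cdf Q (x + a) - cdf Q x| := by
  have hi : ∀ a, Integrable (fun e => step x (e - a)) Q := fun a =>
    integrable_of_abs_le ((measurable_step x).comp (measurable_id.sub_const a))
      fun _ => abs_step_le_one _ _
  have hi0 : Integrable (fun e => step x e) Q := by simpa using hi 0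
  have h0 : ∫ e, step x e ∂Q = cdf Q x := by simpa using integral_step (Q := Q) x 0
  rcases le_total 0 a with ha | ha
  · have h1 : ∀ e, (step x (e - a) - step x e) ^ 2 = step x (e - a) - step x e := by
      intro e
      rw [step_eq_ite, step_eq_ite]
      split_ifs <;> first | (norm_num; done) | (exfalso; linarith)
    simp_rw [h1]
    rw [integral_sub (hi a) hi0, integral_step, h0, abs_of_nonneg]
    exact sub_nonneg.2 (monotone_cdf Q (by linarith))
  · have h1 : ∀ e, (step x (e - a) - step x e) ^ 2 = step x e - step x (e - a) := by
      intro e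
      rw [step_eq_ite, step_eq_ite]
      split_ifs <;> first | (norm_num; done) | (exfalso; linarith)
    simp_rw [h1]
    rw [integral_sub hi0 (hi a), integral_step, h0, abs_of_nonpos, neg_sub]
    exact sub_nonpos.2 (monotone_cdf Q (by linarith))

theorem deriv_cdf_nonneg (x : ℝ) : 0 ≤ deriv (cdf Q) x := (monotone_cdf Q).deriv_nonneg

/-- The mean value inequality is applied twice: to `g`, and then to `G(y) - g(x) y`, whose
derivative is at most `C |h|` on the ball of radius `|h|`. Continuity of `g'` plays no role. -/
theorem abs_cdf_sub_sub_le (hG : Differentiable ℝ (cdf Q))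
    (hg : Differentiable ℝ (deriv (cdf Q))) {C : ℝ}
    (hC : ∀ s, |deriv (deriv (cdf Q)) s| ≤ C) (x h : ℝ) :
    |cdf Q (x + h) - cdf Q x - deriv (cdf Q) x * h| ≤ C * h ^ 2 := by
  have hC0 : 0 ≤ C := (abs_nonneg _).trans (hC 0)
  set F : ℝ → ℝ := fun y => cdf Q y - deriv (cdf Q) x * y with hF
  have hFd : ∀ y, HasDerivAt F (deriv (cdf Q) y - deriv (cdf Q) x) y := by
    intro y
    have := ((hG y).hasDerivAt).sub ((hasDerivAt_id y).const_mul (deriv (cdf Q) x))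
    rw [mul_one] at this
    exact this
  have h1 : ∀ y ∈ Metric.closedBall x |h|, ‖deriv F y‖ ≤ C * |h| := by
    intro y hy
    rw [(hFd y).deriv]
    have := Convex.norm_image_sub_le_of_norm_deriv_le (f := deriv (cdf Q)) (s := Set.univ)
      (fun z _ => hg z) (fun z _ => by rw [Real.norm_eq_abs]; exact hC z) convex_univ
      (Set.mem_univ x) (Set.mem_univ y)
    refine this.trans ?_
    gcongr
    simpa [dist_eq_norm] using hy
  have h2 := Convex.norm_image_sub_le_of_norm_deriv_le (f := F)
    (fun z _ => (hFd z).differentiableAt) h1 (convex_closedBall x |h|)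
    (x := x) (y := x + h) (by simp) (by simp [dist_eq_norm])
  simp only [hF, Real.norm_eq_abs, add_sub_cancel_left] at h2
  rw [mul_assoc, ← sq, sq_abs] at h2
  convert h2 using 2
  ring

/-- The expansion with increment `1` bounds `g(x)` by `G(x+1) - G(x) + C`; hence `G` is Lipschitz.
-/
theorem deriv_cdf_le [IsProbabilityMeasure Q] (hG : Differentiable ℝ (cdf Q))
    (hg : Differentiable ℝ (deriv (cdf Q))) {C : ℝ}
    (hC : ∀ s, |deriv (deriv (cdf Q)) s| ≤ C) (x : ℝ) : deriv (cdf Q) x ≤ 1 + C := by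
  have h1 := (abs_le.1 (abs_cdf_sub_sub_le hG hg hC x 1)).1
  have h2 := cdf_le_one Q (x + 1)
  have h3 := cdf_nonneg Q x
  linarith

theorem abs_cdf_sub_le [IsProbabilityMeasure Q] (hG : Differentiable ℝ (cdf Q))
    (hg : Differentiable ℝ (deriv (cdf Q))) {C : ℝ}
    (hC : ∀ s, |deriv (deriv (cdf Q)) s| ≤ C) (x y : ℝ) :
    |cdf Q y - cdf Q x| ≤ (1 + C) * |y - x| := by
  refine Convex.norm_image_sub_le_of_norm_deriv_le (f := cdf Q) (s := Set.univ)
      (fun z _ => hG z) (fun z _ => ?_) convex_univ (Set.mem_univ x) (Set.mem_univ y)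
  rw [Real.norm_eq_abs, abs_of_nonneg (deriv_cdf_nonneg z)]
  exact deriv_cdf_le hG hg hC z

/-- The difference of the indicators of `e ≤ x + a` and `e ≤ x`, centred with respect to `e`. -/
noncomputable def centredStep (Q : Measure ℝ) (x a e : ℝ) : ℝ :=
  step x (e - a) - step x e - (cdf Q (x + a) - cdf Q x)

theorem measurable_centredStep (x : ℝ) :
    Measurable fun q : ℝ × ℝ => centredStep Q x q.1 q.2 := by
  have := (monotone_cdf Q).measurable
  have := measurable_step x
  unfold centredStep
  fun_prop

theorem abs_centredStep_le (x a e : ℝ) : |centredStep Q x a e| ≤ 2 := by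
  have h1 := abs_le.1 (abs_step_sub_step_le_one x (e - a) e)
  have := cdf_le_one Q (x + a)
  have := cdf_le_one Q x
  have := cdf_nonneg Q (x + a)
  have := cdf_nonneg Q x
  unfold centredStep
  rw [abs_le]
  constructor <;> linarith

theorem integrable_step_sub_step [IsProbabilityMeasure Q] (x a : ℝ) :
    Integrable (fun e => step x (e - a) - step x e) Q :=
  integrable_of_abs_le (((measurable_step x).comp (measurable_id.sub_const a)).sub
    (measurable_step x)) fun _ => abs_step_sub_step_le_one _ _ _

theorem integral_step_sub_step [IsProbabilityMeasure Q] (x a : ℝ) :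
    ∫ e, (step x (e - a) - step x e) ∂Q = cdf Q (x + a) - cdf Q x := by
  have h0 := integral_step (Q := Q) x 0
  simp only [sub_zero, add_zero] at h0
  rw [integral_sub, integral_step, h0]
  · exact integrable_of_abs_le ((measurable_step x).comp (measurable_id.sub_const a))
      fun _ => abs_step_le_one _ _
  · exact integrable_of_abs_le (measurable_step x) fun _ => abs_step_le_one _ _

theorem integral_centredStep [IsProbabilityMeasure Q] (x a : ℝ) : ∫ e, centredStep Q x a e ∂Q = 0 := by
  unfold centredStep
  rw [integral_sub (integrable_step_sub_step x a) (integrable_const _), integral_step_sub_step]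
  simp

theorem integral_centredStep_sq_le [IsProbabilityMeasure Q] (x a : ℝ) :
    ∫ e, centredStep Q x a e ^ 2 ∂Q ≤ |cdf Q (x + a) - cdf Q x| := by
  set d := cdf Q (x + a) - cdf Q x with hd
  have h : ∀ e, centredStep Q x a e ^ 2
      = (step x (e - a) - step x e) ^ 2 - (2 * d * (step x (e - a) - step x e) - d ^ 2) := by
    intro e; unfold centredStep; ring
  have hi : Integrable (fun e => (step x (e - a) - step x e) ^ 2) Q := by
    refine integrable_of_abs_le (c := 1) ?_ ?_
    · exact (((measurable_step x).comp (measurable_id.sub_const a)).sub (measurable_step x)).pow_const 2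
    · intro e
      rw [abs_pow]
      exact pow_le_one₀ (abs_nonneg _) (abs_step_sub_step_le_one _ _ _)
  have hi2 := (integrable_step_sub_step (Q := Q) x a).const_mul (2 * d)
  simp_rw [h]
  have hi3 := hi2.sub (integrable_const (d ^ 2) (μ := Q))
  have e1 := integral_sub hi hi3
  have e2 := integral_sub hi2 (integrable_const (d ^ 2) (μ := Q))
  simp only [Pi.sub_apply] at e1 e2
  rw [e1, e2, integral_const_mul, integral_step_sub_step_sq, integral_step_sub_step]
  simp only [integral_const, probReal_univ, smul_eq_mul, one_mul, ← hd]
  nlinarith [sq_nonneg d]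

end Cdf

/-! ### Empirical processes with predictable shifts. -/

section Predictable

/-- Given `m`, everything except `ε₂` is frozen, and the second factor integrates to zero in `ε₂`.
-/
theorem integral_centredStep_mul_eq_zero {Ω : Type*} {m : MeasurableSpace Ω}
    [mΩ : MeasurableSpace Ω] {P : Measure Ω} [IsProbabilityMeasure P] {Q : Measure ℝ}
    [IsProbabilityMeasure Q] {ε₁ ε₂ a₁ a₂ : Ω → ℝ}
    (hm : m ≤ mΩ) (hε₁ : Measurable[m] ε₁) (ha₁ : Measurable[m] a₁) (ha₂ : Measurable[m] a₂)
    (hε₂ : Measurable ε₂) (hQ : P.map ε₂ = Q)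
    (hind : Indep m (MeasurableSpace.comap ε₂ inferInstance) P) (x : ℝ) :
    ∫ ω, centredStep Q x (a₁ ω) (ε₁ ω) * centredStep Q x (a₂ ω) (ε₂ ω) ∂P = 0 := by
  have hX : Measurable[m] fun ω => (centredStep Q x (a₁ ω) (ε₁ ω), a₂ ω) := by
    exact (((measurable_centredStep x).comp (ha₁.prodMk hε₁))).prodMk ha₂
  have hind' : IndepFun (fun ω => (centredStep Q x (a₁ ω) (ε₁ ω), a₂ ω)) ε₂ P := by
    rw [IndepFun_iff_Indep]
    exact indep_of_indep_of_le_left hind hX.comap_le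
  have hF : Measurable fun y : (ℝ × ℝ) × ℝ =>
      max (-2) (min 2 y.1.1) * centredStep Q x y.1.2 y.2 := by
    have := (measurable_centredStep (Q := Q) x).comp
      ((measurable_snd.comp measurable_fst).prodMk measurable_snd :
        Measurable fun y : (ℝ × ℝ) × ℝ => (y.1.2, y.2))
    refine Measurable.mul ?_ this
    fun_prop
  have hc : ∀ y : (ℝ × ℝ) × ℝ, |max (-2) (min 2 y.1.1) * centredStep Q x y.1.2 y.2| ≤ 2 * 2 := by
    intro y
    rw [abs_mul]
    refine mul_le_mul ?_ (abs_centredStep_le _ _ _) (abs_nonneg _) (by norm_num)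
    rw [abs_le]
    exact ⟨le_max_left _ _, max_le (by norm_num) (min_le_left _ _)⟩
  have h := integral_comp_of_indepFun (hX.mono hm le_rfl) hε₂ hQ hind' hF hc
  simp only at h
  simp_rw [integral_const_mul, integral_centredStep, mul_zero, integral_zero] at h
  rw [← h]
  refine integral_congr_ae (ae_of_all _ fun ω => ?_)
  have := abs_le.1 (abs_centredStep_le (Q := Q) x (a₁ ω) (ε₁ ω))
  simp only
  rw [min_eq_right this.2, max_eq_right this.1]

/-- Each summand is a centred indicator plus `G(x + a_t/√n) - G(x)`. The centred terms are
orthogonal with second moment at most `(1 + C) E|a_t| / √n`, which gives the square root, of order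
`n^{-1/4}`. The Taylor remainders, at most `C a_t² / n` each, give the last term. -/
theorem integral_abs_sum_step_sub_le {Ω : Type*} [mΩ : MeasurableSpace Ω]
    {P : Measure Ω} [IsProbabilityMeasure P] {Q : Measure ℝ} [IsProbabilityMeasure Q] (hG : Differentiable ℝ (cdf Q))
    (hg : Differentiable ℝ (deriv (cdf Q))) {C : ℝ}
    (hC : ∀ s, |deriv (deriv (cdf Q)) s| ≤ C) (x : ℝ) {n : ℕ} (hn : 1 ≤ n)
    {𝓕 : ℤ → MeasurableSpace Ω} (hmono : Monotone 𝓕) (hle : ∀ t, 𝓕 t ≤ mΩ)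
    {ε a : ℤ → Ω → ℝ} (hε : ∀ t, Measurable[𝓕 t] (ε t)) (ha : ∀ t, Measurable[𝓕 (t - 1)] (a t))
    (hQ : ∀ t, P.map (ε t) = Q)
    (hind : ∀ t, Indep (𝓕 (t - 1)) (MeasurableSpace.comap (ε t) inferInstance) P)
    (ha2 : ∀ t, MemLp (a t) 2 P) {K : ℝ} (hK : ∀ t, ∫ ω, a t ω ^ 2 ∂P ≤ K) :
    ∫ ω, |(√n)⁻¹ * ∑ t ∈ Finset.Icc (1 : ℤ) n, (step x (ε t ω - a t ω / √n) - step x (ε t ω))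
        - deriv (cdf Q) x * ((n : ℝ)⁻¹ * ∑ t ∈ Finset.Icc (1 : ℤ) n, a t ω)| ∂P
      ≤ √((1 + C) * √K / √n) + C * K / √n := by
  have hC0 : 0 ≤ C := (abs_nonneg _).trans (hC 0)
  have hn0 : (0 : ℝ) < n := by exact_mod_cast hn
  have hs0 : (0 : ℝ) < √n := Real.sqrt_pos.2 hn0
  have hss : √(n : ℝ) * √n = n := Real.mul_self_sqrt hn0.le
  have hεm : ∀ t, Measurable (ε t) := fun t => (hε t).mono (hle t) le_rfl
  have ham : ∀ t, Measurable (a t) := fun t => (ha t).mono (hle _) le_rfl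
  have hcard : (Finset.Icc (1 : ℤ) n).card = n := by simp
  set D : ℤ → Ω → ℝ := fun t ω => centredStep Q x (a t ω / √n) (ε t ω) with hD
  set r : ℤ → Ω → ℝ := fun t ω =>
    cdf Q (x + a t ω / √n) - cdf Q x - deriv (cdf Q) x * (a t ω / √n) with hr
  have hDm : ∀ t, Measurable (D t) := fun t =>
    (measurable_centredStep x).comp (((ham t).div_const _).prodMk (hεm t))
  have hrm : ∀ t, Measurable (r t) := by
    intro t
    have h1 := (monotone_cdf Q).measurable
    have h2 := ham t
    simp only [hr]
    fun_prop
  have hD2 : ∀ t, MemLp (D t) 2 P := fun t => memLp_two_of_abs_le (hDm t)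
    fun ω => abs_centredStep_le _ _ _
  have hrle : ∀ t ω, |r t ω| ≤ C * (a t ω ^ 2 / n) := by
    intro t ω
    have := abs_cdf_sub_sub_le hG hg hC x (a t ω / √n)
    rwa [div_pow, Real.sq_sqrt hn0.le] at this
  have hri : ∀ t, Integrable (r t) P := by
    intro t
    refine Integrable.mono' (((ha2 t).integrable_sq.div_const (n : ℝ)).const_mul C)
      (hrm t).aestronglyMeasurable (ae_of_all _ fun ω => ?_)
    exact hrle t ω
  have hpt : ∀ ω, |(√n)⁻¹ * ∑ t ∈ Finset.Icc (1 : ℤ) n,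
        (step x (ε t ω - a t ω / √n) - step x (ε t ω))
        - deriv (cdf Q) x * ((n : ℝ)⁻¹ * ∑ t ∈ Finset.Icc (1 : ℤ) n, a t ω)|
      ≤ (√n)⁻¹ * |∑ t ∈ Finset.Icc (1 : ℤ) n, D t ω|
        + (√n)⁻¹ * ∑ t ∈ Finset.Icc (1 : ℤ) n, |r t ω| := by
    intro ω
    have h1 : (√n)⁻¹ * ∑ t ∈ Finset.Icc (1 : ℤ) n,
        (step x (ε t ω - a t ω / √n) - step x (ε t ω))
        - deriv (cdf Q) x * ((n : ℝ)⁻¹ * ∑ t ∈ Finset.Icc (1 : ℤ) n, a t ω)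
      = (√n)⁻¹ * ∑ t ∈ Finset.Icc (1 : ℤ) n, D t ω
        + (√n)⁻¹ * ∑ t ∈ Finset.Icc (1 : ℤ) n, r t ω := by
      simp only [hD, hr, centredStep, Finset.sum_sub_distrib, ← Finset.mul_sum, ← Finset.sum_div]
      have h2 : (n : ℝ)⁻¹ = (√n)⁻¹ * (√n)⁻¹ := by rw [← mul_inv, hss]
      rw [h2, div_eq_mul_inv]
      ring
    rw [h1]
    refine (abs_add_le _ _).trans (add_le_add ?_ ?_)
    · rw [abs_mul, abs_of_pos (inv_pos.2 hs0)]
    · rw [abs_mul, abs_of_pos (inv_pos.2 hs0)]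
      gcongr
      exact Finset.abs_sum_le_sum_abs _ _
  have hDsq : ∀ t, ∫ ω, D t ω ^ 2 ∂P ≤ (1 + C) * √K / √n := by
    intro t
    have hind' : IndepFun (fun ω => a t ω / √n) (ε t) P := by
      rw [IndepFun_iff_Indep]
      exact indep_of_indep_of_le_left (hind t)
        ((ha t).div_const (√n : ℝ)).comap_le
    have h := integral_comp_of_indepFun (F := fun y : ℝ × ℝ => centredStep Q x y.1 y.2 ^ 2)
      ((ham t).div_const _) (hεm t) (hQ t) hind' ((measurable_centredStep x).pow_const 2)
      (c := 2 ^ 2) (fun y => by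
        rw [abs_pow]; exact pow_le_pow_left₀ (abs_nonneg _) (abs_centredStep_le _ _ _) 2)
    simp only at h
    simp only [hD]
    rw [h]
    have hai : Integrable (a t) P := (ha2 t).integrable one_le_two
    have h3 : ∫ ω, ∫ y, centredStep Q x (a t ω / √n) y ^ 2 ∂Q ∂P
        ≤ ∫ ω, (1 + C) * (|a t ω| / √n) ∂P := by
      refine integral_mono_of_nonneg (ae_of_all _ fun ω => integral_nonneg fun y => sq_nonneg _)
        ((hai.abs.div_const _).const_mul _) (ae_of_all _ fun ω => ?_)
      refine (integral_centredStep_sq_le x (a t ω / √n)).trans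
        ((abs_cdf_sub_le hG hg hC x _).trans (le_of_eq ?_))
      rw [add_sub_cancel_left, abs_div, abs_of_pos hs0]
    refine h3.trans ?_
    rw [integral_const_mul, integral_div, mul_div_assoc]
    gcongr
    exact (integral_abs_le_sqrt (ha2 t)).trans (Real.sqrt_le_sqrt (hK t))
  have hDorth : ∀ i ∈ Finset.Icc (1 : ℤ) n, ∀ j ∈ Finset.Icc (1 : ℤ) n, i ≠ j →
      ∫ ω, D i ω * D j ω ∂P = 0 := by
    have key : ∀ i j : ℤ, i < j → ∫ ω, D i ω * D j ω ∂P = 0 := by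
      intro i j hij
      have h1 : 𝓕 i ≤ 𝓕 (j - 1) := hmono (by omega)
      have h2 : 𝓕 (i - 1) ≤ 𝓕 (j - 1) := hmono (by omega)
      exact integral_centredStep_mul_eq_zero (hle (j - 1)) ((hε i).mono h1 le_rfl)
        ((((ha i).mono h2 le_rfl)).div_const _) ((ha j).div_const _) (hεm j) (hQ j) (hind j) x
    intro i _ j _ hij
    rcases lt_or_gt_of_ne hij with h | h
    · exact key i j h
    · rw [← key j i h]
      exact integral_congr_ae (ae_of_all _ fun ω => mul_comm _ _)
  have hDi : Integrable (fun ω => (√n)⁻¹ * |∑ t ∈ Finset.Icc (1 : ℤ) n, D t ω|) P :=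
    ((integrable_finsetSum _ fun t _ => (hD2 t).integrable one_le_two).abs).const_mul _
  have hRi : Integrable (fun ω => (√n)⁻¹ * ∑ t ∈ Finset.Icc (1 : ℤ) n, |r t ω|) P :=
    (integrable_finsetSum _ fun t _ => (hri t).abs).const_mul _
  refine (integral_mono_of_nonneg (ae_of_all _ fun ω => abs_nonneg _) (hDi.add hRi)
    (ae_of_all _ hpt)).trans ?_
  simp only [Pi.add_apply]
  rw [integral_add hDi hRi, integral_const_mul, integral_const_mul]
  refine add_le_add ?_ ?_
  · have h1 := integral_abs_sum_le_sqrt _ (fun t _ => hD2 t) hDorth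
    have h2 : ∑ t ∈ Finset.Icc (1 : ℤ) n, ∫ ω, D t ω ^ 2 ∂P ≤ n * ((1 + C) * √K / √n) := by
      refine (Finset.sum_le_sum fun t _ => hDsq t).trans (le_of_eq ?_)
      rw [Finset.sum_const, hcard, nsmul_eq_mul]
    calc _ ≤ (√n)⁻¹ * √(n * ((1 + C) * √K / √n)) := by
          gcongr
          exact h1.trans (Real.sqrt_le_sqrt h2)
      _ = _ := by
          rw [Real.sqrt_mul hn0.le, inv_mul_cancel_left₀ hs0.ne']
  · rw [integral_finsetSum _ fun t _ => (hri t).abs]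
    have h1 : ∀ t, ∫ ω, |r t ω| ∂P ≤ C * (K / n) := by
      intro t
      refine (integral_mono_of_nonneg (ae_of_all _ fun ω => abs_nonneg _)
        (((ha2 t).integrable_sq.div_const (n : ℝ)).const_mul C) (ae_of_all _ (hrle t))).trans ?_
      rw [integral_const_mul, integral_div]
      gcongr
      exact hK t
    calc _ ≤ (√n)⁻¹ * (n * (C * (K / n))) := by
          gcongr
          refine (Finset.sum_le_sum fun t _ => h1 t).trans (le_of_eq ?_)
          rw [Finset.sum_const, hcard, nsmul_eq_mul]
      _ = _ := by field_simp

end Predictable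

/-! ### Causality and moments of the stationary solution. -/

section Causal

variable {Ω : Type*} [mΩ : MeasurableSpace Ω] {P : Measure Ω}
  {p : ℕ} {b : Fin p → ℝ} {Q : Measure ℝ} {ε v : ℤ → Ω → ℝ} {μ ν : ℝ}

/-- The first unit vector of `ℝ^p` (the zero vector if `p = 0`). -/
def firstUnit (p : ℕ) : Fin p → ℝ := fun i => if (i : ℕ) = 0 then 1 else 0

theorem norm_firstUnit_le (p : ℕ) : ‖firstUnit p‖ ≤ 1 := by
  refine (pi_norm_le_iff_of_nonneg zero_le_one).2 fun i => ?_
  unfold firstUnit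
  split_ifs <;> simp

/-- The σ-algebra generated by the innovations up to time `t`. -/
@[reducible] def innovationAlgebra {Ω : Type*} (ε : ℤ → Ω → ℝ) (t : ℤ) : MeasurableSpace Ω :=
  ⨆ s ∈ Set.Iic t, MeasurableSpace.comap (ε s) inferInstance

theorem innovationAlgebra_mono {Ω : Type*} (ε : ℤ → Ω → ℝ) : Monotone (innovationAlgebra ε) := by
  intro s t hst
  exact biSup_mono fun i hi => le_trans hi hst

theorem innovationAlgebra_le (hε : ∀ t, Measurable (ε t)) (t : ℤ) :
    innovationAlgebra ε t ≤ mΩ :=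
  iSup₂_le fun s _ => (hε s).comap_le

theorem measurable_innovation {Ω : Type*} {ε : ℤ → Ω → ℝ} {s t : ℤ} (hst : s ≤ t) :
    Measurable[innovationAlgebra ε t] (ε s) := by
  rw [measurable_iff_comap_le]
  exact le_iSup₂_of_le (f := fun s (_ : s ∈ Set.Iic t) =>
    MeasurableSpace.comap (ε s) inferInstance) s hst le_rfl

theorem IsIID.indep_innovationAlgebra (h : IsIID P ε Q) (t : ℤ) :
    Indep (innovationAlgebra ε (t - 1)) (MeasurableSpace.comap (ε t) inferInstance) P := by
  have h1 := indep_iSup_of_disjoint (fun s => (h.measurable s).comap_le) h.indep.iIndep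
    (S := Set.Iic (t - 1)) (T := {t}) (by
      rw [Set.disjoint_singleton_right, Set.mem_Iic]; omega)
  simpa [innovationAlgebra] using h1

theorem IsStationarySolution.recursion_centred (h : IsStationarySolution P b ν ε v)
    (hν : ν = delta b * μ) :
    ∀ᵐ ω ∂P, ∀ t, v t ω - μ = ∑ j : Fin p, b j * (v (t - ((j : ℕ) + 1 : ℤ)) ω - μ) + ε t ω := by
  rw [ae_all_iff]
  intro t
  filter_upwards [h.recursion t] with ω hω
  rw [hω, hν]
  simp only [mul_sub, Finset.sum_sub_distrib, ← Finset.sum_mul, delta]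
  ring

theorem state_recursion {w e : ℤ → ℝ}
    (h : ∀ t, w t = ∑ j : Fin p, b j * w (t - ((j : ℕ) + 1 : ℤ)) + e t) (t : ℤ) :
    (fun i : Fin p => w (t - (i : ℕ)))
      = companion b (fun i : Fin p => w (t - 1 - (i : ℕ))) + e t • firstUnit p := by
  ext i
  simp only [Pi.add_apply, companion_apply, Pi.smul_apply, firstUnit, smul_eq_mul]
  split_ifs with hi
  · rw [hi, Nat.cast_zero, sub_zero, h t, mul_one]
    congr 1
    refine Finset.sum_congr rfl fun j _ => ?_
    congr 2
    ring
  · have : ((((i : ℕ) - 1 : ℕ)) : ℤ) = (i : ℕ) - 1 := by omega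
    rw [this, mul_zero, add_zero]
    congr 1
    ring

theorem state_iterate {w e : ℤ → ℝ}
    (h : ∀ t, w t = ∑ j : Fin p, b j * w (t - ((j : ℕ) + 1 : ℤ)) + e t) (t : ℤ) (m : ℕ) :
    (fun i : Fin p => w (t - (i : ℕ)))
      = (companion b ^ m) (fun i : Fin p => w (t - m - (i : ℕ)))
        + ∑ k ∈ Finset.range m, e (t - k) • (companion b ^ k) (firstUnit p) := by
  induction m with
  | zero => simp
  | succ m ih =>
    rw [ih, state_recursion h (t - m), map_add, map_smul, Finset.sum_range_succ,
      ← Module.End.mul_apply, ← pow_succ]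
    have : t - m - 1 = t - ((m + 1 : ℕ) : ℤ) := by push_cast; ring
    rw [this]
    abel

/-- The causal moving average representation of the centred state. -/
noncomputable def causalState (b : Fin p → ℝ) (ε : ℤ → Ω → ℝ) (t : ℤ) (ω : Ω) : Fin p → ℝ :=
  ∑' k : ℕ, ε (t - k) ω • (companion b ^ k) (firstUnit p)

/-- The series is genuinely adapted to the innovations, whereas `v` itself agrees with an adapted
process only almost surely. -/
theorem measurable_causalState {Ω : Type*} {ε : ℤ → Ω → ℝ} (t : ℤ) :
    Measurable[innovationAlgebra ε t] (causalState b ε t) := by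
  refine @Measurable.tsum Ω (Fin p → ℝ) ℕ (innovationAlgebra ε t) _ _ _ _ _ _ _ _ _ _ _ _
    fun k => ?_
  exact (measurable_innovation (by omega)).smul_const _

theorem IsIID.eLpNorm_eq (h : IsIID P ε Q) (q : ENNReal) (t : ℤ) :
    eLpNorm (ε t) q P = eLpNorm id q Q := by
  rw [← h.law t, eLpNorm_map_measure measurable_id.aestronglyMeasurable
    (h.measurable t).aemeasurable]
  rfl

theorem IsIID.memLp (h : IsIID P ε Q) {q : ENNReal} (hQ : MemLp id q Q) (t : ℤ) :
    MemLp (ε t) q P :=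
  ⟨(h.measurable t).aestronglyMeasurable, by rw [h.eLpNorm_eq]; exact hQ.2⟩

theorem norm_companion_pow_firstUnit_le {C ρ : ℝ} (hC : 0 ≤ C) (hρ : 0 < ρ)
    (hT : ∀ (m : ℕ) (u : Fin p → ℝ), ‖(companion b ^ m) u‖ ≤ C * ρ ^ m * ‖u‖) (k : ℕ) :
    ‖(companion b ^ k) (firstUnit p)‖ ≤ C * ρ ^ k :=
  (hT k _).trans (mul_le_of_le_one_right (by positivity) (norm_firstUnit_le p))

/-- The norms have a finite expected sum, because `E|ε|` is constant in time and the coefficients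
decay geometrically. -/
theorem IsIID.ae_summable [IsProbabilityMeasure P] (h : IsIID P ε Q) (hQ : MemLp id 2 Q)
    {C ρ : ℝ} (hC : 0 ≤ C) (hρ : 0 < ρ) (hρ1 : ρ < 1)
    (hT : ∀ (m : ℕ) (u : Fin p → ℝ), ‖(companion b ^ m) u‖ ≤ C * ρ ^ m * ‖u‖) (t : ℤ) :
    ∀ᵐ ω ∂P, Summable fun k : ℕ => ε (t - k) ω • (companion b ^ k) (firstUnit p) := by
  have hε : ∀ s, Integrable (ε s) P := fun s => (h.memLp hQ s).integrable one_le_two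
  have hE : ∀ s, ∫ ω, ‖ε s ω‖ ∂P = ∫ y, ‖y‖ ∂Q := by
    intro s
    rw [← h.law s, integral_map (h.measurable s).aemeasurable]
    exact measurable_norm.aestronglyMeasurable
  have hmeas : ∀ k : ℕ, Measurable fun ω => ‖ε (t - k) ω‖ₑ * ENNReal.ofReal (C * ρ ^ k) :=
    fun k => (h.measurable _).enorm.mul_const _
  have hfin : ∫⁻ ω, ∑' k : ℕ, ‖ε (t - k) ω‖ₑ * ENNReal.ofReal (C * ρ ^ k) ∂P ≠ ⊤ := by
    rw [lintegral_tsum fun k => (hmeas k).aemeasurable]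
    have h1 : ∀ k : ℕ, ∫⁻ ω, ‖ε (t - k) ω‖ₑ * ENNReal.ofReal (C * ρ ^ k) ∂P
        = ENNReal.ofReal ((∫ y, ‖y‖ ∂Q) * (C * ρ ^ k)) := by
      intro k
      rw [lintegral_mul_const _ (h.measurable _).enorm, ← ofReal_integral_norm_eq_lintegral_enorm
        (hε _), hE, ENNReal.ofReal_mul (integral_nonneg fun _ => norm_nonneg _)]
    simp_rw [h1]
    have hs : Summable fun k : ℕ => (∫ y, ‖y‖ ∂Q) * (C * ρ ^ k) :=
      ((summable_geometric_of_lt_one hρ.le hρ1).mul_left C).mul_left _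
    rw [← ENNReal.ofReal_tsum_of_nonneg (fun k => mul_nonneg
      (integral_nonneg fun _ => norm_nonneg _) (by positivity)) hs]
    exact ENNReal.ofReal_ne_top
  filter_upwards [ae_lt_top (Measurable.tsum hmeas) hfin] with ω hω
  refine Summable.of_norm_bounded (g := fun k : ℕ => ‖ε (t - k) ω‖ * (C * ρ ^ k)) ?_ fun k => ?_
  · have h2 : (fun k : ℕ => ‖ε (t - k) ω‖ * (C * ρ ^ k))
        = fun k : ℕ => (‖ε (t - k) ω‖ₑ * ENNReal.ofReal (C * ρ ^ k)).toReal := by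
      ext k
      rw [ENNReal.toReal_mul, toReal_enorm, ENNReal.toReal_ofReal (by positivity)]
    rw [h2]
    exact ENNReal.summable_toReal hω.ne
  · rw [norm_smul]
    gcongr
    exact norm_companion_pow_firstUnit_le hC hρ hT k

theorem IsStationarySolution.measure_norm_state [IsProbabilityMeasure P]
    (h : IsStationarySolution P b ν ε v) (t : ℤ) (r c : ℝ) :
    P {ω | r ≤ ‖c * ‖fun i : Fin p => v (t - (i : ℕ)) ω - μ‖‖}
      = P {ω | r ≤ ‖c * ‖fun i : Fin p => v (0 - (i : ℕ)) ω - μ‖‖} := by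
  have hm : MeasurableSet {f : ℤ → ℝ | r ≤ ‖c * ‖fun i : Fin p => f (0 - (i : ℕ)) - μ‖‖} := by
    refine measurableSet_le measurable_const (Measurable.norm (Measurable.const_mul
      (Measurable.norm ?_) _))
    fun_prop
  have h1 := congrArg (fun M : Measure (ℤ → ℝ) =>
    M {f : ℤ → ℝ | r ≤ ‖c * ‖fun i : Fin p => f (0 - (i : ℕ)) - μ‖‖}) (h.stationary t)
  rw [Measure.map_apply (measurable_pi_lambda _ fun s => h.measurable _) hm,
    Measure.map_apply (measurable_pi_lambda _ fun s => h.measurable _) hm] at h1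
  simp only [Set.preimage_ofPred_eq] at h1
  rw [← h1]
  congr 1
  ext ω
  have : (fun i : Fin p => v (t - (i : ℕ)) ω - μ) = fun i : Fin p => v (0 - (i : ℕ) + t) ω - μ := by
    ext i; congr 3; ring
  rw [Set.mem_ofPred_eq, Set.mem_ofPred_eq, this]

/-- Iterating the recursion `m` times leaves the partial sum of the series and a remainder of norm
at most `C ρ^m` times the norm of the state at time `t - m`. By stationarity that norm is
distributed as at time `0`, so the remainder tends to zero in probability, and limits in probability
are almost surely unique. -/
theorem IsStationarySolution.ae_eq_causalState [IsProbabilityMeasure P]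
    (h : IsStationarySolution P b ν ε v) (hν : ν = delta b * μ) (hε : IsIID P ε Q)
    (hQ : MemLp id 2 Q) {C ρ : ℝ} (hC : 0 ≤ C) (hρ : 0 < ρ) (hρ1 : ρ < 1)
    (hT : ∀ (m : ℕ) (u : Fin p → ℝ), ‖(companion b ^ m) u‖ ≤ C * ρ ^ m * ‖u‖) (t : ℤ) :
    ∀ᵐ ω ∂P, causalState b ε t ω = fun i : Fin p => v (t - (i : ℕ)) ω - μ := by
  set S : ℕ → Ω → Fin p → ℝ := fun m ω =>
    ∑ k ∈ Finset.range m, ε (t - k) ω • (companion b ^ k) (firstUnit p) with hS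
  have hSm : ∀ m, Measurable (S m) := by
    intro m
    exact Finset.measurable_fun_sum _ fun k _ => (hε.measurable _).smul_const _
  have h1 : TendstoInMeasure P S atTop (causalState b ε t) := by
    refine tendstoInMeasure_of_tendsto_ae (fun m => (hSm m).aestronglyMeasurable) ?_
    filter_upwards [hε.ae_summable hQ hC hρ hρ1 hT t] with ω hω
    exact hω.hasSum.tendsto_sum_nat
  have h2 : TendstoInMeasure P S atTop fun ω => fun i : Fin p => v (t - (i : ℕ)) ω - μ := by
    have h0 : TendstoInMeasure P
        (fun (m : ℕ) ω => C * ρ ^ m * ‖fun i : Fin p => v (0 - (i : ℕ)) ω - μ‖) atTop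
        (fun _ => (0 : ℝ)) := by
      refine tendstoInMeasure_of_tendsto_ae (fun m => ?_) (ae_of_all _ fun ω => ?_)
      · refine Measurable.aestronglyMeasurable (Measurable.const_mul (Measurable.norm ?_) _)
        exact measurable_pi_lambda _ fun i => (h.measurable _).sub_const _
      · have := ((tendsto_pow_atTop_nhds_zero_of_lt_one hρ.le hρ1).const_mul C).mul_const
          ‖fun i : Fin p => v (0 - (i : ℕ)) ω - μ‖
        simpa using this
    rw [tendstoInMeasure_iff_norm] at h0 ⊢
    intro r hr
    have h3 := h0 r hr
    simp only [sub_zero] at h3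
    refine tendsto_of_tendsto_of_tendsto_of_le_of_le tendsto_const_nhds h3
      (fun _ => zero_le) fun m => ?_
    simp only
    rw [← h.measure_norm_state (t - m)]
    refine measure_mono_ae ?_
    filter_upwards [h.recursion_centred hν] with ω hω hr'
    change r ≤ _ at hr'
    change r ≤ _
    refine hr'.trans ?_
    have := state_iterate (w := fun t => v t ω - μ) hω t m
    rw [this]
    simp only [hS, sub_add_cancel_right, norm_neg]
    exact (hT m _).trans (le_abs_self _)
  exact tendstoInMeasure_ae_unique h1 h2

/-- Minkowski for the partial sums with a geometric series of coefficients, and Fatou for the limit.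
No moment of `v` has to be assumed. -/
theorem eLpNorm_causalState_le [IsProbabilityMeasure P] (hε : IsIID P ε Q)
    (hQ : MemLp id 2 Q) {C ρ : ℝ} (hC : 0 ≤ C) (hρ : 0 < ρ) (hρ1 : ρ < 1)
    (hT : ∀ (m : ℕ) (u : Fin p → ℝ), ‖(companion b ^ m) u‖ ≤ C * ρ ^ m * ‖u‖) (t : ℤ)
    (i : Fin p) :
    eLpNorm (fun ω => causalState b ε t ω i) 2 P
      ≤ ENNReal.ofReal (C * (1 - ρ)⁻¹) * eLpNorm id 2 Q := by
  have hlim : ∀ᵐ ω ∂P, Tendsto (fun m : ℕ => ∑ k ∈ Finset.range m,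
      ((companion b ^ k) (firstUnit p) i) • ε (t - k) ω) atTop (𝓝 (causalState b ε t ω i)) := by
    filter_upwards [hε.ae_summable hQ hC hρ hρ1 hT t] with ω hω
    have := ((continuous_apply i).tendsto _).comp hω.hasSum.tendsto_sum_nat
    refine this.congr fun m => ?_
    simp [mul_comm]
  refine (Lp.eLpNorm_lim_le_liminf_eLpNorm (fun m => ?_) _ hlim).trans ?_
  · simp only [smul_eq_mul]
    exact (Finset.measurable_fun_sum _ fun k _ =>
      (hε.measurable _).const_mul _).aestronglyMeasurable
  refine liminf_le_of_le (by isBoundedDefault) fun c hc => ?_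
  obtain ⟨m, hm⟩ := hc.exists
  refine hm.trans ?_
  have h1 := eLpNorm_sum_le (μ := P) (p := 2) (s := Finset.range m)
    (f := fun k => ((companion b ^ k) (firstUnit p) i) • ε (t - (k : ℕ)))
    (fun k _ => ((hε.measurable _).const_smul _).aestronglyMeasurable) one_le_two
  have h2 : (∑ k ∈ Finset.range m, ((companion b ^ k) (firstUnit p) i) • ε (t - (k : ℕ)))
      = fun ω => ∑ k ∈ Finset.range m, ((companion b ^ k) (firstUnit p) i) • ε (t - k) ω := by
    ext ω; simp
  rw [h2] at h1
  refine h1.trans ?_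
  have h3 : ∀ k ∈ Finset.range m,
      eLpNorm (((companion b ^ k) (firstUnit p) i) • ε (t - (k : ℕ))) 2 P
        ≤ ENNReal.ofReal (C * ρ ^ k) * eLpNorm id 2 Q := by
    intro k _
    rw [eLpNorm_const_smul, hε.eLpNorm_eq]
    gcongr
    rw [← ofReal_norm]
    exact ENNReal.ofReal_le_ofReal ((norm_le_pi_norm _ i).trans
      (norm_companion_pow_firstUnit_le hC hρ hT k))
  refine (Finset.sum_le_sum h3).trans ?_
  rw [← Finset.sum_mul]
  gcongr
  rw [← ENNReal.ofReal_sum_of_nonneg fun k _ => by positivity]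
  refine ENNReal.ofReal_le_ofReal ?_
  rw [← Finset.mul_sum]
  gcongr
  rw [← tsum_geometric_of_lt_one hρ.le hρ1]
  exact (summable_geometric_of_lt_one hρ.le hρ1).sum_le_tsum _ fun k _ => by positivity

theorem integral_sq_le_of_eLpNorm_le {X : Ω → ℝ} (hX : AEStronglyMeasurable X P) {B : ENNReal}
    (hB : B ≠ ⊤) (h : eLpNorm X 2 P ≤ B) : MemLp X 2 P ∧ ∫ ω, X ω ^ 2 ∂P ≤ B.toReal ^ 2 := by
  have hm : MemLp X 2 P := ⟨hX, h.trans_lt hB.lt_top⟩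
  refine ⟨hm, ?_⟩
  have h1 := ENNReal.toReal_mono hB h
  rw [hm.eLpNorm_eq_integral_rpow_norm two_ne_zero ENNReal.ofNat_ne_top] at h1
  have h0 : 0 ≤ ∫ ω, X ω ^ 2 ∂P := integral_nonneg fun _ => sq_nonneg _
  simp only [ENNReal.toReal_ofNat, Real.rpow_two, Real.norm_eq_abs, sq_abs] at h1
  rw [ENNReal.toReal_ofReal (by positivity)] at h1
  have h2 := pow_le_pow_left₀ (by positivity) h1 2
  rwa [← Real.rpow_natCast, ← Real.rpow_mul h0, Nat.cast_ofNat, inv_mul_cancel₀ two_ne_zero,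
    Real.rpow_one] at h2

end Causal

/-! ### The sample mean of the stationary solution. -/

section Mean

variable {Ω : Type*} [mΩ : MeasurableSpace Ω] {P : Measure Ω}
  {p : ℕ} {b : Fin p → ℝ} {Q : Measure ℝ} {ε v : ℤ → Ω → ℝ} {μ ν : ℝ}

/-- A bound for the second moment of the stationary solution, in terms of the constants in the
geometric decay of the powers of the companion map. -/
noncomputable def momentBound (C ρ : ℝ) (Q : Measure ℝ) : ℝ :=
  (ENNReal.ofReal (C * (1 - ρ)⁻¹) * eLpNorm id 2 Q).toReal ^ 2

theorem momentBound_nonneg (C ρ : ℝ) (Q : Measure ℝ) : 0 ≤ momentBound C ρ Q := sq_nonneg _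

theorem moment_causalState [IsProbabilityMeasure P] (hε : IsIID P ε Q)
    (hQ : MemLp id 2 Q) {C ρ : ℝ} (hC : 0 ≤ C) (hρ : 0 < ρ) (hρ1 : ρ < 1)
    (hT : ∀ (m : ℕ) (u : Fin p → ℝ), ‖(companion b ^ m) u‖ ≤ C * ρ ^ m * ‖u‖) (t : ℤ)
    (i : Fin p) :
    MemLp (fun ω => causalState b ε t ω i) 2 P ∧
      ∫ ω, causalState b ε t ω i ^ 2 ∂P ≤ momentBound C ρ Q := by
  refine integral_sq_le_of_eLpNorm_le ?_ (ENNReal.mul_ne_top ENNReal.ofReal_ne_top hQ.2.ne)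
    (eLpNorm_causalState_le hε hQ hC hρ hρ1 hT t i)
  have h1 : Measurable (causalState b ε t) :=
    (measurable_causalState t).mono (innovationAlgebra_le hε.measurable t) le_rfl
  exact ((measurable_pi_apply i).comp h1).aestronglyMeasurable

theorem IsStationarySolution.moment [IsProbabilityMeasure P]
    (h : IsStationarySolution P b ν ε v) (hν : ν = delta b * μ) (hε : IsIID P ε Q)
    (hQ : MemLp id 2 Q) {C ρ : ℝ} (hC : 0 ≤ C) (hρ : 0 < ρ) (hρ1 : ρ < 1)
    (hT : ∀ (m : ℕ) (u : Fin p → ℝ), ‖(companion b ^ m) u‖ ≤ C * ρ ^ m * ‖u‖)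
    (i : Fin p) (t : ℤ) :
    MemLp (fun ω => v t ω - μ) 2 P ∧ ∫ ω, (v t ω - μ) ^ 2 ∂P ≤ momentBound C ρ Q := by
  -- `v_t` is read off as coordinate `i` of the state at time `t + i`. This requires `p > 0`, which
  -- the argument `i` provides; for `p = 0` no lagged value occurs and no moment is needed.
  have h1 : (fun ω => causalState b ε (t + (i : ℕ)) ω i) =ᵐ[P] fun ω => v t ω - μ := by
    filter_upwards [h.ae_eq_causalState hν hε hQ hC hρ hρ1 hT (t + (i : ℕ))] with ω hω
    simp [hω]
  have h2 := moment_causalState hε hQ hC hρ hρ1 hT (t + (i : ℕ)) i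
  refine ⟨h2.1.ae_eq h1, ?_⟩
  have h3 : (fun ω => causalState b ε (t + (i : ℕ)) ω i ^ 2) =ᵐ[P] fun ω => (v t ω - μ) ^ 2 := by
    filter_upwards [h1] with ω hω
    rw [hω]
  rw [← integral_congr_ae h3]
  exact h2.2

theorem sum_shift_sub_sum (w : ℤ → ℝ) (n : ℕ) (c : ℤ) :
    ∑ t ∈ Finset.Icc (1 : ℤ) n, w (t - (c + 1)) - ∑ t ∈ Finset.Icc (1 : ℤ) n, w (t - c)
      = w (-c) - w (n - c) := by
  induction n with
  | zero => simp
  | succ n ih =>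
    have h1 : Finset.Icc (1 : ℤ) ((n + 1 : ℕ) : ℤ)
        = insert ((n + 1 : ℕ) : ℤ) (Finset.Icc (1 : ℤ) n) := by
      ext t; simp only [Finset.mem_Icc, Finset.mem_insert]; omega
    have h2 : ((n + 1 : ℕ) : ℤ) ∉ Finset.Icc (1 : ℤ) n := by simp
    rw [h1, Finset.sum_insert h2, Finset.sum_insert h2, add_sub_add_comm, ih]
    have h3 : ((n + 1 : ℕ) : ℤ) - (c + 1) = n - c := by push_cast; ring
    rw [h3]
    ring

theorem abs_sum_shift_sub_sum_le (w : ℤ → ℝ) (n : ℕ) (c : ℤ) (m : ℕ) :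
    |∑ t ∈ Finset.Icc (1 : ℤ) n, w (t - c - m) - ∑ t ∈ Finset.Icc (1 : ℤ) n, w (t - c)|
      ≤ ∑ k ∈ Finset.range m, (|w (-(c + k))| + |w (n - (c + k))|) := by
  induction m with
  | zero => simp
  | succ m ih =>
    rw [Finset.sum_range_succ]
    have h1 := sum_shift_sub_sum w n (c + m)
    have h2 : ∀ t : ℤ, t - (c + m + 1) = t - c - ((m + 1 : ℕ) : ℤ) := by
      intro t; push_cast; ring
    have h3 : ∀ t : ℤ, t - (c + m) = t - c - m := by intro t; ring
    simp only [h2, h3] at h1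
    calc _ = |(∑ t ∈ Finset.Icc (1 : ℤ) n, w (t - c - m) - ∑ t ∈ Finset.Icc (1 : ℤ) n, w (t - c))
          + (w (-(c + m)) - w (n - c - m))| := by rw [← h1]; congr 1; ring
      _ ≤ _ := by
          refine (abs_add_le _ _).trans (add_le_add ih ?_)
          rw [h3]
          exact abs_sub _ _

/-- Summing the recursion over `t` gives `δ(β) ∑ w = ∑ e` up to differences of shifted sums, which
telescope to boundary values whose number does not depend on `n`. -/
theorem abs_delta_mul_sum_le {w e : ℤ → ℝ}
    (h : ∀ t, w t = ∑ j : Fin p, b j * w (t - ((j : ℕ) + 1 : ℤ)) + e t) (n : ℕ) (c : ℤ) :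
    |delta b| * |∑ t ∈ Finset.Icc (1 : ℤ) n, w (t - c)|
      ≤ |∑ t ∈ Finset.Icc (1 : ℤ) n, e (t - c)| + ∑ j : Fin p, |b j| *
          ∑ k ∈ Finset.range (j + 1), (|w (-(c + k))| + |w (n - (c + k))|) := by
  have h1 : delta b * ∑ t ∈ Finset.Icc (1 : ℤ) n, w (t - c)
      = ∑ t ∈ Finset.Icc (1 : ℤ) n, e (t - c) + ∑ j : Fin p, b j *
        (∑ t ∈ Finset.Icc (1 : ℤ) n, w (t - c - ((j + 1 : ℕ) : ℤ))
          - ∑ t ∈ Finset.Icc (1 : ℤ) n, w (t - c)) := by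
    have h2 : ∑ t ∈ Finset.Icc (1 : ℤ) n, w (t - c)
        = ∑ j : Fin p, b j * ∑ t ∈ Finset.Icc (1 : ℤ) n, w (t - c - ((j + 1 : ℕ) : ℤ))
          + ∑ t ∈ Finset.Icc (1 : ℤ) n, e (t - c) := by
      rw [Finset.sum_congr rfl fun t _ => h (t - c), Finset.sum_add_distrib, Finset.sum_comm]
      simp_rw [Finset.mul_sum]
      push_cast
      rfl
    simp only [mul_sub, Finset.sum_sub_distrib, ← Finset.sum_mul, delta]
    linear_combination h2
  rw [← abs_mul, h1]
  refine (abs_add_le _ _).trans (add_le_add le_rfl ?_)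
  refine (Finset.abs_sum_le_sum_abs _ _).trans (Finset.sum_le_sum fun j _ => ?_)
  rw [abs_mul]
  gcongr
  exact abs_sum_shift_sub_sum_le w n c (j + 1)

theorem IsIID.integral_comp (h : IsIID P ε Q) (t : ℤ) {f : ℝ → ℝ} (hf : Measurable f) :
    ∫ ω, f (ε t ω) ∂P = ∫ y, f y ∂Q := by
  rw [← h.law t, integral_map (h.measurable t).aemeasurable hf.aestronglyMeasurable]

theorem IsIID.integral_abs_sum_le [IsProbabilityMeasure P] (h : IsIID P ε Q) (hQ : MemLp id 2 Q)
    (hmean : ∫ s, s ∂Q = 0) (n : ℕ) (c : ℤ) :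
    ∫ ω, |∑ t ∈ Finset.Icc (1 : ℤ) n, ε (t - c) ω| ∂P ≤ √(n * ∫ s, s ^ 2 ∂Q) := by
  refine (integral_abs_sum_le_sqrt _ (fun t _ => h.memLp hQ (t - c)) ?_).trans (le_of_eq ?_)
  · intro i _ j _ hij
    have h1 : IndepFun (ε (i - c)) (ε (j - c)) P := h.indep.indepFun (by omega)
    rw [h1.integral_fun_mul_eq_mul_integral (h.measurable _).aestronglyMeasurable
      (h.measurable _).aestronglyMeasurable, h.integral_comp (f := fun y => y) _ measurable_id,
      hmean, zero_mul]
  · congr 1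
    rw [Finset.sum_congr rfl fun t _ => h.integral_comp (f := fun y => y ^ 2) (t - c)
      (measurable_id.pow_const 2)]
    simp

/-- The sum of innovations is `O(√n)` in `L¹` by orthogonality and the boundary terms are `O(1)`, so
the law of large numbers holds with rate `n^{-1/2}` and no autocovariance has to be computed. -/
theorem IsStationarySolution.integral_abs_mean_le [IsProbabilityMeasure P]
    (h : IsStationarySolution P b ν ε v) (hν : ν = delta b * μ) (hε : IsIID P ε Q)
    (hQ : MemLp id 2 Q) (hmean : ∫ s, s ∂Q = 0) (hδ : delta b ≠ 0) {K : ℝ}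
    (hK : ∀ t, MemLp (fun ω => v t ω - μ) 2 P ∧ ∫ ω, (v t ω - μ) ^ 2 ∂P ≤ K)
    {n : ℕ} (hn : 1 ≤ n) (c : ℤ) :
    ∫ ω, |(n : ℝ)⁻¹ * ∑ t ∈ Finset.Icc (1 : ℤ) n, (v (t - c) ω - μ)| ∂P
      ≤ (√(∫ s, s ^ 2 ∂Q) + ∑ j : Fin p, |b j| * ((j + 1) * (2 * √K))) / |delta b| / √n := by
  have hn0 : (0 : ℝ) < n := by exact_mod_cast hn
  have hs0 : (0 : ℝ) < √n := Real.sqrt_pos.2 hn0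
  have hs1 : (1 : ℝ) ≤ √n := Real.one_le_sqrt.2 (by exact_mod_cast hn)
  have hss : √(n : ℝ) * √n = n := Real.mul_self_sqrt hn0.le
  have hd : 0 < |delta b| := abs_pos.2 hδ
  have hvi : ∀ t, Integrable (fun ω => |v t ω - μ|) P := fun t =>
    ((hK t).1.integrable one_le_two).abs
  have hv1 : ∀ t, ∫ ω, |v t ω - μ| ∂P ≤ √K := fun t =>
    (integral_abs_le_sqrt (hK t).1).trans (Real.sqrt_le_sqrt (hK t).2)
  have hei : Integrable (fun ω => |∑ t ∈ Finset.Icc (1 : ℤ) n, ε (t - c) ω|) P :=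
    (integrable_finsetSum _ fun t _ => (hε.memLp hQ (t - c)).integrable one_le_two).abs
  have hvvi : ∀ k : ℕ, Integrable
      (fun ω => |v (-(c + k)) ω - μ| + |v (n - (c + k)) ω - μ|) P :=
    fun k => (hvi _).add (hvi _)
  have hri : ∀ j : Fin p, Integrable (fun ω => |b j| * ∑ k ∈ Finset.range (j + 1),
      (|v (-(c + k)) ω - μ| + |v (n - (c + k)) ω - μ|)) P := fun j =>
    (integrable_finsetSum _ fun k _ => hvvi k).const_mul _
  have h1 : |delta b| * ∫ ω, |∑ t ∈ Finset.Icc (1 : ℤ) n, (v (t - c) ω - μ)| ∂P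
      ≤ √n * √(∫ s, s ^ 2 ∂Q) + ∑ j : Fin p, |b j| * ((j + 1) * (2 * √K)) := by
    rw [← integral_const_mul]
    have h2 : ∀ᵐ ω ∂P, |delta b| * |∑ t ∈ Finset.Icc (1 : ℤ) n, (v (t - c) ω - μ)|
        ≤ |∑ t ∈ Finset.Icc (1 : ℤ) n, ε (t - c) ω| + ∑ j : Fin p, |b j| *
          ∑ k ∈ Finset.range (j + 1), (|v (-(c + k)) ω - μ| + |v (n - (c + k)) ω - μ|) := by
      filter_upwards [h.recursion_centred hν] with ω hω
      exact abs_delta_mul_sum_le (w := fun t => v t ω - μ) hω n c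
    refine (integral_mono_of_nonneg (ae_of_all _ fun ω => by positivity)
      (hei.add (integrable_finsetSum _ fun j _ => hri j)) h2).trans ?_
    simp only [Pi.add_apply]
    rw [integral_add hei (integrable_finsetSum _ fun j _ => hri j),
      integral_finsetSum _ fun j _ => hri j]
    refine add_le_add ?_ (Finset.sum_le_sum fun j _ => ?_)
    · rw [← Real.sqrt_mul hn0.le]
      exact hε.integral_abs_sum_le hQ hmean n c
    · rw [integral_const_mul, integral_finsetSum _ fun k _ => hvvi k]
      gcongr
      have h3 : ∀ k ∈ Finset.range ((j : ℕ) + 1), ∫ ω, (|v (-(c + (k : ℤ))) ω - μ|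
          + |v (n - (c + (k : ℤ))) ω - μ|) ∂P ≤ 2 * √K := by
        intro k _
        rw [integral_add (hvi _) (hvi _), two_mul]
        exact add_le_add (hv1 _) (hv1 _)
      refine (Finset.sum_le_sum h3).trans (le_of_eq ?_)
      simp
  have h4 : ∀ ω, |(n : ℝ)⁻¹ * ∑ t ∈ Finset.Icc (1 : ℤ) n, (v (t - c) ω - μ)|
      = (n : ℝ)⁻¹ * |∑ t ∈ Finset.Icc (1 : ℤ) n, (v (t - c) ω - μ)| := by
    intro ω; rw [abs_mul, abs_of_pos (inv_pos.2 hn0)]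
  simp_rw [h4]
  rw [integral_const_mul, le_div_iff₀ hs0, le_div_iff₀ hd]
  set I := ∫ ω, |∑ t ∈ Finset.Icc (1 : ℤ) n, (v (t - c) ω - μ)| ∂P
  set S := ∑ j : Fin p, |b j| * (((j : ℕ) + 1 : ℝ) * (2 * √K)) with hS
  have hS0 : 0 ≤ S := Finset.sum_nonneg fun j _ => by positivity
  have h5 : (n : ℝ)⁻¹ * I * √n * |delta b| = (√n)⁻¹ * (|delta b| * I) := by
    have h6 : (n : ℝ)⁻¹ = (√n)⁻¹ * (√n)⁻¹ := by rw [← mul_inv, hss]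
    rw [h6]
    field_simp
  rw [h5, inv_mul_le_iff₀ hs0]
  refine h1.trans ?_
  rw [mul_add]
  gcongr
  -- The boundary terms are enlarged by the factor `√n ≥ 1` so that both contributions share one
  -- rate.
  exact le_mul_of_one_le_left hS0 hs1

end Mean

/-! ### Independence structure and probabilities of the outlier events. -/

section Outliers

variable {Ω : Type*} [mΩ : MeasurableSpace Ω] {P : Measure Ω}
  {p : ℕ} {b : Fin p → ℝ} {Q L : Measure ℝ} {q : unitInterval} {ε v z ξ : ℤ → Ω → ℝ} {μ ν : ℝ}

/-- The model postulates independence for `v`, `z`, `ξ`. The innovations are almost surely a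
measurable function of the path of `v`, so they may replace it. -/
theorem IsModel.iIndepFun_sequences (h : IsModel P b ν Q L q ε v z ξ) :
    iIndepFun (fun i ω t => (![ε, z, ξ] : Fin 3 → ℤ → Ω → ℝ) i t ω) P := by
  set φ : (ℤ → ℝ) → ℤ → ℝ := fun f t =>
    f t - ∑ j : Fin p, b j * f (t - ((j : ℕ) + 1 : ℤ)) - ν with hφ
  have hφm : Measurable φ := by
    rw [hφ]
    fun_prop
  have h1 := h.indep.comp (![φ, id, id] : Fin 3 → (ℤ → ℝ) → (ℤ → ℝ)) (by
    intro i
    fin_cases i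
    · exact hφm
    · exact measurable_id
    · exact measurable_id)
  refine h1.congr fun i => ?_
  fin_cases i
  · have h2 : ∀ᵐ ω ∂P, ∀ t, v t ω = ∑ j : Fin p, b j * v (t - ((j : ℕ) + 1 : ℤ)) ω + ν + ε t ω :=
      ae_all_iff.2 h.solution.recursion
    filter_upwards [h2] with ω hω
    ext t
    change φ (fun t => v t ω) t = ε t ω
    simp only [hφ]
    rw [hω t]
    ring
  · exact ae_of_all _ fun ω => rfl
  · exact ae_of_all _ fun ω => rfl

theorem IsModel.measurable_sequences (h : IsModel P b ν Q L q ε v z ξ) (i : Fin 3) (t : ℤ) :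
    Measurable ((![ε, z, ξ] : Fin 3 → ℤ → Ω → ℝ) i t) := by
  fin_cases i
  · exact h.innovations.measurable t
  · exact h.bernoulli.measurable t
  · exact h.outliers.measurable t

theorem IsModel.iIndepFun_all (h : IsModel P b ν Q L q ε v z ξ) :
    iIndepFun (fun (i : Fin 3 × ℤ) ω => (![ε, z, ξ] : Fin 3 → ℤ → Ω → ℝ) i.1 i.2 ω) P := by
  refine iIndepFun_uncurry' (X := (![ε, z, ξ] : Fin 3 → ℤ → Ω → ℝ)) h.measurable_sequences
    h.iIndepFun_sequences fun i => ?_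
  fin_cases i
  · exact h.innovations.indep
  · exact h.bernoulli.indep
  · exact h.outliers.indep

theorem IsModel.indepFun_contamination (h : IsModel P b ν Q L q ε v z ξ) :
    IndepFun (fun ω => ((fun t => z t ω), fun t => ξ t ω)) (fun ω t => ε t ω) P :=
  h.iIndepFun_sequences.indepFun_prodMk
    (fun i => measurable_pi_lambda _ fun t => h.measurable_sequences i t) 1 2 0
    (by decide) (by decide)

theorem IsModel.indepFun_solution (h : IsModel P b ν Q L q ε v z ξ) (s t : ℤ) :
    IndepFun (z s) (v t) P :=
  (h.indep.indepFun (i := 1) (j := 0) (by decide)).comp (measurable_pi_apply s)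
    (measurable_pi_apply t)

theorem IsModel.indepFun_outliers (h : IsModel P b ν Q L q ε v z ξ) (s t : ℤ) :
    IndepFun (z s) (ξ t) P :=
  (h.indep.indepFun (i := 1) (j := 2) (by decide)).comp (measurable_pi_apply s)
    (measurable_pi_apply t)

/-- The index blocks belonging to different times are disjoint. The lag `c` is the same on both
sides, so the blocks cannot meet through the shift. -/
theorem IsModel.indepFun_triple (h : IsModel P b ν Q L q ε v z ξ) {s t : ℤ} (hst : s ≠ t) (c : ℤ) :
    IndepFun (fun ω => (ε s ω, z (s - c) ω, ξ (s - c) ω))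
      (fun ω => (ε t ω, z (t - c) ω, ξ (t - c) ω)) P := by
  set site : ℤ → Finset (Fin 3 × ℤ) := fun r => {(0, r), (1, r - c), (2, r - c)} with hsite
  have hdisj : Disjoint (site s) (site t) := by
    have : s - c ≠ t - c := by omega
    simp [hsite, hst.symm, this.symm]
  have h1 := h.iIndepFun_all.indepFun_finset (site s) (site t) hdisj
    (fun i => h.measurable_sequences i.1 i.2)
  have hm : ∀ r, Measurable fun f : (site r → ℝ) =>
      (f ⟨(0, r), by simp [hsite]⟩, f ⟨(1, r - c), by simp [hsite]⟩,
        f ⟨(2, r - c), by simp [hsite]⟩) := by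
    intro r
    fun_prop
  exact h1.comp (hm s) (hm t)

/-- The indicator of an outlier: `0` at `0`, and `1` elsewhere. -/
noncomputable def occ (u : ℝ) : ℝ := if u = 0 then 0 else 1

theorem measurable_occ : Measurable occ :=
  Measurable.ite (measurableSet_singleton 0) measurable_const measurable_const

theorem occ_nonneg (u : ℝ) : 0 ≤ occ u := by unfold occ; split_ifs <;> norm_num

theorem occ_le_one (u : ℝ) : occ u ≤ 1 := by unfold occ; split_ifs <;> norm_num

theorem abs_occ_le_one (u : ℝ) : |occ u| ≤ 1 := by
  rw [abs_of_nonneg (occ_nonneg u)]; exact occ_le_one u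

theorem IsModel.ae_eq_zero_or_one (h : IsModel P b ν Q L q ε v z ξ) :
    ∀ᵐ ω ∂P, ∀ t, z t ω = 0 ∨ z t ω = 1 := by
  rw [ae_all_iff]
  intro t
  have hs : MeasurableSet {u : ℝ | u = 0 ∨ u = 1} := by
    have : {u : ℝ | u = 0 ∨ u = 1} = {0, 1} := by ext; simp
    rw [this]
    measurability
  rw [← ae_map_iff (h.bernoulli.measurable t).aemeasurable (p := fun u => u = 0 ∨ u = 1) hs,
    h.bernoulli.law t, ae_iff]
  rw [bernoulliMeasure_def]
  simp

theorem IsModel.integral_occ (h : IsModel P b ν Q L q ε v z ξ) (t : ℤ) :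
    ∫ ω, occ (z t ω) ∂P = q := by
  rw [h.bernoulli.integral_comp t measurable_occ, integral_bernoulliMeasure]
  simp [occ]

theorem IsModel.integrable_occ [IsProbabilityMeasure P] (h : IsModel P b ν Q L q ε v z ξ) (t : ℤ) :
    Integrable (fun ω => occ (z t ω)) P :=
  integrable_of_abs_le (measurable_occ.comp (h.bernoulli.measurable t)) fun _ => abs_occ_le_one _

theorem IsModel.integral_occ_mul_occ (h : IsModel P b ν Q L q ε v z ξ) {s t : ℤ} (hst : s ≠ t) :
    ∫ ω, occ (z s ω) * occ (z t ω) ∂P = (q : ℝ) ^ 2 := by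
  have h1 := (h.bernoulli.indep.indepFun hst).comp measurable_occ measurable_occ
  rw [sq, ← h.integral_occ s]
  nth_rewrite 2 [h.integral_occ s]
  rw [← h.integral_occ t]
  exact h1.integral_fun_mul_eq_mul_integral
    (measurable_occ.comp (h.bernoulli.measurable s)).aestronglyMeasurable
    (measurable_occ.comp (h.bernoulli.measurable t)).aestronglyMeasurable

/-- The indicator of `R < |u|`. -/
noncomputable def large (R u : ℝ) : ℝ := if R < |u| then 1 else 0

theorem large_nonneg (R u : ℝ) : 0 ≤ large R u := by unfold large; split_ifs <;> norm_num

theorem abs_large_le_one (R u : ℝ) : |large R u| ≤ 1 := by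
  unfold large; split_ifs <;> norm_num

theorem measurable_large (R : ℝ) : Measurable (large R) :=
  Measurable.ite (measurableSet_lt measurable_const measurable_id.abs) measurable_const
    measurable_const

theorem large_le {R : ℝ} (hR : 0 < R) (u : ℝ) : large R u ≤ u ^ 2 / R ^ 2 := by
  unfold large
  split_ifs with h1
  · rw [one_le_div (by positivity), ← sq_abs u]
    gcongr
  · positivity

theorem IsModel.integral_occ_mul_large_solution_le (h : IsModel P b ν Q L q ε v z ξ) {K : ℝ}
    (hK : ∀ t, MemLp (fun ω => v t ω - μ) 2 P ∧ ∫ ω, (v t ω - μ) ^ 2 ∂P ≤ K) {R : ℝ} (hR : 0 < R)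
    (s t : ℤ) : ∫ ω, occ (z s ω) * large R (v t ω - μ) ∂P ≤ q * (K / R ^ 2) := by
  have hl : Measurable fun u : ℝ => large R (u - μ) :=
    (measurable_large R).comp (measurable_id.sub_const μ)
  have h1 := (h.indepFun_solution s t).comp measurable_occ hl
  have h2 := h1.integral_fun_mul_eq_mul_integral
    (measurable_occ.comp (h.bernoulli.measurable s)).aestronglyMeasurable
    (hl.comp (h.solution.measurable t)).aestronglyMeasurable
  simp only [Function.comp_apply] at h2
  rw [h2, h.integral_occ]
  refine mul_le_mul_of_nonneg_left ?_ q.2.1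
  refine (integral_mono_of_nonneg (ae_of_all _ fun ω => large_nonneg _ _)
    ((hK t).1.integrable_sq.div_const (R ^ 2)) (ae_of_all _ fun ω => large_le hR _)).trans ?_
  rw [integral_div]
  gcongr
  exact (hK t).2

theorem IsModel.integral_occ_mul_large_outlier (h : IsModel P b ν Q L q ε v z ξ) (R : ℝ)
    (s t : ℤ) : ∫ ω, occ (z s ω) * large R (ξ t ω) ∂P = q * ∫ u, large R u ∂L := by
  have h1 := (h.indepFun_outliers s t).comp measurable_occ (measurable_large R)
  have h2 := h1.integral_fun_mul_eq_mul_integral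
    (measurable_occ.comp (h.bernoulli.measurable s)).aestronglyMeasurable
    ((measurable_large R).comp (h.outliers.measurable t)).aestronglyMeasurable
  simp only [Function.comp_apply] at h2
  rw [h2, h.integral_occ, h.outliers.integral_comp t (measurable_large R)]

/-- The indicator of `|u| ≤ r`. -/
noncomputable def near (r u : ℝ) : ℝ := if |u| ≤ r then 1 else 0

theorem near_nonneg (r u : ℝ) : 0 ≤ near r u := by unfold near; split_ifs <;> norm_num

theorem near_le_one (r u : ℝ) : near r u ≤ 1 := by unfold near; split_ifs <;> norm_num

theorem abs_near_le_one (r u : ℝ) : |near r u| ≤ 1 := by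
  rw [abs_of_nonneg (near_nonneg r u)]; exact near_le_one r u

theorem near_mono {r r' : ℝ} (hr : r ≤ r') (u : ℝ) : near r u ≤ near r' u := by
  unfold near
  split_ifs <;> first | (norm_num; done) | (exfalso; linarith)

theorem integral_near_le [IsProbabilityMeasure Q] (hG : Differentiable ℝ (cdf Q))
    (hg : Differentiable ℝ (deriv (cdf Q))) {C : ℝ}
    (hC : ∀ s, |deriv (deriv (cdf Q)) s| ≤ C) {r : ℝ} (hr : 0 < r) (c : ℝ) :
    ∫ e, near r (e + c) ∂Q ≤ 3 * r * (1 + C) := by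
  -- The left threshold is moved from `-r` to `-2r` so that a half-open interval contains the closed
  -- one. This is the origin of the factor `3`.
  have h1 : ∀ e, near r (e + c) ≤ step (r - c) (e - 0) - step (-(2 * r) - c) (e - 0) := by
    intro e
    unfold near
    simp only [step_eq_ite, abs_le, sub_zero]
    split_ifs <;> first | (norm_num; done) | (exfalso; linarith)
  have hi : ∀ y : ℝ, Integrable (fun e => step y (e - 0)) Q := fun y =>
    integrable_of_abs_le ((measurable_step y).comp (measurable_id.sub_const 0))
      fun _ => abs_step_le_one _ _
  refine (integral_mono_of_nonneg (ae_of_all _ fun e => near_nonneg _ _) ((hi _).sub (hi _))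
    (ae_of_all _ h1)).trans ?_
  simp only [Pi.sub_apply]
  rw [integral_sub (hi _) (hi _), integral_step, integral_step]
  refine (le_abs_self _).trans ((abs_cdf_sub_le hG hg hC _ _).trans (le_of_eq ?_))
  rw [abs_of_nonneg (by linarith)]
  ring

/-- The innovation is integrated first, with all of `z` and `ξ` frozen: a bounded density gives
`O(r)` wherever the outliers have moved the threshold, and the factor `q` remains. -/
theorem IsModel.integral_mul_near_le [IsProbabilityMeasure P] [IsProbabilityMeasure Q]
    (h : IsModel P b ν Q L q ε v z ξ)
    (hG : Differentiable ℝ (cdf Q))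
    (hg : Differentiable ℝ (deriv (cdf Q))) {C : ℝ}
    (hC : ∀ s, |deriv (deriv (cdf Q)) s| ≤ C) {r : ℝ} (hr : 0 < r)
    {φ : (ℤ → ℝ) × (ℤ → ℝ) → ℝ} (hφ : Measurable φ) (s t : ℤ) (x : ℝ) :
    ∫ ω, occ (z s ω) * near r (ε t ω + φ ((fun t => z t ω), fun t => ξ t ω) - x) ∂P
      ≤ q * (3 * r * (1 + C)) := by
  have hX : Measurable fun ω => (z s ω, φ ((fun t => z t ω), fun t => ξ t ω)) := by
    refine (h.bernoulli.measurable s).prodMk (hφ.comp (Measurable.prodMk ?_ ?_))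
    · exact measurable_pi_lambda _ h.bernoulli.measurable
    · exact measurable_pi_lambda _ h.outliers.measurable
  have hind : IndepFun (fun ω => (z s ω, φ ((fun t => z t ω), fun t => ξ t ω))) (ε t) P :=
    h.indepFun_contamination.comp
      (φ := fun f : (ℤ → ℝ) × (ℤ → ℝ) => (f.1 s, φ f)) (ψ := fun f : ℤ → ℝ => f t)
      (((measurable_pi_apply s).comp measurable_fst).prodMk hφ) (measurable_pi_apply t)
  have hF : Measurable fun y : (ℝ × ℝ) × ℝ => occ y.1.1 * near r (y.2 + y.1.2 - x) := by
    refine Measurable.mul (measurable_occ.comp (measurable_fst.comp measurable_fst)) ?_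
    refine Measurable.ite (measurableSet_le ?_ measurable_const) measurable_const measurable_const
    fun_prop
  have h1 := integral_comp_of_indepFun hX (h.innovations.measurable t) (h.innovations.law t) hind
    hF (c := 1) (fun y => by
      rw [abs_mul]; exact mul_le_one₀ (abs_occ_le_one _) (abs_nonneg _) (abs_near_le_one _ _))
  simp only at h1
  rw [h1, ← h.integral_occ s, ← integral_mul_const]
  refine integral_mono_of_nonneg (ae_of_all _ fun ω => ?_) ((h.integrable_occ s).mul_const _)
    (ae_of_all _ fun ω => ?_)
  · exact integral_nonneg fun y => mul_nonneg (occ_nonneg _) (near_nonneg _ _)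
  · simp only
    rw [integral_const_mul]
    refine mul_le_mul_of_nonneg_left ?_ (occ_nonneg _)
    simp_rw [add_sub_assoc]
    exact integral_near_le hG hg hC hr _

end Outliers

/-! ### The effect of a single outlier. -/

section Contamination

theorem integrable_cdf_affine {L : Measure ℝ} [IsFiniteMeasure L] (Q : Measure ℝ) (x β : ℝ) :
    Integrable (fun s => cdf Q (x + β * s)) L := by
  refine integrable_of_abs_le (c := 1) ((monotone_cdf Q).measurable.comp (by fun_prop)) fun s => ?_
  rw [abs_of_nonneg (cdf_nonneg Q _)]
  exact cdf_le_one Q _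

variable {Ω : Type*} [mΩ : MeasurableSpace Ω] {P : Measure Ω} [IsProbabilityMeasure P]
  {p : ℕ} {b : Fin p → ℝ} {Q L : Measure ℝ} [IsProbabilityMeasure Q] [IsProbabilityMeasure L]
  {q : unitInterval} {ε v z ξ : ℤ → Ω → ℝ} {μ ν : ℝ}

/-- Integrating out `ε` leaves `G(x + β z ξ) - G(x)`, which is zero when `z = 0` and is independent
of `z` in its `ξ`-part when `z = 1`. -/
theorem IsModel.integral_single_effect (h : IsModel P b ν Q L q ε v z ξ) (x β : ℝ) (s t : ℤ) :
    ∫ ω, (step x (ε t ω - β * (z s ω * ξ s ω)) - step x (ε t ω)) ∂P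
      = q * ((∫ u, cdf Q (x + β * u) ∂L) - cdf Q x) := by
  have hX : Measurable fun ω => β * (z s ω * ξ s ω) :=
    ((h.bernoulli.measurable s).mul (h.outliers.measurable s)).const_mul β
  have hind : IndepFun (fun ω => β * (z s ω * ξ s ω)) (ε t) P :=
    h.indepFun_contamination.comp (φ := fun f : (ℤ → ℝ) × (ℤ → ℝ) => β * (f.1 s * f.2 s))
      (ψ := fun f : ℤ → ℝ => f t) (by fun_prop) (measurable_pi_apply t)
  have hF : Measurable fun y : ℝ × ℝ => step x (y.2 - y.1) - step x y.2 :=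
    ((measurable_step x).comp (by fun_prop)).sub ((measurable_step x).comp measurable_snd)
  have h1 := integral_comp_of_indepFun hX (h.innovations.measurable t) (h.innovations.law t) hind
    hF (c := 1) fun y => abs_step_sub_step_le_one _ _ _
  simp only at h1
  rw [h1]
  simp_rw [integral_step_sub_step]
  have h2 : ∫ ω, (cdf Q (x + β * (z s ω * ξ s ω)) - cdf Q x) ∂P
      = ∫ ω, occ (z s ω) * (cdf Q (x + β * ξ s ω) - cdf Q x) ∂P := by
    refine integral_congr_ae ?_
    filter_upwards [h.ae_eq_zero_or_one] with ω hω
    rcases hω s with h0 | h0 <;> simp [h0, occ]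
  have hm : Measurable fun u : ℝ => cdf Q (x + β * u) - cdf Q x :=
    ((monotone_cdf Q).measurable.comp (by fun_prop)).sub_const _
  have h3 := ((h.indepFun_outliers s s).comp measurable_occ hm).integral_fun_mul_eq_mul_integral
    (measurable_occ.comp (h.bernoulli.measurable s)).aestronglyMeasurable
    (hm.comp (h.outliers.measurable s)).aestronglyMeasurable
  simp only [Function.comp_apply] at h3
  rw [h2, h3, h.integral_occ, h.outliers.integral_comp s hm,
    integral_sub (integrable_cdf_affine Q x β) (integrable_const _)]
  simp

/-- A summand is nonzero only if `z` is, and is bounded by `1`, so its variance is at most `q`.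
Independence at distinct times makes the centred summands orthogonal, and the factor `√n` cancels.
-/
theorem IsModel.integral_abs_sum_single_effect_le (h : IsModel P b ν Q L q ε v z ξ) (x β : ℝ)
    (c : ℤ) {n : ℕ} (hn : 1 ≤ n) :
    ∫ ω, |(√n)⁻¹ * ∑ t ∈ Finset.Icc (1 : ℤ) n,
          (step x (ε t ω - β * (z (t - c) ω * ξ (t - c) ω)) - step x (ε t ω))
        - √n * q * ((∫ u, cdf Q (x + β * u) ∂L) - cdf Q x)| ∂P ≤ √q := by
  have hn0 : (0 : ℝ) < n := by exact_mod_cast hn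
  have hs0 : (0 : ℝ) < √n := Real.sqrt_pos.2 hn0
  have hss : √(n : ℝ) * √n = n := Real.mul_self_sqrt hn0.le
  have hcard : (Finset.Icc (1 : ℤ) n).card = n := by simp
  set m : ℝ := q * ((∫ u, cdf Q (x + β * u) ∂L) - cdf Q x) with hm
  set ψ : ℝ × ℝ × ℝ → ℝ := fun y => step x (y.1 - β * (y.2.1 * y.2.2)) - step x y.1 with hψ
  have hψm : Measurable ψ :=
    ((measurable_step x).comp (by fun_prop)).sub ((measurable_step x).comp measurable_fst)
  set Y : ℤ → Ω → ℝ × ℝ × ℝ := fun t ω => (ε t ω, z (t - c) ω, ξ (t - c) ω) with hY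
  have hYm : ∀ t, Measurable (Y t) := fun t => (h.innovations.measurable t).prodMk
    ((h.bernoulli.measurable _).prodMk (h.outliers.measurable _))
  set Z : ℤ → Ω → ℝ := fun t ω => ψ (Y t ω) with hZ
  have hZm : ∀ t, Measurable (Z t) := fun t => hψm.comp (hYm t)
  have hZ1 : ∀ t ω, |Z t ω| ≤ 1 := fun t ω => abs_step_sub_step_le_one _ _ _
  have hZi : ∀ t, Integrable (Z t) P := fun t => integrable_of_abs_le (hZm t) (hZ1 t)
  have hZ2 : ∀ t, MemLp (Z t) 2 P := fun t => memLp_two_of_abs_le (hZm t) (hZ1 t)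
  have hZE : ∀ t, ∫ ω, Z t ω ∂P = m := fun t => h.integral_single_effect x β (t - c) t
  have hDE : ∀ t, ∫ ω, (Z t ω - m) ∂P = 0 := by
    intro t
    rw [integral_sub (hZi t) (integrable_const _), hZE]
    simp
  have hDsq : ∀ t, ∫ ω, (Z t ω - m) ^ 2 ∂P ≤ q := by
    intro t
    have e1 : ∀ ω, (Z t ω - m) ^ 2 = Z t ω ^ 2 - (2 * m * Z t ω - m ^ 2) := by
      intro ω; ring
    have i2 : Integrable (fun ω => 2 * m * Z t ω) P := (hZi t).const_mul _
    have i3 : Integrable (fun ω => 2 * m * Z t ω - m ^ 2) P := i2.sub (integrable_const _)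
    simp_rw [e1]
    rw [integral_sub (hZ2 t).integrable_sq i3, integral_sub i2 (integrable_const _),
      integral_const_mul, hZE]
    have h1 : ∫ ω, Z t ω ^ 2 ∂P ≤ q := by
      rw [← h.integral_occ (t - c)]
      refine integral_mono_of_nonneg (ae_of_all _ fun ω => sq_nonneg _) (h.integrable_occ _)
        (ae_of_all _ fun ω => ?_)
      simp only
      by_cases h0 : z (t - c) ω = 0
      · simp [hZ, hψ, hY, h0, occ]
      · rw [occ, if_neg h0, ← sq_abs]
        exact pow_le_one₀ (abs_nonneg _) (hZ1 t ω)
    simp only [integral_const, probReal_univ, smul_eq_mul, one_mul]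
    nlinarith [sq_nonneg m]
  have horth : ∀ i ∈ Finset.Icc (1 : ℤ) n, ∀ j ∈ Finset.Icc (1 : ℤ) n, i ≠ j →
      ∫ ω, (Z i ω - m) * (Z j ω - m) ∂P = 0 := by
    intro i _ j _ hij
    have h1 := (h.indepFun_triple hij c).comp (hψm.sub_const m) (hψm.sub_const m)
    have h2 := h1.integral_fun_mul_eq_mul_integral
      ((hZm i).sub_const m).aestronglyMeasurable ((hZm j).sub_const m).aestronglyMeasurable
    refine h2.trans ?_
    have : ∫ ω, ((fun y => ψ y - m) ∘ fun ω => (ε i ω, z (i - c) ω, ξ (i - c) ω)) ω ∂P = 0 := hDE i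
    rw [this, zero_mul]
  have hmain := integral_abs_sum_le_sqrt (P := P) (Finset.Icc (1 : ℤ) n)
    (fun t _ => (hZ2 t).sub (memLp_const m)) horth
  have e2 : ∀ ω, |(√n)⁻¹ * ∑ t ∈ Finset.Icc (1 : ℤ) n,
          (step x (ε t ω - β * (z (t - c) ω * ξ (t - c) ω)) - step x (ε t ω))
        - √n * q * ((∫ u, cdf Q (x + β * u) ∂L) - cdf Q x)|
      = (√n)⁻¹ * |∑ t ∈ Finset.Icc (1 : ℤ) n, (Z t ω - m)| := by
    intro ω
    rw [← abs_of_pos (inv_pos.2 hs0), ← abs_mul, abs_of_pos (inv_pos.2 hs0)]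
    congr 1
    have e3 : ∑ t ∈ Finset.Icc (1 : ℤ) n, (Z t ω - m)
        = ∑ t ∈ Finset.Icc (1 : ℤ) n, Z t ω - n * m := by
      rw [Finset.sum_sub_distrib, Finset.sum_const, hcard, nsmul_eq_mul]
    have e4 : (√n)⁻¹ * (n * m) = √n * m := by
      nth_rewrite 2 [← hss]
      field_simp
    rw [e3, mul_sub ((√n)⁻¹), e4, mul_assoc (√n) (q : ℝ), ← hm]
  simp_rw [e2]
  rw [integral_const_mul, inv_mul_le_iff₀ hs0, ← Real.sqrt_mul hn0.le]
  refine hmain.trans (Real.sqrt_le_sqrt ?_)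
  refine (Finset.sum_le_sum fun t _ => hDsq t).trans (le_of_eq ?_)
  rw [Finset.sum_const, hcard, nsmul_eq_mul]

end Contamination

/-! ### Pathwise comparison of joint and separate outlier effects. -/

section Remainder

/-- Without outliers both sides vanish, since then `d' = d`. With exactly one, the sum of single
effects reproduces the outlier shift exactly, and only the two drifts remain; each can flip its
indicator only near the threshold. With two or more, the mismatch is at most the number of indices
plus one, and the sum over pairs is at least `1`. -/
theorem abs_contamination_remainder_le {ι : Type*} [Fintype ι] [DecidableEq ι] {o y c : ι → ℝ}
    (ho : ∀ i, o i = 0 ∧ y i = 0 ∨ o i = 1) {e d d' s x : ℝ} (hd : |d| ≤ s) (hd' : |d'| ≤ s)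
    (hdd : (∀ i, o i = 0) → d' = d) :
    |step x (e - ∑ i, c i * y i - d') - step x (e - d)
        - ∑ i, (step x (e - c i * y i) - step x e)|
      ≤ (∑ i, o i) * (near s (e - ∑ i, c i * y i - x) + near s (e - x))
        + (Fintype.card ι + 1) * ∑ i, ∑ j, if i = j then 0 else o i * o j := by
  have ho0 : ∀ i, 0 ≤ o i := by
    intro i
    rcases ho i with h | h
    · exact h.1.ge
    · rw [h]; exact zero_le_one
  have hterm : ∀ i j, 0 ≤ if i = j then 0 else o i * o j := by
    intro i j
    split_ifs
    · exact le_rfl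
    · exact mul_nonneg (ho0 i) (ho0 j)
  have hM : 0 ≤ ∑ i, ∑ j, if i = j then 0 else o i * o j :=
    Finset.sum_nonneg fun i _ => Finset.sum_nonneg fun j _ => hterm i j
  by_cases hall : ∀ i, o i = 0
  · have hy : ∀ i, y i = 0 := by
      intro i
      rcases ho i with h | h
      · exact h.2
      · rw [hall i] at h; norm_num at h
    simp [hdd hall, hy, hall]
  · push Not at hall
    obtain ⟨i₀, hi₀⟩ := hall
    have hi₁ : o i₀ = 1 := (ho i₀).resolve_left fun h => hi₀ h.1
    have hN : 1 ≤ ∑ i, o i := by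
      rw [← hi₁]
      exact Finset.single_le_sum (fun i _ => ho0 i) (Finset.mem_univ i₀)
    set E := e - ∑ i, c i * y i with hE
    have t1 : |step x (E - d') - step x E| ≤ near s (E - x) :=
      abs_step_sub_step_le (by rwa [sub_sub_cancel_left, abs_neg])
    have t2 : |step x (e - d) - step x e| ≤ near s (e - x) :=
      abs_step_sub_step_le (by rwa [sub_sub_cancel_left, abs_neg])
    have t3 : |step x E - step x e - ∑ i, (step x (e - c i * y i) - step x e)|
        ≤ (Fintype.card ι + 1) * ∑ i, ∑ j, if i = j then 0 else o i * o j := by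
      by_cases hone : ∀ i, i ≠ i₀ → o i = 0
      · have hy : ∀ i, i ≠ i₀ → y i = 0 := by
          intro i hi
          rcases ho i with h | h
          · exact h.2
          · rw [hone i hi] at h; norm_num at h
        have s1 : ∑ i, c i * y i = c i₀ * y i₀ :=
          Finset.sum_eq_single i₀ (fun i _ hi => by rw [hy i hi, mul_zero]) (by simp)
        have s2 : ∑ i, (step x (e - c i * y i) - step x e) = step x (e - c i₀ * y i₀) - step x e :=
          Finset.sum_eq_single i₀ (fun i _ hi => by rw [hy i hi, mul_zero, sub_zero, sub_self])
            (by simp)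
        rw [hE, s1, s2, sub_self, abs_zero]
        positivity
      · push Not at hone
        obtain ⟨i₁, hne, h1⟩ := hone
        have h1' : o i₁ = 1 := (ho i₁).resolve_left fun h => h1 h.1
        have hM1 : 1 ≤ ∑ i, ∑ j, if i = j then 0 else o i * o j := by
          calc (1 : ℝ) = if i₁ = i₀ then 0 else o i₁ * o i₀ := by rw [if_neg hne, h1', hi₁, mul_one]
            _ ≤ ∑ j, if i₁ = j then 0 else o i₁ * o j :=
                Finset.single_le_sum (f := fun j => if i₁ = j then 0 else o i₁ * o j)
                  (fun j _ => hterm i₁ j) (Finset.mem_univ i₀)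
            _ ≤ _ := Finset.single_le_sum
                  (f := fun i => ∑ j, if i = j then 0 else o i * o j)
                  (fun i _ => Finset.sum_nonneg fun j _ => hterm i j) (Finset.mem_univ i₁)
        refine le_trans ?_ (le_mul_of_one_le_right (by positivity) hM1)
        have s3 : |∑ i, (step x (e - c i * y i) - step x e)| ≤ Fintype.card ι := by
          refine (Finset.abs_sum_le_sum_abs _ _).trans ?_
          refine (Finset.sum_le_sum fun i _ => abs_step_sub_step_le_one x _ _).trans ?_
          simp
        have s4 := abs_step_sub_step_le_one x E e
        refine (abs_sub _ _).trans ?_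
        linarith
    have hsplit : step x (E - d') - step x (e - d) - ∑ i, (step x (e - c i * y i) - step x e)
        = (step x (E - d') - step x E) - (step x (e - d) - step x e)
          + (step x E - step x e - ∑ i, (step x (e - c i * y i) - step x e)) := by ring
    rw [hsplit]
    refine (abs_add_le _ _).trans (add_le_add ((abs_sub _ _).trans ?_) t3)
    refine (add_le_add t1 t2).trans (le_mul_of_one_le_left ?_ hN)
    exact add_nonneg (near_nonneg _ _) (near_nonneg _ _)

/-- The bound on the drift is itself random, and not independent of the outliers. Truncating the
lagged values at `R` makes the window deterministic at the cost of tail indicators. -/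
theorem near_mul_le {p : ℕ} {r R : ℝ} (hr : 0 ≤ r) (w u : Fin p → ℝ) (y : ℝ) :
    near (r * (1 + ∑ j, (|w j| + |u j|))) y
      ≤ near (r * (1 + 2 * p * R)) y + ∑ j, (large R (w j) + large R (u j)) := by
  have hl : ∀ j, 0 ≤ large R (w j) + large R (u j) := fun j =>
    add_nonneg (large_nonneg _ _) (large_nonneg _ _)
  by_cases hall : ∀ j, |w j| ≤ R ∧ |u j| ≤ R
  · have h1 : ∑ j, (|w j| + |u j|) ≤ 2 * p * R := by
      refine (Finset.sum_le_sum fun j _ => add_le_add (hall j).1 (hall j).2).trans (le_of_eq ?_)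
      simp
      ring
    have h2 := near_mono (r := r * (1 + ∑ j, (|w j| + |u j|))) (r' := r * (1 + 2 * p * R))
      (by gcongr) y
    have h3 : 0 ≤ ∑ j, (large R (w j) + large R (u j)) := Finset.sum_nonneg fun j _ => hl j
    linarith
  · push Not at hall
    obtain ⟨j, hj⟩ := hall
    have h1 : 1 ≤ large R (w j) + large R (u j) := by
      by_cases hw : |w j| ≤ R
      · have : large R (u j) = 1 := if_pos (hj hw)
        linarith [large_nonneg R (w j)]
      · have : large R (w j) = 1 := if_pos (not_le.1 hw)
        linarith [large_nonneg R (u j)]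
    have h2 := Finset.single_le_sum (fun j _ => hl j) (Finset.mem_univ j)
    have h3 := near_le_one (r * (1 + ∑ j, (|w j| + |u j|))) y
    have h4 := near_nonneg (r * (1 + 2 * p * R)) y
    linarith

end Remainder

/-! ### Residual identity and expectation of the remainder. -/

section RemainderBound

variable {Ω : Type*} {p : ℕ}

/-- The coefficients `(-1, β₁, …, β_p)`. -/
def fullCoeff (b : Fin p → ℝ) : Fin (p + 1) → ℝ := Fin.cons (-1) b

/-- A bound for the contribution of time `t` to the empirical process of the residuals that is
not accounted for by the linear terms. -/
noncomputable def remainderBound (b : Fin p → ℝ) (μ x r R : ℝ) (ε v z ξ : ℤ → Ω → ℝ) (t : ℤ)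
    (ω : Ω) : ℝ :=
  ∑ i : Fin (p + 1),
    (occ (z (t - (i : ℕ)) ω)
        * near r (ε t ω + -∑ k : Fin (p + 1), fullCoeff b k * (z (t - (k : ℕ)) ω * ξ (t - (k : ℕ)) ω)
            - x)
      + occ (z (t - (i : ℕ)) ω) * near r (ε t ω + 0 - x)
      + 2 * ∑ j : Fin p,
        (occ (z (t - (i : ℕ)) ω) * large R (v (t - ((j : ℕ) + 1 : ℤ)) ω - μ)
          + occ (z (t - (i : ℕ)) ω) * large R (ξ (t - ((j : ℕ) + 1 : ℤ)) ω)))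
    + (p + 2) * ∑ i : Fin (p + 1), ∑ k : Fin (p + 1),
        if i = k then 0 else occ (z (t - (i : ℕ)) ω) * occ (z (t - (k : ℕ)) ω)

/-- Every term carries a factor `q` from an outlier, multiplied by a short-interval probability, by
a tail probability, or, off the diagonal, by a second `q`. -/
theorem IsModel.integral_remainderBound_le [MeasurableSpace Ω] {P : Measure Ω}
    [IsProbabilityMeasure P] {Q L : Measure ℝ} [IsProbabilityMeasure Q] {b : Fin p → ℝ} {μ ν : ℝ}
    {q : unitInterval} {ε v z ξ : ℤ → Ω → ℝ} (h : IsModel P b ν Q L q ε v z ξ)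
    (hG : Differentiable ℝ (cdf Q)) (hg : Differentiable ℝ (deriv (cdf Q))) {C : ℝ}
    (hC : ∀ s, |deriv (deriv (cdf Q)) s| ≤ C) {K : ℝ}
    (hK : ∀ (_ : Fin p) t, MemLp (fun ω => v t ω - μ) 2 P ∧ ∫ ω, (v t ω - μ) ^ 2 ∂P ≤ K)
    {r R : ℝ} (hr : 0 < r) (hR : 0 < R) (x : ℝ) (t : ℤ) :
    Integrable (remainderBound b μ x r R ε v z ξ t) P ∧
    ∫ ω, remainderBound b μ x r R ε v z ξ t ω ∂P
      ≤ (p + 1) * (q * (3 * r * (1 + C)) + q * (3 * r * (1 + C))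
          + 2 * (p * (q * (K / R ^ 2) + q * ∫ u, large R u ∂L)))
        + (p + 2) * ((p + 1) * ((p + 1) * (q : ℝ) ^ 2)) := by
  have hom : ∀ s, Measurable fun ω => occ (z s ω) := fun s =>
    measurable_occ.comp (h.bernoulli.measurable s)
  have hmul : ∀ s, ∀ {Y : Ω → ℝ}, Measurable Y → (∀ ω, |Y ω| ≤ 1) →
      Integrable (fun ω => occ (z s ω) * Y ω) P := by
    intro s Y hY hY1
    refine integrable_of_abs_le ((hom s).mul hY) (c := 1) fun ω => ?_
    rw [abs_mul]
    exact mul_le_one₀ (abs_occ_le_one _) (abs_nonneg _) (hY1 ω)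
  have hnear : ∀ {Y : Ω → ℝ}, Measurable Y → Measurable fun ω => near r (Y ω) := by
    intro Y hY
    exact Measurable.ite (measurableSet_le hY.abs measurable_const) measurable_const
      measurable_const
  set φ : (ℤ → ℝ) × (ℤ → ℝ) → ℝ := fun f =>
    -∑ k : Fin (p + 1), fullCoeff b k * (f.1 (t - (k : ℕ)) * f.2 (t - (k : ℕ))) with hφ
  have hφm : Measurable φ := by
    rw [hφ]
    fun_prop
  have hφω : Measurable fun ω => φ ((fun t => z t ω), fun t => ξ t ω) :=
    hφm.comp ((measurable_pi_lambda _ h.bernoulli.measurable).prodMk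
      (measurable_pi_lambda _ h.outliers.measurable))
  have i1 : ∀ s, Integrable (fun ω => occ (z s ω)
      * near r (ε t ω + φ ((fun t => z t ω), fun t => ξ t ω) - x)) P := fun s =>
    hmul s (hnear (((h.innovations.measurable t).add hφω).sub_const x))
      fun _ => abs_near_le_one _ _
  have i2 : ∀ s, Integrable (fun ω => occ (z s ω) * near r (ε t ω + 0 - x)) P := fun s =>
    hmul s (hnear (((h.innovations.measurable t).add_const 0).sub_const x))
      fun _ => abs_near_le_one _ _
  have i3 : ∀ s s', Integrable (fun ω => occ (z s ω) * large R (v s' ω - μ)) P := fun s s' =>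
    hmul s ((measurable_large R).comp ((h.solution.measurable s').sub_const μ))
      fun _ => abs_large_le_one _ _
  have i4 : ∀ s s', Integrable (fun ω => occ (z s ω) * large R (ξ s' ω)) P := fun s s' =>
    hmul s ((measurable_large R).comp (h.outliers.measurable s'))
      fun _ => abs_large_le_one _ _
  have i5 : ∀ i k : Fin (p + 1), Integrable (fun ω => if i = k then 0 else
      occ (z (t - (i : ℕ)) ω) * occ (z (t - (k : ℕ)) ω)) P := by
    intro i k
    split_ifs
    · exact integrable_zero _ _ _
    · exact hmul _ (hom _) fun _ => abs_occ_le_one _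
  have i34 : ∀ s (j : Fin p), Integrable (fun ω =>
      occ (z s ω) * large R (v (t - ((j : ℕ) + 1 : ℤ)) ω - μ)
        + occ (z s ω) * large R (ξ (t - ((j : ℕ) + 1 : ℤ)) ω)) P := fun s j =>
    (i3 s _).add (i4 s _)
  have i34s : ∀ s, Integrable (fun ω => 2 * ∑ j : Fin p,
      (occ (z s ω) * large R (v (t - ((j : ℕ) + 1 : ℤ)) ω - μ)
        + occ (z s ω) * large R (ξ (t - ((j : ℕ) + 1 : ℤ)) ω))) P := fun s =>
    (integrable_finsetSum _ fun j _ => i34 s j).const_mul 2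
  have i12 : ∀ s, Integrable (fun ω => occ (z s ω)
      * near r (ε t ω + φ ((fun t => z t ω), fun t => ξ t ω) - x)
      + occ (z s ω) * near r (ε t ω + 0 - x)) P := fun s => (i1 s).add (i2 s)
  have i1234 : ∀ s, Integrable (fun ω => occ (z s ω)
      * near r (ε t ω + φ ((fun t => z t ω), fun t => ξ t ω) - x)
      + occ (z s ω) * near r (ε t ω + 0 - x) + 2 * ∑ j : Fin p,
      (occ (z s ω) * large R (v (t - ((j : ℕ) + 1 : ℤ)) ω - μ)
        + occ (z s ω) * large R (ξ (t - ((j : ℕ) + 1 : ℤ)) ω))) P := fun s =>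
    (i12 s).add (i34s s)
  have i5s : ∀ i : Fin (p + 1), Integrable (fun ω => ∑ k : Fin (p + 1), if i = k then 0 else
      occ (z (t - (i : ℕ)) ω) * occ (z (t - (k : ℕ)) ω)) P := fun i =>
    integrable_finsetSum _ fun k _ => i5 i k
  have i5ss : Integrable (fun ω => ((p : ℝ) + 2) * ∑ i : Fin (p + 1), ∑ k : Fin (p + 1),
      if i = k then 0 else occ (z (t - (i : ℕ)) ω) * occ (z (t - (k : ℕ)) ω)) P :=
    (integrable_finsetSum _ fun i _ => i5s i).const_mul _
  have iall : Integrable (fun ω => ∑ i : Fin (p + 1), (occ (z (t - (i : ℕ)) ω)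
      * near r (ε t ω + φ ((fun t => z t ω), fun t => ξ t ω) - x)
      + occ (z (t - (i : ℕ)) ω) * near r (ε t ω + 0 - x) + 2 * ∑ j : Fin p,
      (occ (z (t - (i : ℕ)) ω) * large R (v (t - ((j : ℕ) + 1 : ℤ)) ω - μ)
        + occ (z (t - (i : ℕ)) ω) * large R (ξ (t - ((j : ℕ) + 1 : ℤ)) ω)))) P :=
    integrable_finsetSum _ fun i _ => i1234 _
  refine ⟨iall.add i5ss, ?_⟩
  have key := integral_add iall i5ss
  refine (le_of_eq key).trans ?_
  refine add_le_add ?_ ?_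
  · rw [integral_finsetSum _ fun i _ => i1234 _]
    have hterm : ∀ i ∈ (Finset.univ : Finset (Fin (p + 1))), ∫ ω, (occ (z (t - (i : ℕ)) ω)
      * near r (ε t ω + φ ((fun t => z t ω), fun t => ξ t ω) - x)
      + occ (z (t - (i : ℕ)) ω) * near r (ε t ω + 0 - x) + 2 * ∑ j : Fin p,
      (occ (z (t - (i : ℕ)) ω) * large R (v (t - ((j : ℕ) + 1 : ℤ)) ω - μ)
        + occ (z (t - (i : ℕ)) ω) * large R (ξ (t - ((j : ℕ) + 1 : ℤ)) ω))) ∂P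
        ≤ q * (3 * r * (1 + C)) + q * (3 * r * (1 + C))
          + 2 * (p * (q * (K / R ^ 2) + q * ∫ u, large R u ∂L)) := by
      intro i _
      rw [integral_add (i12 _) (i34s _), integral_add (i1 _) (i2 _), integral_const_mul,
        integral_finsetSum _ fun j _ => i34 _ j]
      refine add_le_add (add_le_add ?_ ?_) ?_
      · exact h.integral_mul_near_le hG hg hC hr hφm _ t x
      · exact h.integral_mul_near_le hG hg hC hr (φ := fun _ => 0) measurable_const _ t x
      · gcongr
        have hj : ∀ j ∈ (Finset.univ : Finset (Fin p)), ∫ ω,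
            (occ (z (t - (i : ℕ)) ω) * large R (v (t - ((j : ℕ) + 1 : ℤ)) ω - μ)
              + occ (z (t - (i : ℕ)) ω) * large R (ξ (t - ((j : ℕ) + 1 : ℤ)) ω)) ∂P
            ≤ q * (K / R ^ 2) + q * ∫ u, large R u ∂L := by
          intro j _
          rw [integral_add (i3 _ _) (i4 _ _)]
          exact add_le_add (h.integral_occ_mul_large_solution_le (hK j) hR _ _)
            (h.integral_occ_mul_large_outlier R _ _).le
        refine (Finset.sum_le_sum hj).trans (le_of_eq ?_)
        rw [Finset.sum_const, Finset.card_univ, Fintype.card_fin, nsmul_eq_mul]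
    refine (Finset.sum_le_sum hterm).trans (le_of_eq ?_)
    rw [Finset.sum_const, Finset.card_univ, Fintype.card_fin, nsmul_eq_mul]
    push_cast
    ring
  · rw [integral_const_mul, integral_finsetSum _ fun i _ => i5s i]
    gcongr
    have hterm : ∀ i ∈ (Finset.univ : Finset (Fin (p + 1))),
        ∫ ω, (∑ k : Fin (p + 1), if i = k then 0 else
          occ (z (t - (i : ℕ)) ω) * occ (z (t - (k : ℕ)) ω)) ∂P ≤ (p + 1) * (q : ℝ) ^ 2 := by
      intro i _
      rw [integral_finsetSum _ fun k _ => i5 i k]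
      have hk : ∀ k ∈ (Finset.univ : Finset (Fin (p + 1))), ∫ ω, (if i = k then 0 else
          occ (z (t - (i : ℕ)) ω) * occ (z (t - (k : ℕ)) ω)) ∂P ≤ (q : ℝ) ^ 2 := by
        intro k _
        by_cases hik : i = k
        · simp only [hik, if_true, integral_zero]
          positivity
        · simp only [hik, if_false]
          refine (h.integral_occ_mul_occ ?_).le
          intro heq
          apply hik
          ext
          omega
      refine (Finset.sum_le_sum hk).trans (le_of_eq ?_)
      simp
    refine (Finset.sum_le_sum hterm).trans (le_of_eq ?_)
    simp

/-- The amount by which the residual at time `t` of the outlier-free model, with estimation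
errors `τ / √n` and `θ / √n`, falls below the innovation. -/
noncomputable def drift {p : ℕ} (b θ : Fin p → ℝ) (τ s : ℝ) (u : ℤ → ℝ) (t : ℤ) : ℝ :=
  (∑ j : Fin p, θ j * u (t - ((j : ℕ) + 1 : ℤ)) + τ * delta b - τ * (∑ j, θ j) / s) / s

theorem abs_drift_le {b θ : Fin p → ℝ} {τ s M : ℝ} (hs : 1 ≤ s) (hτ : |τ| ≤ M)
    (hθ : ∀ j, |θ j| ≤ M) {u : ℤ → ℝ} {w : Fin p → ℝ} {t : ℤ}
    (hu : ∀ j : Fin p, |u (t - ((j : ℕ) + 1 : ℤ))| ≤ w j) :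
    |drift b θ τ s u t| ≤ (M + M * |delta b| + p * M ^ 2) / s * (1 + ∑ j, w j) := by
  have hM : 0 ≤ M := (abs_nonneg _).trans hτ
  have hs0 : 0 < s := by linarith
  have hw : ∀ j, 0 ≤ w j := fun j => (abs_nonneg _).trans (hu j)
  have hW : 0 ≤ ∑ j, w j := Finset.sum_nonneg fun j _ => hw j
  have h1 : |∑ j : Fin p, θ j * u (t - ((j : ℕ) + 1 : ℤ))| ≤ M * ∑ j, w j := by
    refine (Finset.abs_sum_le_sum_abs _ _).trans ?_
    rw [Finset.mul_sum]
    refine Finset.sum_le_sum fun j _ => ?_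
    rw [abs_mul]
    exact mul_le_mul (hθ j) (hu j) (abs_nonneg _) hM
  have h2 : |τ * delta b| ≤ M * |delta b| := by
    rw [abs_mul]
    gcongr
  have h3 : |τ * (∑ j, θ j) / s| ≤ p * M ^ 2 := by
    rw [abs_div, abs_of_pos hs0]
    refine (div_le_self (abs_nonneg _) hs).trans ?_
    rw [abs_mul]
    have : |∑ j, θ j| ≤ p * M := by
      refine (Finset.abs_sum_le_sum_abs _ _).trans ((Finset.sum_le_sum fun j _ => hθ j).trans ?_)
      simp
    calc |τ| * |∑ j, θ j| ≤ M * (p * M) := by gcongr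
      _ = p * M ^ 2 := by ring
  unfold drift
  rw [abs_div, abs_of_pos hs0, div_mul_eq_mul_div]
  gcongr
  refine ((abs_sub _ _).trans (add_le_add (abs_add_le _ _) le_rfl)).trans ?_
  have hMd : 0 ≤ M * |delta b| := by positivity
  have hpM : 0 ≤ (p : ℝ) * M ^ 2 := by positivity
  nlinarith [mul_nonneg hMd hW, mul_nonneg hpM hW]

/-- An exact identity: the term bilinear in the estimation errors is kept inside `drift`. The
coefficient `-1` at lag `0` accounts for the outlier in the current observation. -/
theorem arResidual_eq {b θ : Fin p → ℝ} {μ τ s : ℝ} {e w y : ℤ → ℝ}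
    (h : ∀ t, w t = ∑ j : Fin p, b j * w (t - ((j : ℕ) + 1 : ℤ)) + e t) (t : ℤ) :
    arResidual (fun j => b j + θ j / s) (μ + τ / s) (fun t => w t + μ + y t) t
      = e t - ∑ i : Fin (p + 1), fullCoeff b i * y (t - (i : ℕ))
        - drift b θ τ s (fun t => w t + y t) t := by
  have h1 : ∀ j : Fin p, (b j + θ j / s)
        * (w (t - ((j : ℕ) + 1 : ℤ)) + μ + y (t - ((j : ℕ) + 1 : ℤ)) - (μ + τ / s))
      = b j * w (t - ((j : ℕ) + 1 : ℤ)) + b j * y (t - ((j : ℕ) + 1 : ℤ))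
        + (θ j * (w (t - ((j : ℕ) + 1 : ℤ)) + y (t - ((j : ℕ) + 1 : ℤ)))) / s
        - b j * (τ / s) - θ j * (τ / s / s) := by
    intro j
    ring
  have h2 : ((0 : ℕ) : ℤ) = 0 := rfl
  unfold arResidual drift
  rw [Fin.sum_univ_succ]
  simp only [h1, Finset.sum_sub_distrib, Finset.sum_add_distrib, ← Finset.sum_mul,
    ← Finset.sum_div, fullCoeff, Fin.cons_zero, Fin.cons_succ, Fin.val_zero, Fin.val_succ,
    Nat.cast_add, Nat.cast_one, h2, sub_zero, delta]
  rw [h t]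
  ring

/-- The pathwise comparison is applied with `d` the drift built from `v - μ` and `d'` the one built
from the contaminated values. As `|z ξ| ≤ |ξ|`, one bound serves both; they coincide when the window
is free of outliers. -/
theorem abs_residual_step_sub_le {b θ : Fin p → ℝ} {μ τ s M R x : ℝ} (hs : 1 ≤ s)
    (hτ : |τ| ≤ M) (hθ : ∀ j, |θ j| ≤ M) {ε v z ξ : ℤ → Ω → ℝ} {ω : Ω}
    (h : ∀ t, v t ω - μ = ∑ j : Fin p, b j * (v (t - ((j : ℕ) + 1 : ℤ)) ω - μ) + ε t ω)
    (hz : ∀ t, z t ω = 0 ∨ z t ω = 1) (t : ℤ) :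
    |step x (arResidual (fun j => b j + θ j / s) (μ + τ / s) (obs v z ξ ω) t)
        - step x (ε t ω - drift b θ τ s (fun t => v t ω - μ) t)
        - ∑ i : Fin (p + 1), (step x (ε t ω
            - fullCoeff b i * (z (t - (i : ℕ)) ω * ξ (t - (i : ℕ)) ω)) - step x (ε t ω))|
      ≤ remainderBound b μ x ((M + M * |delta b| + p * M ^ 2) / s * (1 + 2 * p * R)) R
          ε v z ξ t ω := by
  have hM : 0 ≤ M := (abs_nonneg _).trans hτ
  set r₀ : ℝ := (M + M * |delta b| + p * M ^ 2) / s with hr₀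
  have hr₀0 : 0 ≤ r₀ := by positivity
  have hobs : obs v z ξ ω = fun t => (v t ω - μ) + μ + z t ω * ξ t ω := by
    ext t; unfold obs; ring
  rw [hobs, arResidual_eq (w := fun t => v t ω - μ) (e := fun t => ε t ω)
    (y := fun t => z t ω * ξ t ω) h t]
  have hzξ : ∀ t, |z t ω * ξ t ω| ≤ |ξ t ω| := by
    intro t
    rcases hz t with h0 | h0 <;> simp [h0]
  set U : ℝ := ∑ j : Fin p, (|v (t - ((j : ℕ) + 1 : ℤ)) ω - μ| + |ξ (t - ((j : ℕ) + 1 : ℤ)) ω|)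
    with hU
  have hd : |drift b θ τ s (fun t => v t ω - μ) t| ≤ r₀ * (1 + U) :=
    abs_drift_le hs hτ hθ fun j => le_add_of_nonneg_right (abs_nonneg _)
  have hd' : |drift b θ τ s (fun t => v t ω - μ + z t ω * ξ t ω) t| ≤ r₀ * (1 + U) :=
    abs_drift_le hs hτ hθ fun j => (abs_add_le _ _).trans (add_le_add le_rfl (hzξ _))
  have ho : ∀ i : Fin (p + 1), occ (z (t - (i : ℕ)) ω) = 0
      ∧ z (t - (i : ℕ)) ω * ξ (t - (i : ℕ)) ω = 0 ∨ occ (z (t - (i : ℕ)) ω) = 1 := by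
    intro i
    rcases hz (t - (i : ℕ)) with h0 | h0 <;> simp [h0, occ]
  have hdd : (∀ i : Fin (p + 1), occ (z (t - (i : ℕ)) ω) = 0) →
      drift b θ τ s (fun t => v t ω - μ + z t ω * ξ t ω) t
        = drift b θ τ s (fun t => v t ω - μ) t := by
    intro hall
    have h0 : ∀ j : Fin p, z (t - ((j : ℕ) + 1 : ℤ)) ω = 0 := by
      intro j
      have h1 := hall j.succ
      rw [Fin.val_succ, Nat.cast_add, Nat.cast_one] at h1
      by_contra hne
      rw [occ, if_neg hne] at h1
      norm_num at h1
    simp [drift, h0]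
  have hmain := abs_contamination_remainder_le (c := fullCoeff b) (x := x) (e := ε t ω) ho hd hd'
    hdd
  refine hmain.trans ?_
  have hcard : ((Fintype.card (Fin (p + 1)) : ℕ) : ℝ) + 1 = p + 2 := by
    rw [Fintype.card_fin]
    push_cast
    ring
  rw [hcard]
  unfold remainderBound
  refine add_le_add ?_ le_rfl
  rw [Finset.sum_mul]
  refine Finset.sum_le_sum fun i _ => ?_
  have e1 : ε t ω + -∑ k : Fin (p + 1), fullCoeff b k * (z (t - (k : ℕ)) ω * ξ (t - (k : ℕ)) ω) - x
      = ε t ω - ∑ k : Fin (p + 1), fullCoeff b k * (z (t - (k : ℕ)) ω * ξ (t - (k : ℕ)) ω) - x := by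
    ring
  rw [e1, add_zero]
  simp only [← mul_add, ← Finset.mul_sum]
  have n1 := fun y => near_mul_le (R := R) hr₀0 (fun j : Fin p => v (t - ((j : ℕ) + 1 : ℤ)) ω - μ)
    (fun j : Fin p => ξ (t - ((j : ℕ) + 1 : ℤ)) ω) y
  rw [mul_left_comm, ← mul_add]
  refine mul_le_mul_of_nonneg_left ?_ (occ_nonneg _)
  refine (add_le_add (n1 _) (n1 _)).trans (le_of_eq ?_)
  ring

end RemainderBound

/-! ### Replacing the random parameter by finitely many deterministic ones. -/

section Cells

variable {p : ℕ}

/-- The extremal linear drift over the cell of radius `|κ|` around the parameter `(τ, θ)`, as a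
function of the lagged values `y`. -/
def cellDrift (b : Fin p → ℝ) (f : ℝ × (Fin p → ℝ)) (κ : ℝ) (y : Fin p → ℝ) : ℝ :=
  ∑ j, f.2 j * y j + f.1 * delta b + κ * (∑ j, |y j| + |delta b| + 1)

theorem measurable_cellDrift (b : Fin p → ℝ) (f : ℝ × (Fin p → ℝ)) (κ : ℝ) :
    Measurable (cellDrift b f κ) := by
  unfold cellDrift
  fun_prop

theorem cellDrift_sq_le {b : Fin p → ℝ} {f : ℝ × (Fin p → ℝ)} {κ M : ℝ} (hf1 : |f.1| ≤ M)
    (hf2 : ∀ j, |f.2 j| ≤ M) (hκ : |κ| ≤ 1) (y : Fin p → ℝ) :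
    cellDrift b f κ y ^ 2 ≤ 2 * (M + 1) ^ 2 * (p * ∑ j, y j ^ 2 + (|delta b| + 1) ^ 2) := by
  have hM : 0 ≤ M := (abs_nonneg _).trans hf1
  have hS : 0 ≤ ∑ j, |y j| := Finset.sum_nonneg fun j _ => abs_nonneg _
  have h1 : |∑ j, f.2 j * y j| ≤ M * ∑ j, |y j| := by
    refine (Finset.abs_sum_le_sum_abs _ _).trans ?_
    rw [Finset.mul_sum]
    refine Finset.sum_le_sum fun j _ => ?_
    rw [abs_mul]
    exact mul_le_mul_of_nonneg_right (hf2 j) (abs_nonneg _)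
  have h2 : |f.1 * delta b| ≤ M * |delta b| := by
    rw [abs_mul]
    exact mul_le_mul_of_nonneg_right hf1 (abs_nonneg _)
  have h3 : |κ * (∑ j, |y j| + |delta b| + 1)| ≤ 1 * (∑ j, |y j| + |delta b| + 1) := by
    rw [abs_mul, abs_of_nonneg (a := ∑ j, |y j| + |delta b| + 1) (by positivity)]
    exact mul_le_mul_of_nonneg_right hκ (by positivity)
  have h4 : |cellDrift b f κ y| ≤ (M + 1) * (∑ j, |y j| + (|delta b| + 1)) := by
    unfold cellDrift
    refine ((abs_add_le _ _).trans (add_le_add (abs_add_le _ _) le_rfl)).trans ?_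
    nlinarith
  have h5 : (∑ j, |y j|) ^ 2 ≤ p * ∑ j, y j ^ 2 := by
    have := sq_sum_le_card_mul_sum_sq (s := (Finset.univ : Finset (Fin p))) (f := fun j => |y j|)
    simpa using this
  rw [← sq_abs]
  refine (pow_le_pow_left₀ (abs_nonneg _) h4 2).trans ?_
  rw [mul_pow, mul_comm 2, mul_assoc]
  gcongr
  nlinarith [sq_nonneg (∑ j, |y j| - (|delta b| + 1))]

/-- Moving `τ` and `θ` by `η` changes the linear part by at most `η (∑ |y_j| + |δ(β)|)`. The
additional `1` in `cellDrift` pays for the bilinear term, which is below `η` for large `n`. -/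
theorem drift_mem_cell {b θ : Fin p → ℝ} {τ s M η : ℝ} {f : ℝ × (Fin p → ℝ)} (hs : 0 < s)
    (hτ : |τ| ≤ M) (hθ : ∀ j, |θ j| ≤ M) (h1 : |τ - f.1| ≤ η) (h2 : ∀ j, |θ j - f.2 j| ≤ η)
    (hsmall : p * M ^ 2 / s ≤ η) (u : ℤ → ℝ) (t : ℤ) :
    cellDrift b f (-η) (fun j => u (t - ((j : ℕ) + 1 : ℤ))) / s ≤ drift b θ τ s u t ∧
      drift b θ τ s u t ≤ cellDrift b f η (fun j => u (t - ((j : ℕ) + 1 : ℤ))) / s := by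
  have hM : 0 ≤ M := (abs_nonneg _).trans hτ
  set y : Fin p → ℝ := fun j => u (t - ((j : ℕ) + 1 : ℤ)) with hy
  have e1 : |∑ j, θ j * y j - ∑ j, f.2 j * y j| ≤ η * ∑ j, |y j| := by
    rw [← Finset.sum_sub_distrib, Finset.mul_sum]
    refine (Finset.abs_sum_le_sum_abs _ _).trans (Finset.sum_le_sum fun j _ => ?_)
    rw [← sub_mul, abs_mul]
    exact mul_le_mul_of_nonneg_right (h2 j) (abs_nonneg _)
  have e2 : |τ * delta b - f.1 * delta b| ≤ η * |delta b| := by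
    rw [← sub_mul, abs_mul]
    exact mul_le_mul_of_nonneg_right h1 (abs_nonneg _)
  have e3 : |τ * (∑ j, θ j) / s| ≤ η := by
    refine le_trans ?_ hsmall
    rw [abs_div, abs_of_pos hs, abs_mul]
    refine div_le_div_of_nonneg_right ?_ hs.le
    have : |∑ j, θ j| ≤ p * M := by
      refine (Finset.abs_sum_le_sum_abs _ _).trans ((Finset.sum_le_sum fun j _ => hθ j).trans ?_)
      simp
    calc |τ| * |∑ j, θ j| ≤ M * (p * M) := by gcongr
      _ = p * M ^ 2 := by ring
  have e1' := abs_le.1 e1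
  have e2' := abs_le.1 e2
  have e3' := abs_le.1 e3
  have hd : drift b θ τ s u t = (∑ j, θ j * y j + τ * delta b - τ * (∑ j, θ j) / s) / s := rfl
  rw [hd]
  constructor
  · refine div_le_div_of_nonneg_right ?_ hs.le
    unfold cellDrift
    linarith
  · refine div_le_div_of_nonneg_right ?_ hs.le
    unfold cellDrift
    linarith

/-- The centred and scaled empirical process of the innovations at shifts given by `cellDrift`. -/
noncomputable def cellFluct (b : Fin p → ℝ) (g x : ℝ) (n : ℕ) (f : ℝ × (Fin p → ℝ)) (κ : ℝ)
    (u e : ℤ → ℝ) : ℝ :=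
  (√n)⁻¹ * ∑ t ∈ Finset.Icc (1 : ℤ) n,
      (step x (e t - cellDrift b f κ (fun j => u (t - ((j : ℕ) + 1 : ℤ))) / √n) - step x (e t))
    - g * ((n : ℝ)⁻¹ * ∑ t ∈ Finset.Icc (1 : ℤ) n,
        cellDrift b f κ (fun j => u (t - ((j : ℕ) + 1 : ℤ))))

/-- The error in approximating the mean of `cellDrift` by `τ δ(β)`. -/
noncomputable def meanError (b : Fin p → ℝ) (M η : ℝ) (n : ℕ) (u : ℤ → ℝ) : ℝ :=
  M * ∑ j : Fin p, |(n : ℝ)⁻¹ * ∑ t ∈ Finset.Icc (1 : ℤ) n, u (t - ((j : ℕ) + 1 : ℤ))|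
    + η * (2 * |delta b| + 1
        + (n : ℝ)⁻¹ * ∑ t ∈ Finset.Icc (1 : ℤ) n, ∑ j : Fin p, |u (t - ((j : ℕ) + 1 : ℤ))|)

theorem abs_mean_cellDrift_sub_le {b : Fin p → ℝ} {f : ℝ × (Fin p → ℝ)} {κ τ M η : ℝ}
    {n : ℕ} (hn : 1 ≤ n) (hf2 : ∀ j, |f.2 j| ≤ M) (hκ : |κ| ≤ η) (h1 : |τ - f.1| ≤ η)
    (u : ℤ → ℝ) :
    |(n : ℝ)⁻¹ * ∑ t ∈ Finset.Icc (1 : ℤ) n, cellDrift b f κ (fun j => u (t - ((j : ℕ) + 1 : ℤ)))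
      - delta b * τ| ≤ meanError b M η n u := by
  have hn0 : (0 : ℝ) < n := by exact_mod_cast hn
  have hcard : (Finset.Icc (1 : ℤ) n).card = n := by simp
  set W : ℝ := (n : ℝ)⁻¹ * ∑ t ∈ Finset.Icc (1 : ℤ) n, ∑ j : Fin p, |u (t - ((j : ℕ) + 1 : ℤ))|
    with hW
  have hW0 : 0 ≤ W := by positivity
  have e1 : (n : ℝ)⁻¹ * ∑ t ∈ Finset.Icc (1 : ℤ) n,
        cellDrift b f κ (fun j => u (t - ((j : ℕ) + 1 : ℤ))) - delta b * τ
      = ∑ j, f.2 j * ((n : ℝ)⁻¹ * ∑ t ∈ Finset.Icc (1 : ℤ) n, u (t - ((j : ℕ) + 1 : ℤ)))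
        + κ * (W + |delta b| + 1) - (τ - f.1) * delta b := by
    simp only [cellDrift, Finset.sum_add_distrib, Finset.sum_const, hcard, nsmul_eq_mul,
      ← Finset.mul_sum]
    rw [Finset.sum_comm]
    have e2 : ∑ j, f.2 j * ((n : ℝ)⁻¹ * ∑ t ∈ Finset.Icc (1 : ℤ) n, u (t - ((j : ℕ) + 1 : ℤ)))
        = (n : ℝ)⁻¹ * ∑ j, ∑ t ∈ Finset.Icc (1 : ℤ) n, f.2 j * u (t - ((j : ℕ) + 1 : ℤ)) := by
      rw [Finset.mul_sum]
      refine Finset.sum_congr rfl fun j _ => ?_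
      rw [← Finset.mul_sum]
      ring
    rw [e2, hW]
    field_simp
    ring
  rw [e1]
  have a1 : |∑ j, f.2 j * ((n : ℝ)⁻¹ * ∑ t ∈ Finset.Icc (1 : ℤ) n, u (t - ((j : ℕ) + 1 : ℤ)))|
      ≤ M * ∑ j : Fin p, |(n : ℝ)⁻¹ * ∑ t ∈ Finset.Icc (1 : ℤ) n, u (t - ((j : ℕ) + 1 : ℤ))| := by
    rw [Finset.mul_sum]
    refine (Finset.abs_sum_le_sum_abs _ _).trans (Finset.sum_le_sum fun j _ => ?_)
    rw [abs_mul]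
    exact mul_le_mul_of_nonneg_right (hf2 j) (abs_nonneg _)
  have a2 : |κ * (W + |delta b| + 1)| ≤ η * (W + |delta b| + 1) := by
    rw [abs_mul, abs_of_nonneg (a := W + |delta b| + 1) (by positivity)]
    exact mul_le_mul_of_nonneg_right hκ (by positivity)
  have a3 : |(τ - f.1) * delta b| ≤ η * |delta b| := by
    rw [abs_mul]
    exact mul_le_mul_of_nonneg_right h1 (abs_nonneg _)
  refine ((abs_sub _ _).trans (add_le_add (abs_add_le _ _) le_rfl)).trans ?_
  unfold meanError
  linarith

/-- The sandwich: the indicator decreases in its argument, so the extremal drifts of the cell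
enclose the process at the random parameter. On the right-hand side the parameter enters only
through the choice of `f`. -/
theorem abs_clean_process_sub_le {b θ : Fin p → ℝ} {τ M η g x : ℝ} {f : ℝ × (Fin p → ℝ)} {n : ℕ}
    (hn : 1 ≤ n) (hg : 0 ≤ g) (hτ : |τ| ≤ M) (hθ : ∀ j, |θ j| ≤ M) (hf2 : ∀ j, |f.2 j| ≤ M)
    (h1 : |τ - f.1| ≤ η) (h2 : ∀ j, |θ j - f.2 j| ≤ η) (hsmall : p * M ^ 2 / √n ≤ η)
    (u e : ℤ → ℝ) :
    |(√n)⁻¹ * ∑ t ∈ Finset.Icc (1 : ℤ) n, (step x (e t - drift b θ τ (√n) u t) - step x (e t))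
        - g * delta b * τ|
      ≤ |cellFluct b g x n f η u e| + |cellFluct b g x n f (-η) u e|
        + g * meanError b M η n u := by
  have hs0 : (0 : ℝ) < √n := Real.sqrt_pos.2 (by exact_mod_cast hn)
  have hη : 0 ≤ η := (abs_nonneg _).trans h1
  have hcell := fun t => drift_mem_cell (b := b) hs0 hτ hθ h1 h2 hsmall u t
  have hup : (√n)⁻¹ * ∑ t ∈ Finset.Icc (1 : ℤ) n,
        (step x (e t - drift b θ τ (√n) u t) - step x (e t))
      ≤ (√n)⁻¹ * ∑ t ∈ Finset.Icc (1 : ℤ) n,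
      (step x (e t - cellDrift b f η (fun j => u (t - ((j : ℕ) + 1 : ℤ))) / √n)
        - step x (e t)) := by
    gcongr with t _
    exact step_antitone x (by linarith [(hcell t).2])
  have hlo : (√n)⁻¹ * ∑ t ∈ Finset.Icc (1 : ℤ) n,
      (step x (e t - cellDrift b f (-η) (fun j => u (t - ((j : ℕ) + 1 : ℤ))) / √n)
        - step x (e t))
      ≤ (√n)⁻¹ * ∑ t ∈ Finset.Icc (1 : ℤ) n,
        (step x (e t - drift b θ τ (√n) u t) - step x (e t)) := by
    gcongr with t _
    exact step_antitone x (by linarith [(hcell t).1])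
  have mup := abs_le.1 (abs_mean_cellDrift_sub_le (b := b) (f := f) (κ := η) (τ := τ) hn hf2
    (abs_of_nonneg hη).le h1 u)
  have mlo := abs_le.1 (abs_mean_cellDrift_sub_le (b := b) (f := f) (κ := -η) (τ := τ) hn hf2
    (by rw [abs_neg]; exact (abs_of_nonneg hη).le) h1 u)
  have gup := mul_le_mul_of_nonneg_left mup.2 hg
  have glo := mul_le_mul_of_nonneg_left mlo.1 hg
  have p1 := le_abs_self (cellFluct b g x n f η u e)
  have p2 := neg_abs_le (cellFluct b g x n f (-η) u e)
  have q1 := abs_nonneg (cellFluct b g x n f η u e)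
  have q2 := abs_nonneg (cellFluct b g x n f (-η) u e)
  rw [abs_le]
  unfold cellFluct at p1 p2 q1 q2 ⊢
  constructor <;> linarith

end Cells

/-! ### Expected size of the cell processes and of the mean error. -/

section CellExpectation

variable {Ω : Type*} [mΩ : MeasurableSpace Ω] {P : Measure Ω} [IsProbabilityMeasure P]
  {p : ℕ} {b : Fin p → ℝ} {Q : Measure ℝ} {ε v : ℤ → Ω → ℝ} {μ ν : ℝ}

/-- The lagged values are replaced by `causalState` at time `t - 1`, almost surely equal to them and
measurable with respect to the innovations before `t`, so that the estimate for predictable shifts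
applies. -/
theorem IsStationarySolution.integral_abs_cellFluct_le [IsProbabilityMeasure Q]
    (h : IsStationarySolution P b ν ε v) (hν : ν = delta b * μ) (hε : IsIID P ε Q)
    (hQ : MemLp id 2 Q) {C' ρ : ℝ} (hC' : 0 ≤ C') (hρ : 0 < ρ) (hρ1 : ρ < 1)
    (hT : ∀ (m : ℕ) (u : Fin p → ℝ), ‖(companion b ^ m) u‖ ≤ C' * ρ ^ m * ‖u‖)
    (hG : Differentiable ℝ (cdf Q)) (hg : Differentiable ℝ (deriv (cdf Q))) {C : ℝ}
    (hC : ∀ s, |deriv (deriv (cdf Q)) s| ≤ C) {f : ℝ × (Fin p → ℝ)} {κ M : ℝ} (hf1 : |f.1| ≤ M)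
    (hf2 : ∀ j, |f.2 j| ≤ M) (hκ : |κ| ≤ 1) (x : ℝ) {n : ℕ} (hn : 1 ≤ n) {K : ℝ}
    (hK : K = 2 * (M + 1) ^ 2 * (p * (p * momentBound C' ρ Q) + (|delta b| + 1) ^ 2)) :
    Integrable (fun ω => |cellFluct b (deriv (cdf Q) x) x n f κ (fun t => v t ω - μ)
        (fun t => ε t ω)|) P ∧
    ∫ ω, |cellFluct b (deriv (cdf Q) x) x n f κ (fun t => v t ω - μ) (fun t => ε t ω)| ∂P
      ≤ √((1 + C) * √K / √n) + C * K / √n := by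
  set a : ℤ → Ω → ℝ := fun t ω => cellDrift b f κ (causalState b ε (t - 1) ω) with ha
  have ham : ∀ t, Measurable[innovationAlgebra ε (t - 1)] (a t) := fun t =>
    (measurable_cellDrift b f κ).comp (measurable_causalState (t - 1))
  have ham' : ∀ t, Measurable (a t) := fun t =>
    (ham t).mono (innovationAlgebra_le hε.measurable _) le_rfl
  have hmom := fun t i => moment_causalState hε hQ hC' hρ hρ1 hT t i
  have hsqi : ∀ t, Integrable (fun ω => 2 * (M + 1) ^ 2 *
      (p * ∑ j, causalState b ε (t - 1) ω j ^ 2 + (|delta b| + 1) ^ 2)) P := fun t =>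
    (((integrable_finsetSum _ fun j _ => (hmom (t - 1) j).1.integrable_sq).const_mul _).add
      (integrable_const _)).const_mul _
  have hsq : ∀ t ω, a t ω ^ 2 ≤ 2 * (M + 1) ^ 2 *
      (p * ∑ j, causalState b ε (t - 1) ω j ^ 2 + (|delta b| + 1) ^ 2) := fun t ω =>
    cellDrift_sq_le hf1 hf2 hκ _
  have ha2 : ∀ t, MemLp (a t) 2 P := by
    intro t
    rw [memLp_two_iff_integrable_sq (ham' t).aestronglyMeasurable]
    refine Integrable.mono' (hsqi t) ((ham' t).pow_const 2).aestronglyMeasurable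
      (ae_of_all _ fun ω => ?_)
    rw [Real.norm_eq_abs, abs_of_nonneg (sq_nonneg _)]
    exact hsq t ω
  have haK : ∀ t, ∫ ω, a t ω ^ 2 ∂P ≤ K := by
    intro t
    refine (integral_mono_of_nonneg (ae_of_all _ fun ω => sq_nonneg _) (hsqi t)
      (ae_of_all _ (hsq t))).trans ?_
    rw [integral_const_mul, integral_add ((integrable_finsetSum _ fun j _ =>
      (hmom (t - 1) j).1.integrable_sq).const_mul _) (integrable_const _), integral_const_mul,
      integral_finsetSum _ fun j _ => (hmom (t - 1) j).1.integrable_sq, hK]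
    simp only [integral_const, probReal_univ, smul_eq_mul, one_mul]
    gcongr
    refine (Finset.sum_le_sum fun j _ => (hmom (t - 1) j).2).trans ?_
    simp
  have hmain := integral_abs_sum_step_sub_le hG hg hC x hn (innovationAlgebra_mono ε)
    (innovationAlgebra_le hε.measurable) (fun t => measurable_innovation le_rfl) ham hε.law
    hε.indep_innovationAlgebra ha2 haK
  have hae : (fun ω => |(√n)⁻¹ * ∑ t ∈ Finset.Icc (1 : ℤ) n,
        (step x (ε t ω - a t ω / √n) - step x (ε t ω))
        - deriv (cdf Q) x * ((n : ℝ)⁻¹ * ∑ t ∈ Finset.Icc (1 : ℤ) n, a t ω)|)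
      =ᵐ[P] fun ω => |cellFluct b (deriv (cdf Q) x) x n f κ (fun t => v t ω - μ)
        (fun t => ε t ω)| := by
    have h1 : ∀ᵐ ω ∂P, ∀ t : ℤ, causalState b ε (t - 1) ω
        = fun i : Fin p => v (t - 1 - (i : ℕ)) ω - μ :=
      ae_all_iff.2 fun t => h.ae_eq_causalState hν hε hQ hC' hρ hρ1 hT (t - 1)
    filter_upwards [h1] with ω hω
    have h2 : ∀ t, a t ω = cellDrift b f κ (fun j => v (t - ((j : ℕ) + 1 : ℤ)) ω - μ) := by
      intro t
      simp only [ha]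
      rw [hω t]
      congr 1
      ext j
      congr 2
      ring
    simp only [h2]
    rfl
  have hint : Integrable (fun ω => |(√n)⁻¹ * ∑ t ∈ Finset.Icc (1 : ℤ) n,
        (step x (ε t ω - a t ω / √n) - step x (ε t ω))
        - deriv (cdf Q) x * ((n : ℝ)⁻¹ * ∑ t ∈ Finset.Icc (1 : ℤ) n, a t ω)|) P := by
    refine Integrable.abs (Integrable.sub ?_ ?_)
    · refine (integrable_finsetSum _ fun t _ => ?_).const_mul _
      refine integrable_of_abs_le (c := 1) ?_ fun ω => abs_step_sub_step_le_one _ _ _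
      exact ((measurable_step x).comp ((hε.measurable t).sub ((ham' t).div_const _))).sub
        ((measurable_step x).comp (hε.measurable t))
    · exact ((integrable_finsetSum _ fun t _ => (ha2 t).integrable one_le_two).const_mul _).const_mul _
  exact ⟨hint.congr hae, (integral_congr_ae hae).symm.le.trans hmain⟩

theorem IsStationarySolution.integral_meanError_le
    (h : IsStationarySolution P b ν ε v) (hν : ν = delta b * μ) (hε : IsIID P ε Q)
    (hQ : MemLp id 2 Q) (hmean : ∫ s, s ∂Q = 0) (hδ : delta b ≠ 0) {K : ℝ}
    (hK : ∀ (_ : Fin p) t, MemLp (fun ω => v t ω - μ) 2 P ∧ ∫ ω, (v t ω - μ) ^ 2 ∂P ≤ K)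
    {M η : ℝ} (hM : 0 ≤ M) (hη : 0 ≤ η) {n : ℕ} (hn : 1 ≤ n) :
    Integrable (fun ω => meanError b M η n fun t => v t ω - μ) P ∧
    ∫ ω, meanError b M η n (fun t => v t ω - μ) ∂P
      ≤ M * (p * ((√(∫ s, s ^ 2 ∂Q) + ∑ j : Fin p, |b j| * ((j + 1) * (2 * √K)))
          / |delta b| / √n))
        + η * (2 * |delta b| + 1 + p * √K) := by
  have hn0 : (0 : ℝ) < n := by exact_mod_cast hn
  have hcard : (Finset.Icc (1 : ℤ) n).card = n := by simp
  have hvi : ∀ (_ : Fin p) t, Integrable (fun ω => v t ω - μ) P := fun j t =>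
    (hK j t).1.integrable one_le_two
  have i1 : ∀ j : Fin p, Integrable (fun ω => |(n : ℝ)⁻¹ * ∑ t ∈ Finset.Icc (1 : ℤ) n,
      (v (t - ((j : ℕ) + 1 : ℤ)) ω - μ)|) P := fun j =>
    ((integrable_finsetSum _ fun t _ => hvi j _).const_mul _).abs
  have i1s : Integrable (fun ω => M * ∑ j : Fin p, |(n : ℝ)⁻¹ * ∑ t ∈ Finset.Icc (1 : ℤ) n,
      (v (t - ((j : ℕ) + 1 : ℤ)) ω - μ)|) P := (integrable_finsetSum _ fun j _ => i1 j).const_mul _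
  have i2 : ∀ t, Integrable (fun ω => ∑ j : Fin p, |v (t - ((j : ℕ) + 1 : ℤ)) ω - μ|) P := fun t =>
    integrable_finsetSum _ fun j _ => (hvi j _).abs
  have i2s : Integrable (fun ω => (n : ℝ)⁻¹ * ∑ t ∈ Finset.Icc (1 : ℤ) n,
      ∑ j : Fin p, |v (t - ((j : ℕ) + 1 : ℤ)) ω - μ|) P :=
    (integrable_finsetSum _ fun t _ => i2 t).const_mul _
  have i2ss : Integrable (fun ω => η * (2 * |delta b| + 1
        + (n : ℝ)⁻¹ * ∑ t ∈ Finset.Icc (1 : ℤ) n,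
      ∑ j : Fin p, |v (t - ((j : ℕ) + 1 : ℤ)) ω - μ|)) P :=
    ((integrable_const _).add i2s).const_mul _
  refine ⟨i1s.add i2ss, ?_⟩
  refine (integral_add i1s i2ss).le.trans (add_le_add ?_ ?_)
  · rw [integral_const_mul, integral_finsetSum _ fun j _ => i1 j]
    gcongr
    refine (Finset.sum_le_sum fun j _ => h.integral_abs_mean_le hν hε hQ hmean hδ (hK j) hn _).trans
      (le_of_eq ?_)
    rw [Finset.sum_const, Finset.card_univ, Fintype.card_fin, nsmul_eq_mul]
  · rw [integral_const_mul, integral_add (integrable_const _) i2s, integral_const_mul,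
      integral_finsetSum _ fun t _ => i2 t]
    simp only [integral_const, probReal_univ, smul_eq_mul, one_mul]
    refine mul_le_mul_of_nonneg_left (add_le_add le_rfl ?_) hη
    rw [inv_mul_le_iff₀ hn0]
    have h1 : ∀ t ∈ Finset.Icc (1 : ℤ) n,
        ∫ ω, ∑ j : Fin p, |v (t - ((j : ℕ) + 1 : ℤ)) ω - μ| ∂P ≤ p * √K := by
      intro t _
      rw [integral_finsetSum _ fun j _ => (hvi j _).abs]
      refine (Finset.sum_le_sum fun j _ => (integral_abs_le_sqrt (hK j _).1).trans
        (Real.sqrt_le_sqrt (hK j _).2)).trans (le_of_eq ?_)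
      rw [Finset.sum_const, Finset.card_univ, Fintype.card_fin, nsmul_eq_mul]
    refine (Finset.sum_le_sum h1).trans (le_of_eq ?_)
    rw [Finset.sum_const, hcard, nsmul_eq_mul]

end CellExpectation

/-! ### The dominating random variable and its expectation. -/

section Assembly

/-- Compactness of a ball in the finite-dimensional parameter space. The centres stay inside the
ball, so the moment bounds hold for them with the same `M`. -/
theorem exists_finite_net (p : ℕ) (M : ℝ) {η : ℝ} (hη : 0 < η) :
    ∃ F : Finset (ℝ × (Fin p → ℝ)), (∀ f ∈ F, |f.1| ≤ M ∧ ∀ j, |f.2 j| ≤ M) ∧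
      ∀ (τ : ℝ) (θ : Fin p → ℝ), |τ| ≤ M → ‖θ‖ ≤ M →
        ∃ f ∈ F, |τ - f.1| ≤ η ∧ ∀ j, |θ j - f.2 j| ≤ η := by
  obtain ⟨T, hTsub, hTfin, hTcov⟩ :=
    (isCompact_closedBall (0 : ℝ × (Fin p → ℝ)) M).finite_cover_balls hη
  refine ⟨hTfin.toFinset, fun f hf => ?_, fun τ θ hτ hθ => ?_⟩
  · have h1 := hTsub (hTfin.mem_toFinset.1 hf)
    rw [mem_closedBall_zero_iff, Prod.norm_def, max_le_iff] at h1
    exact ⟨h1.1, fun j => (norm_le_pi_norm f.2 j).trans h1.2⟩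
  · have h1 : (τ, θ) ∈ Metric.closedBall (0 : ℝ × (Fin p → ℝ)) M := by
      rw [mem_closedBall_zero_iff, Prod.norm_def, max_le_iff]
      exact ⟨hτ, hθ⟩
    obtain ⟨f, hfT, hf⟩ := Set.mem_iUnion₂.1 (hTcov h1)
    rw [Metric.mem_ball, dist_eq_norm, Prod.norm_def, max_lt_iff] at hf
    exact ⟨f, hTfin.mem_toFinset.2 hfT, hf.1.le, fun j =>
      (norm_le_pi_norm (θ - f.2) j).trans hf.2.le⟩

/-- Dominated convergence; the outlier law need not have any moment. -/
theorem tendsto_integral_large (L : Measure ℝ) [IsProbabilityMeasure L] :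
    Tendsto (fun k : ℕ => ∫ u, large (k : ℝ) u ∂L) atTop (𝓝 0) := by
  have h := tendsto_integral_of_dominated_convergence (μ := L)
    (F := fun (k : ℕ) u => large (k : ℝ) u) (f := fun _ => (0 : ℝ)) (fun _ => (1 : ℝ))
    (fun k => (measurable_large _).aestronglyMeasurable) (integrable_const _)
    (fun k => ae_of_all _ fun u => abs_large_le_one _ _) (ae_of_all _ fun u => ?_)
  · simpa using h
  · refine tendsto_const_nhds.congr' ?_
    filter_upwards [eventually_ge_atTop ⌈|u|⌉₊] with k hk
    rw [large, if_neg]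
    exact not_lt.2 (Nat.ceil_le.1 hk)

theorem sqrt_mul_outlierProb {γ : ℝ} {n : ℕ} (hγ : 0 ≤ γ) (hn : 1 ≤ n) (h : γ ≤ √n) :
    √n * (outlierProb γ n : ℝ) = γ := by
  have hs0 : (0 : ℝ) < √n := Real.sqrt_pos.2 (by exact_mod_cast hn)
  rw [coe_outlierProb hγ, min_eq_right ((div_le_one hs0).2 h)]
  field_simp

variable {Ω : Type*} {p : ℕ}

/-- The random variable that dominates the error of the asymptotic expansion, as long as the
scaled estimation errors are bounded by `M`. -/
noncomputable def totalBound (b : Fin p → ℝ) (Q L : Measure ℝ) (q : unitInterval) (μ x M η R : ℝ)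
    (n : ℕ) (F : Finset (ℝ × (Fin p → ℝ))) (ε v z ξ : ℤ → Ω → ℝ) (ω : Ω) : ℝ :=
  ∑ f ∈ F, (|cellFluct b (deriv (cdf Q) x) x n f η (fun t => v t ω - μ) (fun t => ε t ω)|
      + |cellFluct b (deriv (cdf Q) x) x n f (-η) (fun t => v t ω - μ) (fun t => ε t ω)|)
    + deriv (cdf Q) x * meanError b M η n (fun t => v t ω - μ)
    + ∑ i : Fin (p + 1), |(√n)⁻¹ * ∑ t ∈ Finset.Icc (1 : ℤ) n,
          (step x (ε t ω - fullCoeff b i * (z (t - (i : ℕ)) ω * ξ (t - (i : ℕ)) ω))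
            - step x (ε t ω))
        - √n * q * ((∫ u, cdf Q (x + fullCoeff b i * u) ∂L) - cdf Q x)|
    + (√n)⁻¹ * ∑ t ∈ Finset.Icc (1 : ℤ) n,
        remainderBound b μ x ((M + M * |delta b| + p * M ^ 2) / √n * (1 + 2 * p * R)) R ε v z ξ t ω

/-- The three-part decomposition for a single outcome. The bound sums over the whole net because the
relevant centre depends on the estimators. -/
theorem abs_expansion_error_le {b : Fin p → ℝ} {Q L : Measure ℝ} {q : unitInterval}
    {μ x M η R : ℝ} {n : ℕ} (hn : 1 ≤ n) {F : Finset (ℝ × (Fin p → ℝ))}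
    {ε v z ξ : ℤ → Ω → ℝ} {ω : Ω} {μhat : ℝ} {bhat : Fin p → ℝ}
    (hF : ∀ f ∈ F, |f.1| ≤ M ∧ ∀ j, |f.2 j| ≤ M)
    (hnet : ∀ (τ : ℝ) (θ : Fin p → ℝ), |τ| ≤ M → ‖θ‖ ≤ M →
        ∃ f ∈ F, |τ - f.1| ≤ η ∧ ∀ j, |θ j - f.2 j| ≤ η)
    (hsmall : p * M ^ 2 / √n ≤ η)
    (h : ∀ t, v t ω - μ = ∑ j : Fin p, b j * (v (t - ((j : ℕ) + 1 : ℤ)) ω - μ) + ε t ω)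
    (hz : ∀ t, z t ω = 0 ∨ z t ω = 1)
    (hμ : ‖√n * (μhat - μ)‖ ≤ M) (hb : ‖√n • (bhat - b)‖ ≤ M) :
    |√n * (empiricalDF (arResidual bhat μhat (obs v z ξ ω)) n x
          - empiricalDF (fun t => ε t ω) n x)
        - deriv (cdf Q) x * delta b * (√n * (μhat - μ)) - √n * q * shift b Q L x|
      ≤ totalBound b Q L q μ x M η R n F ε v z ξ ω := by
  have hn0 : (0 : ℝ) < n := by exact_mod_cast hn
  have hs0 : (0 : ℝ) < √n := Real.sqrt_pos.2 hn0
  have hs1 : (1 : ℝ) ≤ √n := Real.one_le_sqrt.2 (by exact_mod_cast hn)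
  have hss : √(n : ℝ) * √n = n := Real.mul_self_sqrt hn0.le
  set τ : ℝ := √n * (μhat - μ) with hτ
  set θ : Fin p → ℝ := √n • (bhat - b) with hθ
  have hθj : ∀ j, |θ j| ≤ M := fun j => (norm_le_pi_norm θ j).trans hb
  obtain ⟨f, hfF, hf1, hf2⟩ := hnet τ θ hμ hb
  have hμ' : μhat = μ + τ / √n := by rw [hτ]; field_simp; ring
  have hb' : bhat = fun j => b j + θ j / √n := by
    ext j
    simp only [hθ, Pi.smul_apply, Pi.sub_apply, smul_eq_mul]
    field_simp
    ring
  have hres : ∀ t, |step x (arResidual bhat μhat (obs v z ξ ω) t)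
        - step x (ε t ω - drift b θ τ (√n) (fun t => v t ω - μ) t)
        - ∑ i : Fin (p + 1), (step x (ε t ω
            - fullCoeff b i * (z (t - (i : ℕ)) ω * ξ (t - (i : ℕ)) ω)) - step x (ε t ω))|
      ≤ remainderBound b μ x ((M + M * |delta b| + p * M ^ 2) / √n * (1 + 2 * p * R)) R
          ε v z ξ t ω := by
    intro t
    rw [hμ', hb']
    exact abs_residual_step_sub_le hs1 hμ hθj h hz t
  have hclean := abs_clean_process_sub_le (b := b) (x := x) hn
    (deriv_cdf_nonneg (Q := Q) x) hμ hθj (hF f hfF).2 hf1 hf2 hsmall (fun t => v t ω - μ)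
    (fun t => ε t ω)
  have hcell : |cellFluct b (deriv (cdf Q) x) x n f η (fun t => v t ω - μ) (fun t => ε t ω)|
      + |cellFluct b (deriv (cdf Q) x) x n f (-η) (fun t => v t ω - μ) (fun t => ε t ω)|
      ≤ ∑ f ∈ F,
        (|cellFluct b (deriv (cdf Q) x) x n f η (fun t => v t ω - μ) (fun t => ε t ω)|
      + |cellFluct b (deriv (cdf Q) x) x n f (-η) (fun t => v t ω - μ) (fun t => ε t ω)|) :=
    Finset.single_le_sum (f := fun f =>
      |cellFluct b (deriv (cdf Q) x) x n f η (fun t => v t ω - μ) (fun t => ε t ω)|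
      + |cellFluct b (deriv (cdf Q) x) x n f (-η) (fun t => v t ω - μ) (fun t => ε t ω)|)
      (fun f _ => add_nonneg (abs_nonneg _) (abs_nonneg _)) hfF
  have hemp : √n * (empiricalDF (arResidual bhat μhat (obs v z ξ ω)) n x
          - empiricalDF (fun t => ε t ω) n x)
      = (√n)⁻¹ * ∑ t ∈ Finset.Icc (1 : ℤ) n,
        (step x (arResidual bhat μhat (obs v z ξ ω) t) - step x (ε t ω)) := by
    have h1 : √(n : ℝ) * (n : ℝ)⁻¹ = (√n)⁻¹ := by
      nth_rewrite 2 [← hss]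
      field_simp
    rw [Finset.sum_sub_distrib]
    unfold empiricalDF step
    rw [← mul_sub, ← mul_assoc, h1]
  have hdecomp : √n * (empiricalDF (arResidual bhat μhat (obs v z ξ ω)) n x
          - empiricalDF (fun t => ε t ω) n x)
        - deriv (cdf Q) x * delta b * τ - √n * q * shift b Q L x
      = ((√n)⁻¹ * ∑ t ∈ Finset.Icc (1 : ℤ) n,
          (step x (ε t ω - drift b θ τ (√n) (fun t => v t ω - μ) t) - step x (ε t ω))
        - deriv (cdf Q) x * delta b * τ)
      + ∑ i : Fin (p + 1), ((√n)⁻¹ * ∑ t ∈ Finset.Icc (1 : ℤ) n,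
          (step x (ε t ω - fullCoeff b i * (z (t - (i : ℕ)) ω * ξ (t - (i : ℕ)) ω))
            - step x (ε t ω))
        - √n * q * ((∫ u, cdf Q (x + fullCoeff b i * u) ∂L) - cdf Q x))
      + (√n)⁻¹ * ∑ t ∈ Finset.Icc (1 : ℤ) n, (step x (arResidual bhat μhat (obs v z ξ ω) t)
        - step x (ε t ω - drift b θ τ (√n) (fun t => v t ω - μ) t)
        - ∑ i : Fin (p + 1), (step x (ε t ω
            - fullCoeff b i * (z (t - (i : ℕ)) ω * ξ (t - (i : ℕ)) ω)) - step x (ε t ω))) := by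
    have hshift : shift b Q L x
        = ∑ i : Fin (p + 1), ((∫ u, cdf Q (x + fullCoeff b i * u) ∂L) - cdf Q x) := rfl
    have hcomm : ∑ t ∈ Finset.Icc (1 : ℤ) n, ∑ i : Fin (p + 1), (step x (ε t ω
            - fullCoeff b i * (z (t - (i : ℕ)) ω * ξ (t - (i : ℕ)) ω)) - step x (ε t ω))
        = ∑ i : Fin (p + 1), ∑ t ∈ Finset.Icc (1 : ℤ) n, (step x (ε t ω
            - fullCoeff b i * (z (t - (i : ℕ)) ω * ξ (t - (i : ℕ)) ω)) - step x (ε t ω)) :=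
      Finset.sum_comm
    rw [hemp, hshift, Finset.sum_sub_distrib (s := (Finset.univ : Finset (Fin (p + 1))))
      (f := fun i : Fin (p + 1) => (√n)⁻¹ * _), ← Finset.mul_sum, ← Finset.mul_sum, ← hcomm,
      Finset.sum_sub_distrib (s := Finset.Icc (1 : ℤ) n) (f := fun t =>
        step x (arResidual bhat μhat (obs v z ξ ω) t)
        - step x (ε t ω - drift b θ τ (√n) (fun t => v t ω - μ) t))]
    simp only [Finset.sum_sub_distrib (s := Finset.Icc (1 : ℤ) n)
      (f := fun t => step x (arResidual bhat μhat (obs v z ξ ω) t)),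
      Finset.sum_sub_distrib (s := Finset.Icc (1 : ℤ) n)
      (f := fun t => step x (ε t ω - drift b θ τ (√n) (fun t => v t ω - μ) t))]
    ring
  rw [hdecomp]
  unfold totalBound
  refine (abs_add_le _ _).trans (add_le_add ((abs_add_le _ _).trans (add_le_add ?_ ?_)) ?_)
  · exact hclean.trans (add_le_add hcell le_rfl)
  · exact Finset.abs_sum_le_sum_abs _ _
  · rw [abs_mul, abs_of_pos (inv_pos.2 hs0)]
    refine mul_le_mul_of_nonneg_left ?_ (inv_pos.2 hs0).le
    exact (Finset.abs_sum_le_sum_abs _ _).trans (Finset.sum_le_sum fun t _ => hres t)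

theorem IsModel.integral_totalBound_le [mΩ : MeasurableSpace Ω] {P : Measure Ω}
    [IsProbabilityMeasure P] {b : Fin p → ℝ} {μ ν : ℝ} {Q L : Measure ℝ}
    [IsProbabilityMeasure Q] [IsProbabilityMeasure L] {q : unitInterval}
    {ε v z ξ : ℤ → Ω → ℝ} (h : IsModel P b ν Q L q ε v z ξ) (hν : ν = delta b * μ)
    (hQ : MemLp id 2 Q) (hmean : ∫ s, s ∂Q = 0) (hδ : delta b ≠ 0)
    {C' ρ : ℝ} (hC' : 0 ≤ C') (hρ : 0 < ρ) (hρ1 : ρ < 1)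
    (hT : ∀ (m : ℕ) (u : Fin p → ℝ), ‖(companion b ^ m) u‖ ≤ C' * ρ ^ m * ‖u‖)
    (hG : Differentiable ℝ (cdf Q)) (hg : Differentiable ℝ (deriv (cdf Q))) {C : ℝ}
    (hC : ∀ s, |deriv (deriv (cdf Q)) s| ≤ C) {F : Finset (ℝ × (Fin p → ℝ))} {M η R : ℝ}
    (hF : ∀ f ∈ F, |f.1| ≤ M ∧ ∀ j, |f.2 j| ≤ M) (hM : 0 < M) (hη : 0 ≤ η) (hη1 : η ≤ 1)
    (hR : 0 < R) (x : ℝ) {n : ℕ} (hn : 1 ≤ n) {K K₂ r : ℝ} (hK : K = momentBound C' ρ Q)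
    (hK₂ : K₂ = 2 * (M + 1) ^ 2 * (p * (p * K) + (|delta b| + 1) ^ 2))
    (hr : r = (M + M * |delta b| + p * M ^ 2) / √n * (1 + 2 * p * R)) :
    Integrable (totalBound b Q L q μ x M η R n F ε v z ξ) P ∧
    ∫ ω, totalBound b Q L q μ x M η R n F ε v z ξ ω ∂P
      ≤ F.card * (2 * (√((1 + C) * √K₂ / √n) + C * K₂ / √n))
        + deriv (cdf Q) x * (M * (p * ((√(∫ s, s ^ 2 ∂Q)
              + ∑ j : Fin p, |b j| * ((j + 1) * (2 * √K))) / |delta b| / √n))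
            + η * (2 * |delta b| + 1 + p * √K))
        + (p + 1) * √q
        + √n * ((p + 1) * (q * (3 * r * (1 + C)) + q * (3 * r * (1 + C))
          + 2 * (p * (q * (K / R ^ 2) + q * ∫ u, large R u ∂L)))
        + (p + 2) * ((p + 1) * ((p + 1) * (q : ℝ) ^ 2))) := by
  subst hK
  have hn0 : (0 : ℝ) < n := by exact_mod_cast hn
  have hs0 : (0 : ℝ) < √n := Real.sqrt_pos.2 hn0
  have hss : √(n : ℝ) * √n = n := Real.mul_self_sqrt hn0.le
  have hcard : (Finset.Icc (1 : ℤ) n).card = n := by simp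
  have hr0 : 0 < r := by rw [hr]; positivity
  have hmom : ∀ (_ : Fin p) t, MemLp (fun ω => v t ω - μ) 2 P ∧
      ∫ ω, (v t ω - μ) ^ 2 ∂P ≤ momentBound C' ρ Q := fun i t =>
    h.solution.moment hν h.innovations hQ hC' hρ hρ1 hT i t
  have c1 := fun f (hf : f ∈ F) (κ : ℝ) (hκ : |κ| ≤ 1) =>
    h.solution.integral_abs_cellFluct_le hν h.innovations hQ hC' hρ hρ1 hT hG hg hC
      (hF f hf).1 (hF f hf).2 hκ x hn hK₂
  have hη' : |η| ≤ 1 := by rwa [abs_of_nonneg hη]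
  have hη'' : |(-η)| ≤ 1 := by rwa [abs_neg]
  have i1 : Integrable (fun ω => ∑ f ∈ F,
      (|cellFluct b (deriv (cdf Q) x) x n f η (fun t => v t ω - μ) (fun t => ε t ω)|
      + |cellFluct b (deriv (cdf Q) x) x n f (-η) (fun t => v t ω - μ) (fun t => ε t ω)|)) P :=
    integrable_finsetSum _ fun f hf => (c1 f hf η hη').1.add (c1 f hf (-η) hη'').1
  have c2 := h.solution.integral_meanError_le hν h.innovations hQ hmean hδ hmom hM.le hη hn
  have i2 : Integrable (fun ω => deriv (cdf Q) x * meanError b M η n (fun t => v t ω - μ)) P :=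
    c2.1.const_mul _
  have i3' : ∀ i : Fin (p + 1), Integrable (fun ω => |(√n)⁻¹ * ∑ t ∈ Finset.Icc (1 : ℤ) n,
          (step x (ε t ω - fullCoeff b i * (z (t - (i : ℕ)) ω * ξ (t - (i : ℕ)) ω))
            - step x (ε t ω))
        - √n * q * ((∫ u, cdf Q (x + fullCoeff b i * u) ∂L) - cdf Q x)|) P := by
    intro i
    refine (((integrable_finsetSum _ fun t _ => ?_).const_mul _).sub (integrable_const _)).abs
    refine integrable_of_abs_le (c := 1) ?_ fun ω => abs_step_sub_step_le_one _ _ _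
    exact ((measurable_step x).comp ((h.innovations.measurable t).sub
      (((h.bernoulli.measurable _).mul (h.outliers.measurable _)).const_mul _))).sub
        ((measurable_step x).comp (h.innovations.measurable t))
  have i3 := integrable_finsetSum (Finset.univ : Finset (Fin (p + 1))) fun i _ => i3' i
  have c4 := fun t => h.integral_remainderBound_le hG hg hC hmom hr0 hR x t
  have i4 : Integrable (fun ω => (√n)⁻¹ * ∑ t ∈ Finset.Icc (1 : ℤ) n,
      remainderBound b μ x r R ε v z ξ t ω) P :=
    (integrable_finsetSum _ fun t _ => (c4 t).1).const_mul _
  have htot : totalBound b Q L q μ x M η R n F ε v z ξ = fun ω =>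
      ∑ f ∈ F, (|cellFluct b (deriv (cdf Q) x) x n f η (fun t => v t ω - μ) (fun t => ε t ω)|
      + |cellFluct b (deriv (cdf Q) x) x n f (-η) (fun t => v t ω - μ) (fun t => ε t ω)|)
    + deriv (cdf Q) x * meanError b M η n (fun t => v t ω - μ)
    + ∑ i : Fin (p + 1), |(√n)⁻¹ * ∑ t ∈ Finset.Icc (1 : ℤ) n,
          (step x (ε t ω - fullCoeff b i * (z (t - (i : ℕ)) ω * ξ (t - (i : ℕ)) ω))
            - step x (ε t ω))
        - √n * q * ((∫ u, cdf Q (x + fullCoeff b i * u) ∂L) - cdf Q x)|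
    + (√n)⁻¹ * ∑ t ∈ Finset.Icc (1 : ℤ) n, remainderBound b μ x r R ε v z ξ t ω := by
    ext ω
    rw [totalBound, hr]
  have i12 := i1.add i2
  have i123 := i12.add i3
  rw [htot]
  refine ⟨i123.add i4, ?_⟩
  refine (integral_add i123 i4).le.trans (add_le_add ?_ ?_)
  · refine (integral_add i12 i3).le.trans (add_le_add ?_ ?_)
    · refine (integral_add i1 i2).le.trans (add_le_add ?_ ?_)
      · refine (integral_finsetSum _ fun f hf =>
          (c1 f hf η hη').1.add (c1 f hf (-η) hη'').1).le.trans ?_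
        rw [← nsmul_eq_mul, ← Finset.sum_const]
        refine Finset.sum_le_sum fun f hf => ?_
        refine (integral_add (c1 f hf η hη').1 (c1 f hf (-η) hη'').1).le.trans ?_
        rw [two_mul]
        exact add_le_add (c1 f hf η hη').2 (c1 f hf (-η) hη'').2
      · rw [integral_const_mul]
        exact mul_le_mul_of_nonneg_left c2.2 (deriv_cdf_nonneg x)
    · rw [integral_finsetSum _ fun i _ => i3' i]
      refine (Finset.sum_le_sum fun i _ =>
        h.integral_abs_sum_single_effect_le x (fullCoeff b i) (i : ℕ) hn).trans (le_of_eq ?_)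
      rw [Finset.sum_const, Finset.card_univ, Fintype.card_fin, nsmul_eq_mul]
      push_cast
      rfl
  · rw [integral_const_mul, integral_finsetSum _ fun t _ => (c4 t).1, inv_mul_le_iff₀ hs0,
      ← mul_assoc, hss]
    refine (Finset.sum_le_sum fun t _ => (c4 t).2).trans (le_of_eq ?_)
    rw [Finset.sum_const, hcard, nsmul_eq_mul]

/-- The part of the bound for the expected error that vanishes as `y = n ^ (-1/2)` tends to
zero. -/
noncomputable def vanishing (p : ℕ) (N C K₂ c g M Γ r : ℝ) (y : ℝ) : ℝ :=
  N * (2 * (√((1 + C) * √K₂ * y) + C * K₂ * y)) + g * (M * (p * (c * y))) + (p + 1) * √(Γ * y)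
    + (p + 1) * (2 * (Γ * (3 * (r * y) * (1 + C)))) + (p + 2) * ((p + 1) * ((p + 1) * (Γ * (Γ * y))))

theorem tendsto_vanishing (p : ℕ) (N C K₂ c g M Γ r : ℝ) :
    Tendsto (fun n : ℕ => vanishing p N C K₂ c g M Γ r (√n)⁻¹) atTop (𝓝 0) := by
  have h1 : Continuous (vanishing p N C K₂ c g M Γ r) := by
    unfold vanishing
    fun_prop
  have h2 : vanishing p N C K₂ c g M Γ r 0 = 0 := by simp [vanishing]
  have h3 : Tendsto (fun n : ℕ => (√(n : ℝ))⁻¹) atTop (𝓝 0) :=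
    tendsto_inv_atTop_zero.comp (Real.tendsto_sqrt_atTop.comp tendsto_natCast_atTop_atTop)
  have := (h1.tendsto 0).comp h3
  rwa [h2] at this

/-- Markov's inequality for `Y` outside the exceptional sets `A` and `B`. -/
theorem measure_lt_le_of_ae_le [mΩ : MeasurableSpace Ω] {P : Measure Ω} [IsProbabilityMeasure P]
    {X Y : Ω → ℝ} {A B : Set Ω} {δ E : ℝ} (hδ : 0 < δ) (hY0 : ∀ ω, 0 ≤ Y ω) (hY : Integrable Y P)
    (hE : ∫ ω, Y ω ∂P ≤ E) (h : ∀ᵐ ω ∂P, ω ∉ A → ω ∉ B → X ω ≤ Y ω) :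
    P {ω | δ < X ω} ≤ P A + P B + ENNReal.ofReal (E / δ) := by
  have h1 : P {ω | δ < X ω} ≤ P (A ∪ B ∪ {ω | δ ≤ Y ω}) := by
    refine measure_mono_ae ?_
    filter_upwards [h] with ω hω hX
    change δ < X ω at hX
    by_cases hA : ω ∈ A
    · exact Or.inl (Or.inl hA)
    by_cases hB : ω ∈ B
    · exact Or.inl (Or.inr hB)
    exact Or.inr (hX.le.trans (hω hA hB))
  refine h1.trans ((measure_union_le _ _).trans (add_le_add (measure_union_le _ _) ?_))
  have h2 := mul_meas_ge_le_integral_of_nonneg (ae_of_all P hY0) hY δ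
  rw [← ofReal_measureReal]
  refine ENNReal.ofReal_le_ofReal ?_
  rw [le_div_iff₀ hδ, mul_comm]
  exact h2.trans hE

theorem remainderBound_nonneg (b : Fin p → ℝ) (μ x r R : ℝ) (ε v z ξ : ℤ → Ω → ℝ) (t : ℤ)
    (ω : Ω) : 0 ≤ remainderBound b μ x r R ε v z ξ t ω := by
  unfold remainderBound
  refine add_nonneg (Finset.sum_nonneg fun i _ => ?_) (mul_nonneg (by positivity)
    (Finset.sum_nonneg fun i _ => Finset.sum_nonneg fun k _ => ?_))
  · refine add_nonneg (add_nonneg (mul_nonneg (occ_nonneg _) (near_nonneg _ _))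
      (mul_nonneg (occ_nonneg _) (near_nonneg _ _))) (mul_nonneg zero_le_two
        (Finset.sum_nonneg fun j _ => add_nonneg (mul_nonneg (occ_nonneg _) (large_nonneg _ _))
          (mul_nonneg (occ_nonneg _) (large_nonneg _ _))))
  · split_ifs
    · exact le_rfl
    · exact mul_nonneg (occ_nonneg _) (occ_nonneg _)

theorem totalBound_nonneg {M η : ℝ} (hM : 0 ≤ M) (hη : 0 ≤ η) (b : Fin p → ℝ) (Q L : Measure ℝ)
    (q : unitInterval) (μ x R : ℝ) (n : ℕ) (F : Finset (ℝ × (Fin p → ℝ)))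
    (ε v z ξ : ℤ → Ω → ℝ) (ω : Ω) : 0 ≤ totalBound b Q L q μ x M η R n F ε v z ξ ω := by
  have h1 : 0 ≤ meanError b M η n (fun t => v t ω - μ) := by
    unfold meanError
    positivity
  have h2 := deriv_cdf_nonneg (Q := Q) x
  have h3 := Finset.sum_nonneg fun t (_ : t ∈ Finset.Icc (1 : ℤ) n) => remainderBound_nonneg b μ x
    ((M + M * |delta b| + p * M ^ 2) / √n * (1 + 2 * p * R)) R ε v z ξ t ω
  unfold totalBound
  positivity

end Assembly

/-! ### Bounds uniform in the contamination level. -/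

section Limit

/-- Through `√n q = γ ≤ Γ` every term becomes a function of `n^{-1/2}` and `Γ`, except the mesh
term, proportional to `η`, and the tail term, governed by `R`. -/
theorem expectedError_le {p : ℕ} {N C K K₂ c g M Γ R r r₁ η c₂ ℓ γ q s : ℝ} (hs : 0 < s)
    (hq : s * q = γ) (hγ : γ ≤ Γ) (hγ0 : 0 ≤ γ) (hC : 0 ≤ C) (hK : 0 ≤ K) (hℓ : 0 ≤ ℓ)
    (hr0 : 0 ≤ r₁) (hr : r = r₁ * s⁻¹) :
    N * (2 * (√((1 + C) * √K₂ / s) + C * K₂ / s)) + g * (M * (p * (c / s)) + η * c₂)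
        + (p + 1) * √q
        + s * ((p + 1) * (q * (3 * r * (1 + C)) + q * (3 * r * (1 + C))
          + 2 * (p * (q * (K / R ^ 2) + q * ℓ)))
        + (p + 2) * ((p + 1) * ((p + 1) * q ^ 2)))
      ≤ vanishing p N C K₂ c g M Γ r₁ s⁻¹ + g * c₂ * η
        + 2 * (p + 1) * p * Γ * (K / R ^ 2 + ℓ) := by
  have hq' : q = γ * s⁻¹ := by rw [← hq]; field_simp
  have hs' : 0 < s⁻¹ := inv_pos.2 hs
  have hsq : √q ≤ √(Γ * s⁻¹) := by
    rw [hq']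
    exact Real.sqrt_le_sqrt (by gcongr)
  have e1 : s * ((p + 1) * (q * (3 * r * (1 + C)) + q * (3 * r * (1 + C))
          + 2 * (p * (q * (K / R ^ 2) + q * ℓ)))
        + (p + 2) * ((p + 1) * ((p + 1) * q ^ 2)))
      = (p + 1) * (2 * (γ * (3 * (r₁ * s⁻¹) * (1 + C))))
        + 2 * (p + 1) * p * γ * (K / R ^ 2 + ℓ)
        + (p + 2) * ((p + 1) * ((p + 1) * (γ * (γ * s⁻¹)))) := by
    rw [hr, ← hq]
    field_simp
    ring
  have e2 : (p + 1 : ℝ) * (2 * (γ * (3 * (r₁ * s⁻¹) * (1 + C))))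
      ≤ (p + 1) * (2 * (Γ * (3 * (r₁ * s⁻¹) * (1 + C)))) := by gcongr
  have e3 : 2 * (p + 1 : ℝ) * p * γ * (K / R ^ 2 + ℓ) ≤ 2 * (p + 1) * p * Γ * (K / R ^ 2 + ℓ) := by
    gcongr
  have e4 : (p + 2 : ℝ) * ((p + 1) * ((p + 1) * (γ * (γ * s⁻¹))))
      ≤ (p + 2) * ((p + 1) * ((p + 1) * (Γ * (Γ * s⁻¹)))) := by
    gcongr
    exact hγ0.trans hγ
  have e5 : (p + 1 : ℝ) * √q ≤ (p + 1) * √(Γ * s⁻¹) := by gcongr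
  rw [e1]
  unfold vanishing
  simp only [div_eq_mul_inv] at *
  linarith

theorem exists_outlier_cutoff (L : Measure ℝ) [IsProbabilityMeasure L] (K A : ℝ) {e : ℝ}
    (he : 0 < e) : ∃ R : ℝ, 0 < R ∧ A * (K / R ^ 2 + ∫ u, large R u ∂L) < e := by
  have h1 : Tendsto (fun k : ℕ => K / (k : ℝ) ^ 2) atTop (𝓝 0) :=
    tendsto_const_nhds.div_atTop
      ((tendsto_pow_atTop two_ne_zero).comp tendsto_natCast_atTop_atTop)
  have h2 := (h1.add (tendsto_integral_large L)).const_mul A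
  rw [add_zero, mul_zero] at h2
  obtain ⟨k, hk1, hk2⟩ := ((h2.eventually (gt_mem_nhds he)).and (eventually_gt_atTop 0)).exists
  exact ⟨k, by exact_mod_cast hk2, hk1⟩

end Limit

end AROutliers

/-! ### The main theorem. -/

open AROutliers

theorem mainTheorem1 (p : ℕ) (b : Fin p → ℝ) (hb : AROutliers.CharRootsInsideDisk b)
    (μ ν : ℝ) (hν : ν = AROutliers.delta b * μ)
    (Q : Measure ℝ) [IsProbabilityMeasure Q]
    (hQ_sq : MemLp id 2 Q) (hQ_mean : ∫ s, s ∂Q = 0) (hQ_var : 0 < ∫ s, s ^ 2 ∂Q)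
    (L : Measure ℝ) [IsProbabilityMeasure L]
    (hG : Differentiable ℝ (cdf Q)) (hg : Differentiable ℝ (deriv (cdf Q)))
    (hg' : ∃ C : ℝ, ∀ s, |deriv (deriv (cdf Q)) s| ≤ C)
    (Γ : ℝ) (hΓ : 0 ≤ Γ)
    {Ω : ℝ → ℕ → Type*} [∀ γ n, MeasurableSpace (Ω γ n)]
    (P : ∀ γ n, Measure (Ω γ n)) [∀ γ n, IsProbabilityMeasure (P γ n)]
    (ε v z ξ : ∀ γ n, ℤ → Ω γ n → ℝ)
    (hmodel : ∀ γ ∈ Set.Icc 0 Γ, ∀ n : ℕ, 1 ≤ n →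
      AROutliers.IsModel (P γ n) b ν Q L (AROutliers.outlierProb γ n)
        (ε γ n) (v γ n) (z γ n) (ξ γ n))
    (μhat : ∀ γ n, Ω γ n → ℝ) (hμhat_meas : ∀ γ n, Measurable (μhat γ n))
    (bhat : ∀ γ n, Ω γ n → Fin p → ℝ) (hbhat_meas : ∀ γ n, Measurable (bhat γ n))
    (hμhat : AROutliers.IsBoundedInProbUniformly P Γ
      (fun γ n ω => Real.sqrt n * (μhat γ n ω - μ)))
    (hbhat : AROutliers.IsBoundedInProbUniformly P Γ
      (fun γ n ω => Real.sqrt n • (bhat γ n ω - b)))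
    (x : ℝ) (δ : ℝ) (hδ : 0 < δ) :
    Tendsto
      (fun n : ℕ => ⨆ γ ∈ Set.Icc 0 Γ, P γ n {ω | δ <
        |Real.sqrt n *
            (AROutliers.empiricalDF
                (AROutliers.arResidual (bhat γ n ω) (μhat γ n ω)
                  (AROutliers.obs (v γ n) (z γ n) (ξ γ n) ω)) n x
              - AROutliers.empiricalDF (fun t => ε γ n t ω) n x)
          - deriv (cdf Q) x * AROutliers.delta b * (Real.sqrt n * (μhat γ n ω - μ))
          - γ * AROutliers.shift b Q L x|})
      atTop (𝓝 0) := by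
  obtain ⟨C, hC⟩ := hg'
  have hC0 : 0 ≤ C := (abs_nonneg _).trans (hC 0)
  obtain ⟨C', ρ, hC', hρ, hρ1, hT⟩ := hb.exists_norm_companion_pow_le
  have hδb := hb.delta_ne_zero
  rw [ENNReal.tendsto_nhds_zero]
  intro e he
  -- A finite `ζ` below the target, which may be infinite, is divided into thirds: one for each
  -- estimator leaving its ball and one for Markov's inequality.
  obtain ⟨ζ, hζ0, hζe⟩ := ENNReal.lt_iff_exists_nnreal_btwn.1 he
  have hζ : (0 : ℝ) < ζ := by exact_mod_cast hζ0
  obtain ⟨M₁, N₁, h₁⟩ := hμhat (ζ / 3) (by positivity)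
  obtain ⟨M₂, N₂, h₂⟩ := hbhat (ζ / 3) (by positivity)
  -- The `1` ensures a positive `M` and hence a positive window width in the remainder bound.
  set M : ℝ := max 1 (max M₁ M₂) with hMdef
  have hM : 0 < M := lt_of_lt_of_le one_pos (le_max_left _ _)
  have hM₁ : M₁ ≤ M := (le_max_left _ _).trans (le_max_right _ _)
  have hM₂ : M₂ ≤ M := (le_max_right _ _).trans (le_max_right _ _)
  set K : ℝ := momentBound C' ρ Q with hK
  have hK0 : 0 ≤ K := momentBound_nonneg _ _ _
  set K₂ : ℝ := 2 * (M + 1) ^ 2 * (p * (p * K) + (|delta b| + 1) ^ 2) with hK₂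
  set g : ℝ := deriv (cdf Q) x with hgdef
  have hg0 : 0 ≤ g := deriv_cdf_nonneg x
  set c₂ : ℝ := 2 * |delta b| + 1 + p * √K with hc₂
  have hc₂0 : 0 ≤ c₂ := by positivity
  set c : ℝ := (√(∫ s, s ^ 2 ∂Q) + ∑ j : Fin p, |b j| * ((j + 1) * (2 * √K))) / |delta b| with hc
  have htol : 0 < δ * (ζ / 3) / 3 := by positivity
  -- The mesh term takes one third of the expectation budget `δ ζ / 3`. The `+ 1` avoids division by
  -- zero when `g(x) = 0`, and `η ≤ 1` is what the moment bound for `cellDrift` requires.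
  set η : ℝ := min 1 (δ * (ζ / 3) / 3 / (g * c₂ + 1)) with hη
  have hη0 : 0 < η := lt_min one_pos (by positivity)
  have hη1 : η ≤ 1 := min_le_left _ _
  have hη2 : g * c₂ * η ≤ δ * (ζ / 3) / 3 := by
    calc g * c₂ * η ≤ (g * c₂ + 1) * (δ * (ζ / 3) / 3 / (g * c₂ + 1)) := by
          gcongr
          · linarith
          · exact min_le_right _ _
      _ = δ * (ζ / 3) / 3 := by field_simp
  obtain ⟨R, hR, hR2⟩ := exists_outlier_cutoff L K (2 * (p + 1) * p * Γ) htol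
  obtain ⟨F, hF, hnet⟩ := exists_finite_net p M hη0
  set r₁ : ℝ := (M + M * |delta b| + p * M ^ 2) * (1 + 2 * p * R) with hr₁
  have hvan := (tendsto_vanishing p F.card C K₂ c g M Γ r₁).eventually (gt_mem_nhds htol)
  have hsqrt : Tendsto (fun n : ℕ => √(n : ℝ)) atTop atTop :=
    Real.tendsto_sqrt_atTop.comp tendsto_natCast_atTop_atTop
  -- With `M`, `η`, `R` and the net fixed, `n` comes last: the vanishing terms take the remaining
  -- third, `√n ≥ Γ` makes `√n γ_n = γ` for all admissible `γ`, and `√n ≥ p M² / η` absorbs the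
  -- bilinear term of the drift.
  filter_upwards [hvan, hsqrt.eventually_ge_atTop Γ, hsqrt.eventually_ge_atTop (p * M ^ 2 / η),
    eventually_ge_atTop 1, eventually_ge_atTop N₁, eventually_ge_atTop N₂]
    with n hvn hΓn hpn hn hnN₁ hnN₂
  have hs0 : (0 : ℝ) < √n := Real.sqrt_pos.2 (by exact_mod_cast hn)
  have hsmall : p * M ^ 2 / √n ≤ η := by
    rw [div_le_iff₀ hη0] at hpn
    rw [div_le_iff₀ hs0]
    linarith
  refine (iSup₂_le fun γ hγ => ?_).trans hζe.le
  have hm := hmodel γ hγ n hn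
  have hq := sqrt_mul_outlierProb hγ.1 hn (hγ.2.trans hΓn)
  have hexp := hm.integral_totalBound_le hν hQ_sq hQ_mean hδb hC' hρ hρ1 hT hG hg hC hF hM hη0.le
    hη1 hR x hn hK hK₂ rfl
  have hE := hexp.2.trans (expectedError_le (r₁ := r₁) hs0 hq hγ.2 hγ.1 hC0 hK0
    (integral_nonneg fun u => large_nonneg R u) (by positivity) (by rw [hr₁]; ring))
  have hE' : ∫ ω, totalBound b Q L (outlierProb γ n) μ x M η R n F (ε γ n) (v γ n) (z γ n)
      (ξ γ n) ω ∂(P γ n) ≤ δ * (ζ / 3) := by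
    refine hE.trans ?_
    linarith
  refine (measure_lt_le_of_ae_le (A := {ω | M₁ < ‖√n * (μhat γ n ω - μ)‖})
    (B := {ω | M₂ < ‖√n • (bhat γ n ω - b)‖}) hδ
    (totalBound_nonneg hM.le hη0.le b Q L (outlierProb γ n) μ x R n F _ _ _ _) hexp.1 hE' ?_).trans
    ?_
  · filter_upwards [hm.solution.recursion_centred hν, hm.ae_eq_zero_or_one] with ω hω hz hA hB
    have hA' : ‖√n * (μhat γ n ω - μ)‖ ≤ M := (not_lt.1 hA).trans hM₁
    have hB' : ‖√n • (bhat γ n ω - b)‖ ≤ M := (not_lt.1 hB).trans hM₂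
    have := abs_expansion_error_le (ξ := ξ γ n) (L := L) (q := outlierProb γ n) (R := R) (Q := Q) (x := x)
      hn hF hnet hsmall hω hz hA' hB'
    rwa [hq] at this
  · calc _ ≤ ENNReal.ofReal (ζ / 3) + ENNReal.ofReal (ζ / 3) + ENNReal.ofReal (ζ / 3) := by
          refine add_le_add (add_le_add (h₁ n hnN₁ γ hγ) (h₂ n hnN₂ γ hγ)) (le_of_eq ?_)
          congr 1
          field_simp
      _ = ζ := by
          rw [← ENNReal.ofReal_add (by positivity) (by positivity),
            ← ENNReal.ofReal_add (by positivity) (by positivity)]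
          rw [add_thirds, ENNReal.ofReal_coe_nnreal]
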